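/- An instance consists of $n\ge 1$ jobs with processing times $p_1,\dots,p_n\in\mathbb N_{>0}$, a partition of the jobs into $k$ classes $C_1,\dots,C_k$, a number $m\ge 1$ of identical machines, and a setup time $s\in\mathbb N_{>0}$. In a schedule every job is processed without preemption on one machine, and a machine processes at most one job at a time. A setup of length $s$, during which the machine is blocked, has to take place on a machine before its first job and whenever it switches from a job of one class to a job of another class. The makespan is the maximum completion time of a job; $\mathrm{OPT}$ denotes the smallest makespan of a feasible schedule, and $p_{\max}=\max_j p_j$. Let $\varepsilon>0$ and $\gamma$ be real constants. Then there is an algorithm that, for every instance in which every class satisfies $\sum_{j\in C_i}p_j\le\gamma\cdot\mathrm{OPT}$, computes a feasible non-preemptive schedule of makespan at most \[(1+\varepsilon)\cdot\min\left\{\tfrac32\,\mathrm{OPT},\ \mathrm{OPT}+p_{\max}-1\right\},\] and whose running time is polynomial in $n$, $k$ and $m$ (for fixed $\varepsilon$ and $\gamma$), counted in steps of a random access machine with unit-cost addition, subtraction and tests for zero on natural numbers. -/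

import Mathlib

/-! ## The scheduling problem -/

/-- An instance: `n ≥ 1` jobs, `k` classes, `m ≥ 1` identical machines, setup time `s`,
processing times `p`, and the class `cls j` of every job `j`. -/
structure SetupInstance where
  n : ℕ
  k : ℕ
  m : ℕ
  s : ℕ
  p : Fin n → ℕ
  cls : Fin n → Fin k
  n_pos : 0 < n
  m_pos : 0 < m
  s_pos : 0 < s
  p_pos : ∀ j, 0 < p j

namespace SetupInstance

/-- The workload `w(C_i)` of class `i`: the total processing time of its jobs. -/
def workload (I : SetupInstance) (i : Fin I.k) : ℕ :=
  ∑ j : Fin I.n, if I.cls j = i then I.p j else 0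

/-- The processing time of the largest job. -/
def pmax (I : SetupInstance) : ℕ :=
  Finset.univ.sup I.p

/-- The setup time needed between job `i` and a later job `j` on the same machine. -/
def switchTime (I : SetupInstance) (i j : Fin I.n) : ℕ :=
  if I.cls i = I.cls j then 0 else I.s

/-- A non-preemptive schedule: every job gets one machine and one starting time, and then
occupies this machine during `[start j, start j + p j)`. -/
structure Schedule (I : SetupInstance) where
  machine : Fin I.n → Fin I.m
  start : Fin I.n → ℕ

/-- Feasibility: a setup takes place before the first job of every machine, jobs on the same
machine do not overlap, and between two jobs of different classes on the same machine there is
room for a setup. (Imposed on all pairs of jobs of a machine; this is the same as imposing it on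
pairs of consecutive jobs, where the machine is switched over.) -/
def Schedule.Feasible {I : SetupInstance} (S : I.Schedule) : Prop :=
  (∀ j, I.s ≤ S.start j) ∧
  ∀ i j, i ≠ j → S.machine i = S.machine j →
    S.start i + I.p i + I.switchTime i j ≤ S.start j ∨
    S.start j + I.p j + I.switchTime j i ≤ S.start i

/-- The makespan: the largest completion time of a job. -/
def Schedule.makespan {I : SetupInstance} (S : I.Schedule) : ℕ :=
  Finset.univ.sup fun j => S.start j + I.p j

/-- The optimal makespan. -/
noncomputable def opt (I : SetupInstance) : ℕ :=
  sInf {T | ∃ S : I.Schedule, S.Feasible ∧ S.makespan = T}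

/-- Feasible schedules exist, so the optimal makespan is a minimum. -/
theorem opt_isLeast (I : SetupInstance) :
    IsLeast {T | ∃ S : I.Schedule, S.Feasible ∧ S.makespan = T} I.opt := by
  have key : ∀ i j : Fin I.n, i < j →
      I.s + i * (I.s + I.pmax) + I.p i + I.switchTime i j ≤ I.s + j * (I.s + I.pmax) := by
    intro i j hij
    have h1 : I.p i ≤ I.pmax := Finset.le_sup (f := I.p) (Finset.mem_univ i)
    have h2 : I.switchTime i j ≤ I.s := by
      unfold switchTime
      split_ifs <;> omega
    have h3 : (i : ℕ) + 1 ≤ j := hij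
    have h4 := Nat.mul_le_mul_right (I.s + I.pmax) h3
    rw [Nat.add_mul, Nat.one_mul] at h4
    omega
  have hne : {T | ∃ S : I.Schedule, S.Feasible ∧ S.makespan = T}.Nonempty := by
    refine ⟨_, ⟨fun _ => ⟨0, I.m_pos⟩, fun j => I.s + j * (I.s + I.pmax)⟩, ⟨?_, ?_⟩, rfl⟩
    · intro j
      exact Nat.le_add_right _ _
    · intro i j hij _
      rcases lt_or_gt_of_ne hij with h | h
      · exact Or.inl (key i j h)
      · exact Or.inr (key j i h)
  exact ⟨Nat.sInf_mem hne, fun T hT => Nat.sInf_le hT⟩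

end SetupInstance

/-! ## The machine model

A unit-cost random access machine with structured control flow. Its memory consists of
arrays of natural numbers with indices in `ℕ`; a program names only finitely many arrays.
The only arithmetic operations are addition and (truncated) subtraction, so that the unit-cost
measure is realistic: the bit length of a number grows by at most a constant per step. -/

namespace RAM

/-- Memory contents: `σ a i` is the entry with index `i` of the array `a`. -/
abbrev Store := ℕ → ℕ → ℕ

/-- Expressions; `get a e` reads the entry of the array `a` whose index is the value of `e`. -/
inductive Expr where
  | lit (v : ℕ)
  | get (a : ℕ) (e : Expr)
  | add (e f : Expr)
  | sub (e f : Expr)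

/-- The value of an expression. -/
def Expr.eval (σ : Store) : Expr → ℕ
  | .lit v => v
  | .get a e => σ a (e.eval σ)
  | .add e f => e.eval σ + f.eval σ
  | .sub e f => e.eval σ - f.eval σ

/-- The number of steps that evaluating an expression takes: one for each operation. -/
def Expr.cost : Expr → ℕ
  | .lit _ => 1
  | .get _ e => e.cost + 1
  | .add e f => e.cost + f.cost + 1
  | .sub e f => e.cost + f.cost + 1

/-- Programs. `put a e f` stores the value of `f` in the array `a` at the index given by `e`;
`branch e P Q` runs `P` if `e` is nonzero, and `Q` otherwise; `loop e P` repeats `P` as long as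
`e` is nonzero. -/
inductive Program where
  | skip
  | put (a : ℕ) (e f : Expr)
  | seq (P Q : Program)
  | branch (e : Expr) (P Q : Program)
  | loop (e : Expr) (P : Program)

/-- The memory after storing `v` in the array `a` at index `i`. -/
def Store.write (σ : Store) (a i v : ℕ) : Store :=
  fun b l => if b = a ∧ l = i then v else σ b l

/-- `Runs P σ t τ`: started with memory `σ`, the program `P` halts after exactly `t` steps with
memory `τ`. -/
inductive Runs : Program → Store → ℕ → Store → Prop where
  | skip (σ : Store) : Runs .skip σ 1 σ
  | put (a : ℕ) (e f : Expr) (σ : Store) :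
      Runs (.put a e f) σ (e.cost + f.cost + 1) (σ.write a (e.eval σ) (f.eval σ))
  | seq {P Q : Program} {σ τ υ : Store} {t u : ℕ} :
      Runs P σ t τ → Runs Q τ u υ → Runs (.seq P Q) σ (t + u) υ
  | branch_true {e : Expr} {P Q : Program} {σ τ : Store} {t : ℕ} :
      e.eval σ ≠ 0 → Runs P σ t τ → Runs (.branch e P Q) σ (e.cost + 1 + t) τ
  | branch_false {e : Expr} {P Q : Program} {σ τ : Store} {t : ℕ} :
      e.eval σ = 0 → Runs Q σ t τ → Runs (.branch e P Q) σ (e.cost + 1 + t) τ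
  | loop_done {e : Expr} {P : Program} {σ : Store} :
      e.eval σ = 0 → Runs (.loop e P) σ (e.cost + 1) σ
  | loop_step {e : Expr} {P : Program} {σ τ υ : Store} {t u : ℕ} :
      e.eval σ ≠ 0 → Runs P σ t τ → Runs (.loop e P) τ u υ →
      Runs (.loop e P) σ (e.cost + 1 + t + u) υ

/-- The machine is deterministic: the running time and the final memory are determined by the
program and the initial memory. -/
theorem Runs.unique {P : Program} {σ τ τ' : Store} {t t' : ℕ}
    (h : Runs P σ t τ) (h' : Runs P σ t' τ') : t = t' ∧ τ = τ' := by
  induction h generalizing t' τ' with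
  | skip σ => cases h'; exact ⟨rfl, rfl⟩
  | put a e f σ => cases h'; exact ⟨rfl, rfl⟩
  | seq _ _ ih1 ih2 =>
    cases h' with
    | seq k1 k2 =>
      obtain ⟨rfl, rfl⟩ := ih1 k1
      obtain ⟨rfl, rfl⟩ := ih2 k2
      exact ⟨rfl, rfl⟩
  | branch_true he _ ih =>
    cases h' with
    | branch_true _ k =>
      obtain ⟨rfl, rfl⟩ := ih k
      exact ⟨rfl, rfl⟩
    | branch_false hn _ => exact absurd hn he
  | branch_false he _ ih =>
    cases h' with
    | branch_true hn _ => exact absurd he hn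
    | branch_false _ k =>
      obtain ⟨rfl, rfl⟩ := ih k
      exact ⟨rfl, rfl⟩
  | loop_done he =>
    cases h' with
    | loop_done _ => exact ⟨rfl, rfl⟩
    | loop_step hn _ _ => exact absurd he hn
  | loop_step he _ _ ih1 ih2 =>
    cases h' with
    | loop_done hn => exact absurd hn he
    | loop_step _ k1 k2 =>
      obtain ⟨rfl, rfl⟩ := ih1 k1
      obtain ⟨rfl, rfl⟩ := ih2 k2
      exact ⟨rfl, rfl⟩

end RAM

namespace SetupInstance

/-- The initial memory for an instance: array `0` holds `n, k, m, s`, array `1` the processing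
times, and array `2` the (indices of the) classes of the jobs; everything else is `0`. -/
def input (I : SetupInstance) : RAM.Store := fun a i =>
  if a = 0 then
    if i = 0 then I.n else if i = 1 then I.k else if i = 2 then I.m else if i = 3 then I.s else 0
  else if a = 1 then
    if h : i < I.n then I.p ⟨i, h⟩ else 0
  else if a = 2 then
    if h : i < I.n then I.cls ⟨i, h⟩ else 0
  else 0

/-- The memory `τ` contains the schedule `S` as output: array `3` holds the machines of the jobs
and array `4` their starting times. -/
def Schedule.IsOutput {I : SetupInstance} (S : I.Schedule) (τ : RAM.Store) : Prop :=
  ∀ j : Fin I.n, τ 3 j = S.machine j ∧ τ 4 j = S.start j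

end SetupInstance

/-!
The algorithm is a polynomial-time approximation scheme: it computes a schedule of makespan at most
`(1 + ε) * opt`. Since `pmax ≥ 1`, this is at most `1 + ε` times either term of the minimum.

**Loads.** Up to the order of the jobs on the machines, a schedule is an assignment of the jobs to
the machines. The optimal makespan is the least possible maximum of the loads `mload`, where the load
of a machine is the total size of its jobs plus one setup for each class among them
(`SetupInstance.exists_mload_le_opt`, `SetupInstance.exists_schedule`).

**Grouping.** All sizes are multiplied by a constant, and for a scale `g` it is decided approximately
whether there is an assignment with loads of at most `T = 2 * e ^ 4 * g`. The jobs, listed by class,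
are grouped into items (`Form`): a large job is an item of its own, and small jobs are put one after
the other into containers that are closed when they are large enough. If setups are short compared
with `g`, a container may have jobs of several classes, and the setups are included in the sizes of
the items. If setups are long, a container has jobs of one class only, which is the label of the
item, and every label on a machine costs a setup. The sizes of the items, and in the second case the
setup time, are rounded up to multiples of `g`. If the jobs can be assigned with loads of at most `T`, then the items
can be assigned such that the rounded loads are at most `C * g`, where `C = 2 * e ^ 4 + 24 * e ^ 3`
(`Form.Inv.exists_small`, `Form.Inv.exists_large`). The proofs distribute the containers greedily
over the machines (`exists_greedy`), in the room that the small jobs have taken. Conversely, an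
assignment of the items with rounded loads of at most `C * g` gives one of the jobs with loads of at
most `C * g` (`Form.Inv.load_le`).

**Dynamic program.** In units of `g`, the rounded loads are integers between `0` and the constant
`C`. Assigning the items in the order of their labels, it only matters how many machines there are of
every load, with or without a setup for the label at hand. These numbers are encoded as the digits of
`key`, for which there are polynomially many values, and equal keys allow for equal continuations
(`exists_exchange`). So one state per key suffices (`exec_solveCmd`).

**Search.** The scales `g = u, 2 * u, …` are tried out, where `u = s + pmax ≤ opt` is so small that
stopping at the first success costs only a factor `1 + 1 / e` (`exec_searchCmd`, `mul_load_le`).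

**Running time.** The program is written in a language (`RAM.Cmd`) in which every loop runs the same
number `B` of times, where `B` is `n + k + m` plus a constant. Its running time is therefore bounded
by a polynomial in `B` that can be read off from the text of the program (`RAM.Cmd.runs_compile`).
-/

/-! ### Programs with bounded loops -/

namespace RAM

/-- Programs in which every loop runs a number `B` of times that is fixed in advance, so that
they always halt, in time polynomial in `B`. -/
inductive Cmd where
  | skip
  | put (a : ℕ) (e f : Expr)
  | seq (c d : Cmd)
  | ite (e : Expr) (c d : Cmd)
  | rep (c : Cmd)

namespace Cmd

/-- The effect of a bounded-loop program on the memory. -/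
def exec (B : ℕ) : Cmd → Store → Store
  | .skip => fun σ => σ
  | .put a e f => fun σ => σ.write a (e.eval σ) (f.eval σ)
  | .seq c d => fun σ => d.exec B (c.exec B σ)
  | .ite e c d => fun σ => if e.eval σ = 0 then d.exec B σ else c.exec B σ
  | .rep c => (c.exec B)^[B]

/-- A polynomial in the number of loop iterations that bounds the running time. -/
noncomputable def time : Cmd → Polynomial ℕ
  | .skip => 1
  | .put _ e f => Polynomial.C (e.cost + f.cost + 1)
  | .seq c d => c.time + d.time
  | .ite e c d => Polynomial.C (e.cost + 1) + c.time + d.time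
  | .rep c => (c.time + 10) * Polynomial.X + 10

/-- The arrays that a program may write to. -/
def mods : Cmd → List ℕ
  | .skip => []
  | .put a _ _ => [a]
  | .seq c d => c.mods ++ d.mods
  | .ite _ c d => c.mods ++ d.mods
  | .rep c => c.mods

end Cmd

/-- Renumbering of the arrays that leaves the input and output arrays in place and keeps
array `5` free for the loop counters. -/
def emb (a : ℕ) : ℕ := if a < 5 then a else a + 1

theorem emb_inj {a b : ℕ} : emb a = emb b ↔ a = b := by
  unfold emb; split_ifs <;> omega

theorem emb_ne_five (a : ℕ) : emb a ≠ 5 := by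
  unfold emb; split_ifs <;> omega

/-- The expression with its arrays renumbered by `emb`. -/
def Expr.rename : Expr → Expr
  | .lit v => .lit v
  | .get a e => .get (emb a) e.rename
  | .add e f => .add e.rename f.rename
  | .sub e f => .sub e.rename f.rename

theorem Expr.cost_rename (e : Expr) : e.rename.cost = e.cost := by
  induction e <;> simp_all [Expr.rename, Expr.cost]

theorem Expr.eval_rename {σ ρ : Store} (h : ∀ a, ρ (emb a) = σ a) (e : Expr) :
    e.rename.eval ρ = e.eval σ := by
  induction e <;> simp_all [Expr.rename, Expr.eval]

/-- Translation to the machine. Cell `0` of array `5` holds the number of iterations of all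
loops, and cell `d + 1` the counter of the loops at nesting depth `d`. -/
def Cmd.compile : Cmd → ℕ → Program
  | .skip, _ => .skip
  | .put a e f, _ => .put (emb a) e.rename f.rename
  | .seq c c', d => .seq (c.compile d) (c'.compile d)
  | .ite e c c', d => .branch e.rename (c.compile d) (c'.compile d)
  | .rep c, d => .seq (.put 5 (.lit (d + 1)) (.get 5 (.lit 0)))
      (.loop (.get 5 (.lit (d + 1)))
        (.seq (c.compile (d + 1)) (.put 5 (.lit (d + 1)) (.sub (.get 5 (.lit (d + 1))) (.lit 1)))))

/-- The translation of a bounded-loop program halts within the polynomial time bound, with the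
memory that `exec` prescribes. The counters of the enclosing loops are preserved. -/
theorem Cmd.runs_compile {B : ℕ} (c : Cmd) : ∀ (d : ℕ) (σ ρ : Store),
    (∀ a, ρ (emb a) = σ a) → ρ 5 0 = B →
    ∃ t ρ', Runs (c.compile d) ρ t ρ' ∧ t ≤ c.time.eval B ∧
      (∀ a, ρ' (emb a) = c.exec B σ a) ∧ ∀ l ≤ d, ρ' 5 l = ρ 5 l := by
  induction c with
  | skip =>
    intro d σ ρ h _
    exact ⟨_, _, Runs.skip ρ, by simp [time], h, fun _ _ => rfl⟩
  | put a e f =>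
    intro d σ ρ h _
    refine ⟨_, _, Runs.put _ _ _ ρ, by simp [time, Expr.cost_rename], ?_, ?_⟩
    · intro b
      funext l
      simp only [exec, Store.write, emb_inj, Expr.eval_rename h, h]
    · intro l _
      simp [Store.write, (emb_ne_five a).symm]
  | seq c c' ih ih' =>
    intro d σ ρ h hB
    obtain ⟨t, ρ₁, h1, h2, h3, h4⟩ := ih d σ ρ h hB
    obtain ⟨u, ρ₂, k1, k2, k3, k4⟩ := ih' d _ ρ₁ h3 (by rw [h4 0 (Nat.zero_le _), hB])
    refine ⟨_, _, Runs.seq h1 k1, ?_, k3, fun l hl => by rw [k4 l hl, h4 l hl]⟩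
    simp only [time, Polynomial.eval_add]
    omega
  | ite e c c' ih ih' =>
    intro d σ ρ h hB
    have he : e.rename.eval ρ = e.eval σ := Expr.eval_rename h e
    by_cases h0 : e.eval σ = 0
    · obtain ⟨t, ρ₁, h1, h2, h3, h4⟩ := ih' d σ ρ h hB
      refine ⟨_, _, Runs.branch_false (he.trans h0) h1, ?_, ?_, h4⟩
      · simp only [time, Polynomial.eval_add, Polynomial.eval_C, Expr.cost_rename]
        omega
      · simpa [exec, h0] using h3
    · obtain ⟨t, ρ₁, h1, h2, h3, h4⟩ := ih d σ ρ h hB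
      refine ⟨_, _, Runs.branch_true (by rwa [he]) h1, ?_, ?_, h4⟩
      · simp only [time, Polynomial.eval_add, Polynomial.eval_C, Expr.cost_rename]
        omega
      · simpa [exec, h0] using h3
  | rep c ih =>
    intro d σ ρ h hB
    -- the loop, started with `r` remaining iterations
    have key : ∀ (r : ℕ) (σ ρ : Store), (∀ a, ρ (emb a) = σ a) → ρ 5 0 = B →
        ρ 5 (d + 1) = r →
        ∃ t ρ', Runs (.loop (.get 5 (.lit (d + 1))) (.seq (c.compile (d + 1))
            (.put 5 (.lit (d + 1)) (.sub (.get 5 (.lit (d + 1))) (.lit 1))))) ρ t ρ' ∧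
          t ≤ (c.time.eval B + 10) * r + 3 ∧
          (∀ a, ρ' (emb a) = (c.exec B)^[r] σ a) ∧ ∀ l ≤ d, ρ' 5 l = ρ 5 l := by
      intro r
      induction r with
      | zero =>
        intro σ ρ h _ hr
        exact ⟨_, _, Runs.loop_done (by simpa [Expr.eval] using hr), by simp [Expr.cost], h,
          fun _ _ => rfl⟩
      | succ r ihr =>
        intro σ ρ h hB hr
        obtain ⟨t, ρ₁, h1, h2, h3, h4⟩ := ih (d + 1) σ ρ h hB
        have hput := Runs.put 5 (.lit (d + 1)) (.sub (.get 5 (.lit (d + 1))) (.lit 1)) ρ₁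
        set ρ₂ := Store.write ρ₁ 5 (Expr.eval ρ₁ (.lit (d + 1)))
          (Expr.eval ρ₁ (.sub (.get 5 (.lit (d + 1))) (.lit 1))) with hρ₂
        have e1 : ∀ a, ρ₂ (emb a) = c.exec B σ a := by
          intro a
          rw [← h3 a]
          funext l
          simp [hρ₂, Store.write, emb_ne_five]
        have e2 : ∀ l ≤ d, ρ₂ 5 l = ρ 5 l := by
          intro l hl
          rw [← h4 l (by omega)]
          have : l ≠ d + 1 := by omega
          simp [hρ₂, Store.write, Expr.eval, this]
        have e3 : ρ₂ 5 (d + 1) = r := by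
          have := h4 (d + 1) le_rfl
          simp [hρ₂, Store.write, Expr.eval, this, hr]
        obtain ⟨u, ρ₃, k1, k2, k3, k4⟩ := ihr _ ρ₂ e1 (by rw [e2 0 (Nat.zero_le _), hB]) e3
        refine ⟨_, _, Runs.loop_step (by simp [Expr.eval, hr]) (Runs.seq h1 hput) k1, ?_, ?_, ?_⟩
        · simp only [Expr.cost]
          have : (c.time.eval B + 10) * (r + 1) = (c.time.eval B + 10) * r + (c.time.eval B + 10) :=
            Nat.mul_succ _ _
          omega
        · intro a
          rw [k3 a, Function.iterate_succ_apply]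
        · intro l hl
          rw [k4 l hl, e2 l hl]
    have hput := Runs.put 5 (.lit (d + 1)) (.get 5 (.lit 0)) ρ
    set ρ₁ := Store.write ρ 5 (Expr.eval ρ (.lit (d + 1))) (Expr.eval ρ (.get 5 (.lit 0)))
      with hρ₁
    have e1 : ∀ a, ρ₁ (emb a) = σ a := by
      intro a
      rw [← h a]
      funext l
      simp [hρ₁, Store.write, emb_ne_five]
    have e2 : ∀ l ≤ d, ρ₁ 5 l = ρ 5 l := by
      intro l hl
      have : l ≠ d + 1 := by omega
      simp [hρ₁, Store.write, Expr.eval, this]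
    have e3 : ρ₁ 5 (d + 1) = B := by
      simp [hρ₁, Store.write, Expr.eval, hB]
    obtain ⟨u, ρ₂, k1, k2, k3, k4⟩ := key B σ ρ₁ e1 (by rw [e2 0 (Nat.zero_le _), hB]) e3
    refine ⟨_, _, Runs.seq hput k1, ?_, k3, fun l hl => by rw [k4 l hl, e2 l hl]⟩
    simp only [Expr.cost, time, Polynomial.eval_add, Polynomial.eval_mul, Polynomial.eval_X,
      Polynomial.eval_ofNat]
    omega

/-- A program changes only the arrays it writes to. -/
theorem Cmd.exec_frame {B : ℕ} (c : Cmd) {a : ℕ} (h : a ∉ c.mods) (σ : Store) :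
    c.exec B σ a = σ a := by
  induction c generalizing σ with
  | skip => rfl
  | put b e f =>
    funext l
    simp only [mods, List.mem_singleton] at h
    simp [exec, Store.write, h]
  | seq c d ih ih' =>
    simp only [mods, List.mem_append, not_or] at h
    simp only [exec]
    rw [ih' h.2, ih h.1]
  | ite e c d ih ih' =>
    simp only [mods, List.mem_append, not_or] at h
    simp only [exec]
    split_ifs
    exacts [ih' h.2 σ, ih h.1 σ]
  | rep c ih =>
    have : ∀ r σ, (c.exec B)^[r] σ a = σ a := by
      intro r
      induction r with
      | zero => exact fun _ => rfl
      | succ r ihr =>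
        intro σ
        rw [Function.iterate_succ_apply, ihr, ih h]
    exact this B σ

/-- The invariant rule for loops. -/
theorem Cmd.exec_rep {B : ℕ} {c : Cmd} (I : ℕ → Store → Prop) {σ : Store} (h0 : I 0 σ)
    (hs : ∀ t < B, ∀ τ, I t τ → I (t + 1) (c.exec B τ)) : I B ((Cmd.rep c).exec B σ) := by
  have : ∀ r ≤ B, I r ((c.exec B)^[r] σ) := by
    intro r
    induction r with
    | zero => exact fun _ => h0
    | succ r ih =>
      intro hr
      rw [Function.iterate_succ_apply']
      exact hs r hr _ (ih (by omega))
  exact this B le_rfl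

/-- `d` nested loops around `c`. -/
def Cmd.repPow (c : Cmd) : ℕ → Cmd
  | 0 => c
  | d + 1 => .rep (c.repPow d)

theorem Cmd.exec_repPow_eq {B : ℕ} (c : Cmd) (d : ℕ) :
    (c.repPow d).exec B = (c.exec B)^[B ^ d] := by
  induction d with
  | zero => rfl
  | succ d ih => rw [repPow, exec, ih, ← Function.iterate_mul, pow_succ]

theorem Cmd.mods_repPow (c : Cmd) (d : ℕ) : (c.repPow d).mods = c.mods := by
  induction d with
  | zero => rfl
  | succ d ih => rw [repPow, mods, ih]

/-- The invariant rule for nested loops. -/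
theorem Cmd.exec_repPow {B : ℕ} {c : Cmd} {d : ℕ} (I : ℕ → Store → Prop) {σ : Store} (h0 : I 0 σ)
    (hs : ∀ t < B ^ d, ∀ τ, I t τ → I (t + 1) (c.exec B τ)) :
    I (B ^ d) ((c.repPow d).exec B σ) := by
  rw [exec_repPow_eq]
  have : ∀ r ≤ B ^ d, I r ((c.exec B)^[r] σ) := by
    intro r
    induction r with
    | zero => exact fun _ => h0
    | succ r ih =>
      intro hr
      rw [Function.iterate_succ_apply']
      exact hs r hr _ (ih (by omega))
  exact this _ le_rfl

end RAM

/-! ### Loads -/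

/-- The load of a machine that processes the set `X` of jobs: the total size `p` of the jobs, plus
a setup `s` for each of their classes `c`. -/
def mload (p c : ℕ → ℕ) (s : ℕ) (X : Finset ℕ) : ℕ :=
  ∑ t ∈ X, p t + s * (X.image c).card

/-- The jobs among `0, …, n - 1` that the assignment `a` sends to the machine `i`. -/
def fib (a : ℕ → ℕ) (n i : ℕ) : Finset ℕ := {t ∈ Finset.range n | a t = i}

theorem mem_fib {a : ℕ → ℕ} {n i t : ℕ} : t ∈ fib a n i ↔ t < n ∧ a t = i := by
  simp [fib]

theorem fib_succ (a : ℕ → ℕ) (n i : ℕ) :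
    fib a (n + 1) i = if a n = i then insert n (fib a n i) else fib a n i := by
  unfold fib
  rw [Finset.range_add_one, Finset.filter_insert]

theorem notMem_fib (a : ℕ → ℕ) (n i : ℕ) : n ∉ fib a n i := by
  simp [fib]

/-- The class of the last of the jobs `0, …, q - 1` on machine `i`, plus one; `0` if there is no
such job. -/
def lst (c b : ℕ → ℕ) : ℕ → ℕ → ℕ
  | 0, _ => 0
  | q + 1, i => if b q = i then c q + 1 else lst c b q i

/-- The load of machine `i` after the jobs `0, …, q - 1` have been assigned one by one, with a
setup whenever the class differs from that of the preceding job on the machine. -/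
def lev (r c : ℕ → ℕ) (s : ℕ) (b : ℕ → ℕ) : ℕ → ℕ → ℕ
  | 0, _ => 0
  | q + 1, i => if b q = i then lev r c s b q i + r q + (if lst c b q i = c q + 1 then 0 else s)
      else lev r c s b q i

theorem lst_le {c b : ℕ → ℕ} {n q i : ℕ} (hc : MonotoneOn c (Set.Iio (n + 1))) (hq : q ≤ n) :
    lst c b q i ≤ c q + 1 := by
  induction q with
  | zero => simp [lst]
  | succ q ih =>
    have h1 : c q ≤ c (q + 1) := hc (by simp; omega) (by simp; omega) (by omega)
    have := ih (by omega)
    rw [lst]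
    split_ifs <;> omega

/-- As the classes are in ascending order, it suffices to look at the last job in order to decide
whether the machine has had a job of the class at hand. -/
theorem lst_eq_iff {c b : ℕ → ℕ} {n q i : ℕ} (hc : MonotoneOn c (Set.Iio n)) (hq : q < n) :
    lst c b q i = c q + 1 ↔ c q ∈ (fib b q i).image c := by
  suffices h : ∀ r ≤ q, (lst c b r i = c q + 1 ↔ c q ∈ (fib b r i).image c) from h q le_rfl
  intro r hr
  induction r with
  | zero => simp [lst, fib]
  | succ r ih =>
    rw [lst, fib_succ]
    split_ifs with h
    · rw [Finset.image_insert, Finset.mem_insert, ← ih (by omega)]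
      constructor
      · intro h; left; omega
      · rintro (h1 | h1)
        · rw [h1]
        · -- an earlier job has class `c q`, hence so has job `r`
          rw [ih (by omega), Finset.mem_image] at h1
          obtain ⟨u, hu, hu'⟩ := h1
          rw [mem_fib] at hu
          have h2 : c u ≤ c r := hc (by simp; omega) (by simp; omega) (by omega)
          have h3 : c r ≤ c q := hc (by simp; omega) (by simp; omega) (by omega)
          omega
    · exact ih (by omega)

theorem mload_insert {p c : ℕ → ℕ} {s t : ℕ} {X : Finset ℕ} (h : t ∉ X) :
    mload p c s (insert t X) = mload p c s X + p t + if c t ∈ X.image c then 0 else s := by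
  unfold mload
  rw [Finset.sum_insert h, Finset.image_insert, Finset.card_insert_eq_ite]
  split_ifs <;> ring

/-- With the jobs in the order of their classes, every class causes exactly one setup per machine. -/
theorem lev_eq {r c : ℕ → ℕ} {s : ℕ} {b : ℕ → ℕ} {n q i : ℕ} (hc : MonotoneOn c (Set.Iio n))
    (hq : q ≤ n) : lev r c s b q i = mload r c s (fib b q i) := by
  induction q with
  | zero => simp [lev, fib, mload]
  | succ q ih =>
    rw [lev, fib_succ, ih (by omega)]
    simp only [lst_eq_iff hc (show q < n by omega)]
    split_ifs with h h'
    · rw [mload_insert (notMem_fib _ _ _), if_pos h']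
    · rw [mload_insert (notMem_fib _ _ _), if_neg h']
    · rfl

theorem lev_mono {r c : ℕ → ℕ} {s : ℕ} {b : ℕ → ℕ} {q q' i : ℕ} (h : q ≤ q') :
    lev r c s b q i ≤ lev r c s b q' i := by
  induction q', h using Nat.le_induction with
  | base => rfl
  | succ q' _ ih =>
    refine ih.trans ?_
    rw [lev]
    split_ifs <;> omega

theorem mload_mono {p c : ℕ → ℕ} {s : ℕ} {X Y : Finset ℕ} (h : X ⊆ Y) :
    mload p c s X ≤ mload p c s Y := by
  unfold mload
  gcongr

theorem lev_congr {r c : ℕ → ℕ} {s : ℕ} {b b' : ℕ → ℕ} {q i : ℕ} (h : ∀ t < q, b t = b' t) :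
    lev r c s b q i = lev r c s b' q i ∧ lst c b q i = lst c b' q i := by
  induction q with
  | zero => exact ⟨rfl, rfl⟩
  | succ q ih =>
    obtain ⟨h1, h2⟩ := ih fun t ht => h t (by omega)
    rw [lev, lev, lst, lst, h1, h2, h q (by omega)]
    exact ⟨rfl, rfl⟩

/-! ### Rounding -/

/-- `⌈z / g⌉`, truncated at `C + 1`. -/
def rnd (g C z : ℕ) : ℕ := ∑ t ∈ Finset.range (C + 1), if t * g < z then 1 else 0

theorem mul_rnd_le (g C z : ℕ) : g * rnd g C z ≤ z + g := by
  unfold rnd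
  suffices h : ∀ C, g * (∑ t ∈ Finset.range C, if t * g < z then 1 else 0) ≤ z + g ∧
      g * (∑ t ∈ Finset.range C, if t * g < z then 1 else 0) ≤ C * g from (h _).1
  intro C
  induction C with
  | zero => simp
  | succ C ih =>
    rw [Finset.sum_range_succ, mul_add, add_mul]
    split_ifs with h <;> simp only [mul_one, mul_zero, one_mul] <;> constructor <;> omega

/-- Rounding does not decrease sizes, unless it truncates. -/
theorem rnd_cases (g C z : ℕ) : z ≤ g * rnd g C z ∨ rnd g C z = C + 1 := by
  unfold rnd
  generalize C + 1 = C
  induction C with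
  | zero => simp
  | succ C ih =>
    rw [Finset.sum_range_succ]
    rcases ih with ih | ih
    · left
      exact ih.trans (Nat.mul_le_mul_left _ (by omega))
    · split_ifs with h
      · right; omega
      · left; rw [ih, mul_add]; rw [mul_comm] at h; omega

/-! ### Distributing containers -/

/-- Items of size at most `M` can be distributed to machines with enough capacity `v` in total,
such that every machine exceeds its capacity by at most `M`. -/
theorem exists_greedy {m M : ℕ} {z v : ℕ → ℕ} (S : Finset ℕ) (hz : ∀ q ∈ S, 0 < z q ∧ z q ≤ M)
    (hv : ∑ q ∈ S, z q ≤ ∑ i ∈ Finset.range m, v i) :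
    ∃ b : ℕ → ℕ, (∀ q ∈ S, b q < m ∧ 0 < v (b q)) ∧
      ∀ i, ∑ q ∈ S with b q = i, z q ≤ v i + M := by
  induction S using Finset.induction_on with
  | empty => exact ⟨0, by simp, by simp⟩
  | insert q S hq ih =>
    rw [Finset.sum_insert hq] at hv
    obtain ⟨b, hb, hb'⟩ := ih (fun q' h => hz q' (Finset.mem_insert_of_mem h)) (by omega)
    have hq0 := hz q (Finset.mem_insert_self _ _)
    -- some machine is not full yet
    obtain ⟨i, hi, hi'⟩ : ∃ i ∈ Finset.range m, ∑ q ∈ S with b q = i, z q < v i := by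
      apply Finset.exists_lt_of_sum_lt
      rw [Finset.sum_fiberwise_of_maps_to (fun q' h => Finset.mem_range.2 (hb q' h).1)]
      omega
    have hS : ∀ q' ∈ S, Function.update b q i q' = b q' := fun q' h =>
      Function.update_of_ne (by rintro rfl; exact hq h) _ _
    refine ⟨Function.update b q i, ?_, ?_⟩
    · intro q' h
      rcases Finset.mem_insert.1 h with rfl | h
      · simp only [Function.update_self]
        exact ⟨Finset.mem_range.1 hi, by omega⟩
      · rw [hS q' h]
        exact hb q' h
    · intro i'
      have h1 : {q' ∈ S | Function.update b q i q' = i'} = {q' ∈ S | b q' = i'} :=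
        Finset.filter_congr fun q' h => by rw [hS q' h]
      rw [Finset.filter_insert, h1, Function.update_self]
      split_ifs with h
      · rw [Finset.sum_insert (by simp [hq]), ← h]
        omega
      · exact hb' i'

/-! ### Grouping jobs into items -/

/-- The state of the grouping procedure: the number `N` of items, their sizes `z` and labels `cl`,
the item `it` of every job treated so far, the set `S` of containers (the items made of small
jobs). If `cur ≠ 0`, then `cur - 1` is the container opened last, and `lc - 1` the class of the
last job put into it. -/
structure Form where
  N : ℕ
  cur : ℕ
  lc : ℕ
  z : ℕ → ℕ
  cl : ℕ → ℕ
  it : ℕ → ℕ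
  S : Finset ℕ

namespace Form

/-- Job `t` is joined to the container opened last if it is small, and this container is not yet
full and has the right label. -/
def Joins (thr : ℕ) (κ : ℕ → ℕ) (F : Form) (t : ℕ) : Prop :=
  F.cur ≠ 0 ∧ F.z (F.cur - 1) < thr ∧ F.cl (F.cur - 1) = κ t

open Classical in
/-- The treatment of job `t`. Jobs of size at least `thr` become items of their own. A setup time
`sm` is included in an item for every class in it. -/
noncomputable def step (sm thr : ℕ) (p c κ : ℕ → ℕ) (t : ℕ) (F : Form) : Form :=
  if thr ≤ p t then
    { F with
      N := F.N + 1
      z := Function.update F.z F.N (p t + sm)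
      cl := Function.update F.cl F.N (κ t)
      it := Function.update F.it t F.N }
  else if F.Joins thr κ t then
    { F with
      lc := c t + 1
      z := Function.update F.z (F.cur - 1)
        (F.z (F.cur - 1) + (if F.lc = c t + 1 then 0 else sm) + p t)
      it := Function.update F.it t (F.cur - 1) }
  else
    { N := F.N + 1
      cur := F.N + 1
      lc := c t + 1
      z := Function.update F.z F.N (p t + sm)
      cl := Function.update F.cl F.N (κ t)
      it := Function.update F.it t F.N
      S := insert F.N F.S }

/-- The state after the jobs `0, …, t - 1`; the initial contents of the arrays are irrelevant. -/
noncomputable def run (sm thr : ℕ) (p c κ z₀ cl₀ it₀ : ℕ → ℕ) : ℕ → Form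
  | 0 => ⟨0, 0, 0, z₀, cl₀, it₀, ∅⟩
  | t + 1 => (run sm thr p c κ z₀ cl₀ it₀ t).step sm thr p c κ t

/-- The properties of the grouping after the jobs `0, …, t - 1`. -/
structure Inv (sm thr : ℕ) (p c κ : ℕ → ℕ) (t : ℕ) (F : Form) : Prop where
  N_le : F.N ≤ t
  it_lt : ∀ u < t, F.it u < F.N
  cl_it : ∀ u < t, F.cl (F.it u) = κ u
  surj : ∀ q < F.N, ∃ u < t, F.it u = q
  cl_mono : ∀ q q', q ≤ q' → q' < F.N → F.cl q ≤ F.cl q'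
  z_eq : ∀ q < F.N, F.z q = mload p c sm (fib F.it t q)
  S_lt : ∀ q ∈ F.S, q < F.N
  big : ∀ u < t, thr ≤ p u → F.it u ∉ F.S ∧ fib F.it t (F.it u) = {u}
  small : ∀ u < t, p u < thr → F.it u ∈ F.S
  z_lt : ∀ q ∈ F.S, F.z q < 2 * thr + sm
  cur_mem : F.cur ≠ 0 → F.cur - 1 ∈ F.S
  open_cur : ∀ q ∈ F.S, F.z q < thr → F.cur ≠ 0 ∧ (q + 1 = F.cur ∨ F.cl q < F.cl (F.cur - 1))
  open_unique : ∀ q ∈ F.S, ∀ q' ∈ F.S, F.z q < thr → F.z q' < thr → F.cl q = F.cl q' → q = q'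
  lc_ge : ∀ u < t, p u < thr → c u + 1 ≤ F.lc
  lc_mem : F.cur ≠ 0 → ∃ u ∈ fib F.it t (F.cur - 1), F.lc = c u + 1
  total : ∑ q ∈ F.S, F.z q ≤ ∑ u ∈ Finset.range t with p u < thr, p u +
    sm * ({u ∈ Finset.range t | p u < thr}.image c).card + sm * (F.S.card - 1)

theorem _root_.fib_update (it : ℕ → ℕ) (t x q : ℕ) :
    fib (Function.update it t x) (t + 1) q =
      if x = q then insert t (fib it t q) else fib it t q := by
  have : fib (Function.update it t x) t q = fib it t q := by
    unfold fib
    refine Finset.filter_congr fun u hu => ?_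
    rw [Function.update_of_ne (Finset.mem_range.1 hu).ne]
  rw [fib_succ, Function.update_self, this]

theorem Inv.cl_le {sm thr : ℕ} {p c κ : ℕ → ℕ} {n t : ℕ} {F : Form}
    (h : Inv sm thr p c κ t F) (hκ : MonotoneOn κ (Set.Iio n)) (ht : t < n) {q : ℕ}
    (hq : q < F.N) : F.cl q ≤ κ t := by
  obtain ⟨u, hu, rfl⟩ := h.surj q hq
  rw [h.cl_it u hu]
  exact hκ (by simp; omega) (by simp; omega) hu.le

theorem _root_.mload_singleton (p c : ℕ → ℕ) (s t : ℕ) : mload p c s {t} = p t + s := by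
  simp [mload]

theorem Inv.fib_new {sm thr : ℕ} {p c κ : ℕ → ℕ} {t : ℕ} {F : Form}
    (h : Inv sm thr p c κ t F) (q : ℕ) :
    fib (Function.update F.it t F.N) (t + 1) q = if q = F.N then {t} else fib F.it t q := by
  rw [fib_update]
  by_cases h1 : q = F.N
  · have : fib F.it t q = ∅ := by
      rw [Finset.eq_empty_iff_forall_notMem]
      intro u hu
      rw [mem_fib] at hu
      have := h.it_lt u hu.1
      omega
    rw [if_pos h1.symm, if_pos h1, this]
    rfl
  · rw [if_neg (Ne.symm h1), if_neg h1]

theorem Inv.step {sm thr : ℕ} {p c κ : ℕ → ℕ} {n t : ℕ} {F : Form}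
    (h : Inv sm thr p c κ t F) (hc : MonotoneOn c (Set.Iio n)) (hκ : MonotoneOn κ (Set.Iio n))
    (ht : t < n) : Inv sm thr p c κ (t + 1) (F.step sm thr p c κ t) := by
  have hup : ∀ {f : ℕ → ℕ} {x : ℕ}, ∀ u < t, Function.update f t x u = f u := fun u hu =>
    Function.update_of_ne hu.ne _ _
  have hupN : ∀ {f : ℕ → ℕ} {x : ℕ}, ∀ q < F.N, Function.update f F.N x q = f q := fun q hq =>
    Function.update_of_ne hq.ne _ _
  have hfilt : p t < thr → {u ∈ Finset.range (t + 1) | p u < thr} =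
      insert t {u ∈ Finset.range t | p u < thr} := fun hp => by
    rw [Finset.range_add_one, Finset.filter_insert, if_pos hp]
  have hnot : t ∉ {u ∈ Finset.range t | p u < thr} := by simp
  unfold Form.step
  -- facts shared by the two cases in which a new item is opened
  have it_lt' : ∀ u < t + 1, Function.update F.it t F.N u < F.N + 1 := by
    intro u hu
    rcases Nat.lt_succ_iff_lt_or_eq.1 hu with hu | rfl
    · rw [hup u hu]; have := h.it_lt u hu; omega
    · simp
  have cl_it' : ∀ u < t + 1,
      Function.update F.cl F.N (κ t) (Function.update F.it t F.N u) = κ u := by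
    intro u hu
    rcases Nat.lt_succ_iff_lt_or_eq.1 hu with hu | rfl
    · rw [hup u hu, hupN _ (h.it_lt u hu), h.cl_it u hu]
    · simp
  have surj' : ∀ q < F.N + 1, ∃ u < t + 1, Function.update F.it t F.N u = q := by
    intro q hq
    rcases Nat.lt_succ_iff_lt_or_eq.1 hq with hq | rfl
    · obtain ⟨u, hu, hu'⟩ := h.surj q hq
      exact ⟨u, by omega, by rw [hup u hu, hu']⟩
    · exact ⟨t, by omega, by simp⟩
  have cl_mono' : ∀ q q', q ≤ q' → q' < F.N + 1 → Function.update F.cl F.N (κ t) q ≤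
      Function.update F.cl F.N (κ t) q' := by
    intro q q' hqq hq
    rcases Nat.lt_succ_iff_lt_or_eq.1 hq with hq | rfl
    · rw [hupN q (by omega), hupN q' hq]
      exact h.cl_mono q q' hqq hq
    · rw [Function.update_self]
      rcases Nat.lt_or_eq_of_le hqq with hq | rfl
      · rw [hupN q hq]
        exact h.cl_le hκ ht hq
      · simp
  have z_eq' : ∀ q < F.N + 1, Function.update F.z F.N (p t + sm) q =
      mload p c sm (fib (Function.update F.it t F.N) (t + 1) q) := by
    intro q hq
    rw [h.fib_new q]
    rcases Nat.lt_succ_iff_lt_or_eq.1 hq with hq | rfl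
    · rw [hupN q hq, h.z_eq q hq, if_neg hq.ne]
    · rw [Function.update_self, if_pos rfl, mload_singleton]
  have big' : ∀ u < t, thr ≤ p u → F.it u ∉ F.S ∧
      fib (Function.update F.it t F.N) (t + 1) (F.it u) = {u} := by
    intro u hu hp
    have h1 := h.it_lt u hu
    rw [h.fib_new _, if_neg h1.ne]
    exact h.big u hu hp
  by_cases hp : thr ≤ p t
  · rw [if_pos hp]
    exact {
      N_le := Nat.succ_le_succ h.N_le
      it_lt := it_lt'
      cl_it := cl_it'
      surj := surj'
      cl_mono := cl_mono'
      z_eq := z_eq'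
      S_lt := fun q hq => (h.S_lt q hq).trans (Nat.lt_succ_self _)
      big := by
        intro u hu hpu
        rcases Nat.lt_succ_iff_lt_or_eq.1 hu with hu | rfl
        · simp only [hup u hu]
          exact big' u hu hpu
        · simp only [Function.update_self]
          refine ⟨fun hN => absurd (h.S_lt _ hN) (lt_irrefl _), ?_⟩
          rw [h.fib_new _, if_pos rfl]
      small := by
        intro u hu hpu
        rcases Nat.lt_succ_iff_lt_or_eq.1 hu with hu | rfl
        · simp only [hup u hu]
          exact h.small u hu hpu
        · omega
      z_lt := fun q hq => by simpa only [hupN q (h.S_lt q hq)] using h.z_lt q hq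
      cur_mem := h.cur_mem
      open_cur := by
        intro q hq hz
        simp only [hupN q (h.S_lt q hq)] at hz ⊢
        obtain ⟨h1, h2⟩ := h.open_cur q hq hz
        rw [hupN _ (h.S_lt _ (h.cur_mem h1))]
        exact ⟨h1, h2⟩
      open_unique := by
        intro q hq q' hq' hz hz' he
        simp only [hupN q (h.S_lt q hq), hupN q' (h.S_lt q' hq')] at hz hz' he
        exact h.open_unique q hq q' hq' hz hz' he
      lc_ge := by
        intro u hu hpu
        rcases Nat.lt_succ_iff_lt_or_eq.1 hu with hu | rfl
        · exact h.lc_ge u hu hpu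
        · omega
      lc_mem := by
        intro hcur
        obtain ⟨u, hu, hu'⟩ := h.lc_mem hcur
        have h1 := h.S_lt _ (h.cur_mem hcur)
        refine ⟨u, ?_, hu'⟩
        rw [h.fib_new _, if_neg h1.ne]
        exact hu
      total := by
        have h1 : {u ∈ Finset.range (t + 1) | p u < thr} = {u ∈ Finset.range t | p u < thr} := by
          rw [Finset.range_add_one, Finset.filter_insert, if_neg (by omega)]
        rw [h1]
        refine le_trans (le_of_eq ?_) h.total
        exact Finset.sum_congr rfl fun q hq => hupN q (h.S_lt q hq) }
  rw [if_neg hp]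
  by_cases hj : F.Joins thr κ t
  · rw [if_pos hj]
    obtain ⟨hcur, hzc, hclc⟩ := hj
    obtain ⟨x, hx⟩ : ∃ x, F.cur = x + 1 := ⟨F.cur - 1, by omega⟩
    have hx1 : F.cur - 1 = x := by omega
    have hxS : x ∈ F.S := hx1 ▸ h.cur_mem hcur
    have hxN : x < F.N := h.S_lt x hxS
    rw [hx1] at hzc hclc
    -- a setup is added exactly if the class is new in the container
    have hlc : F.lc = c t + 1 ↔ c t ∈ (fib F.it t x).image c := by
      obtain ⟨u, hu, hu'⟩ := h.lc_mem hcur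
      rw [hx1] at hu
      constructor
      · intro h1
        exact Finset.mem_image.2 ⟨u, hu, by omega⟩
      · intro h1
        obtain ⟨v, hv, hv'⟩ := Finset.mem_image.1 h1
        have hpv : p v < thr := by
          by_contra hpv
          rw [mem_fib] at hv
          have := (h.big v hv.1 (by omega)).1
          rw [hv.2] at this
          exact this hxS
        rw [mem_fib] at hu hv
        have h2 := h.lc_ge v hv.1 hpv
        have h3 : c u ≤ c t := hc (by simp; omega) (by simp; omega) (by omega)
        omega
    have hlc' : F.lc ≠ c t + 1 → c t ∉ {u ∈ Finset.range t | p u < thr}.image c := by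
      intro h1 h2
      obtain ⟨v, hv, hv'⟩ := Finset.mem_image.1 h2
      rw [Finset.mem_filter, Finset.mem_range] at hv
      obtain ⟨u, hu, hu'⟩ := h.lc_mem hcur
      rw [mem_fib] at hu
      have h2 := h.lc_ge v hv.1 hv.2
      have h3 : c u ≤ c t := hc (by simp; omega) (by simp; omega) (by omega)
      omega
    simp only [hx1]
    have hz : ∀ q, F.z q ≤ Function.update F.z x
        (F.z x + (if F.lc = c t + 1 then 0 else sm) + p t) q := by
      intro q
      by_cases hq : q = x
      · subst hq
        rw [Function.update_self]
        split_ifs <;> omega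
      · rw [Function.update_of_ne hq]
    exact {
      N_le := h.N_le.trans (Nat.le_succ _)
      it_lt := by
        intro u hu
        rcases Nat.lt_succ_iff_lt_or_eq.1 hu with hu | rfl
        · simp only [hup u hu]; exact h.it_lt u hu
        · simpa using hxN
      cl_it := by
        intro u hu
        rcases Nat.lt_succ_iff_lt_or_eq.1 hu with hu | rfl
        · simp only [hup u hu]; exact h.cl_it u hu
        · simpa using hclc
      surj := by
        intro q hq
        obtain ⟨u, hu, hu'⟩ := h.surj q hq
        exact ⟨u, by omega, by simp only [hup u hu, hu']⟩
      cl_mono := h.cl_mono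
      z_eq := by
        intro q hq
        simp only [fib_update]
        by_cases h1 : x = q
        · subst h1
          rw [Function.update_self, if_pos rfl, mload_insert (notMem_fib _ _ _), h.z_eq _ hq]
          simp only [hlc]
          ring
        · rw [if_neg h1, Function.update_of_ne (Ne.symm h1), h.z_eq q hq]
      S_lt := h.S_lt
      big := by
        intro u hu hpu
        rcases Nat.lt_succ_iff_lt_or_eq.1 hu with hu | rfl
        · simp only [hup u hu, fib_update]
          have h1 := h.big u hu hpu
          rw [if_neg (by rintro rfl; exact h1.1 hxS)]
          exact h1
        · omega
      small := by
        intro u hu hpu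
        rcases Nat.lt_succ_iff_lt_or_eq.1 hu with hu | rfl
        · simp only [hup u hu]
          exact h.small u hu hpu
        · simpa using hxS
      z_lt := by
        intro q hq
        simp only
        by_cases hqx : q = x
        · subst hqx
          rw [Function.update_self]
          split_ifs <;> omega
        · rw [Function.update_of_ne hqx]
          exact h.z_lt q hq
      cur_mem := h.cur_mem
      open_cur := fun q hq hz' => h.open_cur q hq ((hz q).trans_lt hz')
      open_unique := fun q hq q' hq' h1 h2 =>
        h.open_unique q hq q' hq' ((hz q).trans_lt h1) ((hz q').trans_lt h2)
      lc_ge := by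
        intro u hu hpu
        rcases Nat.lt_succ_iff_lt_or_eq.1 hu with hu | rfl
        · have h3 : c u ≤ c t := hc (by simp; omega) (by simp; omega) (by omega)
          simp only; omega
        · simp
      lc_mem := by
        intro _
        refine ⟨t, ?_, rfl⟩
        rw [fib_update, if_pos hx1.symm]
        exact Finset.mem_insert_self _ _
      total := by
        have h1 : ∑ q ∈ F.S, Function.update F.z x
            (F.z x + (if F.lc = c t + 1 then 0 else sm) + p t) q =
            ∑ q ∈ F.S, F.z q + ((if F.lc = c t + 1 then 0 else sm) + p t) := by
          rw [← Finset.add_sum_erase _ _ hxS, ← Finset.add_sum_erase _ F.z hxS,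
            Function.update_self]
          rw [Finset.sum_congr rfl fun q hq =>
            Function.update_of_ne (Finset.ne_of_mem_erase hq) _ _]
          ring
        simp only
        rw [h1, hfilt (by omega), Finset.sum_insert hnot, Finset.image_insert,
          Finset.card_insert_eq_ite]
        have h2 := h.total
        by_cases h3 : F.lc = c t + 1
        · rw [if_pos h3]
          split_ifs
          · omega
          · rw [mul_add]; omega
        · rw [if_neg h3, if_neg (hlc' h3), mul_add]
          omega }
  · rw [if_neg hj]
    have hN : F.N ∉ F.S := fun hN => absurd (h.S_lt _ hN) (lt_irrefl _)
    -- containers that are not yet full have smaller labels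
    have hlt : ∀ q ∈ F.S, F.z q < thr → F.cl q < κ t := by
      intro q hq hz
      obtain ⟨h1, h2⟩ := h.open_cur q hq hz
      have h3 := h.cl_le hκ ht (h.S_lt _ (h.cur_mem h1))
      rcases h2 with h2 | h2
      · have h4 : F.cur - 1 = q := by omega
        refine lt_of_le_of_ne (h4 ▸ h3) fun h5 => hj ⟨h1, ?_, ?_⟩
        · rwa [h4]
        · rwa [h4]
      · omega
    exact {
      N_le := Nat.succ_le_succ h.N_le
      it_lt := it_lt'
      cl_it := cl_it'
      surj := surj'
      cl_mono := cl_mono'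
      z_eq := z_eq'
      S_lt := by
        intro q hq
        rcases Finset.mem_insert.1 hq with rfl | hq
        · simp
        · exact (h.S_lt q hq).trans (Nat.lt_succ_self _)
      big := by
        intro u hu hpu
        rcases Nat.lt_succ_iff_lt_or_eq.1 hu with hu | rfl
        · simp only [hup u hu]
          obtain ⟨h1, h2⟩ := big' u hu hpu
          refine ⟨fun h3 => ?_, h2⟩
          rcases Finset.mem_insert.1 h3 with h3 | h3
          · have := h.it_lt u hu; omega
          · exact h1 h3
        · omega
      small := by
        intro u hu hpu
        rcases Nat.lt_succ_iff_lt_or_eq.1 hu with hu | rfl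
        · simp only [hup u hu]
          exact Finset.mem_insert_of_mem (h.small u hu hpu)
        · simp
      z_lt := by
        intro q hq
        rcases Finset.mem_insert.1 hq with rfl | hq
        · simp only [Function.update_self]; omega
        · simp only [hupN q (h.S_lt q hq)]
          exact h.z_lt q hq
      cur_mem := by
        intro _
        simp
      open_cur := by
        intro q hq hz
        refine ⟨by simp, ?_⟩
        rcases Finset.mem_insert.1 hq with rfl | hq
        · left; rfl
        · right
          simp only [hupN q (h.S_lt q hq)] at hz
          simp only [Nat.add_sub_cancel, Function.update_self, hupN q (h.S_lt q hq)]
          exact hlt q hq hz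
      open_unique := by
        intro q hq q' hq' hz hz' he
        simp only at hz hz' he
        rcases Finset.mem_insert.1 hq with rfl | hq <;>
          rcases Finset.mem_insert.1 hq' with rfl | hq'
        · rfl
        · rw [hupN q' (h.S_lt q' hq')] at he hz'
          rw [Function.update_self] at he
          have := hlt q' hq' hz'
          omega
        · rw [hupN q (h.S_lt q hq)] at he hz
          rw [Function.update_self] at he
          have := hlt q hq hz
          omega
        · rw [hupN q (h.S_lt q hq)] at he hz
          rw [hupN q' (h.S_lt q' hq')] at he hz'
          exact h.open_unique q hq q' hq' hz hz' he
      lc_ge := by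
        intro u hu hpu
        rcases Nat.lt_succ_iff_lt_or_eq.1 hu with hu | rfl
        · have h3 : c u ≤ c t := hc (by simp; omega) (by simp; omega) (by omega)
          simp only; omega
        · simp
      lc_mem := by
        intro _
        refine ⟨t, ?_, rfl⟩
        rw [h.fib_new _]
        simp
      total := by
        simp only
        rw [Finset.sum_insert hN, Function.update_self,
          Finset.sum_congr rfl fun q hq => hupN q (h.S_lt q hq), hfilt (by omega),
          Finset.sum_insert hnot, Finset.card_insert_of_notMem hN, Finset.image_insert]
        have h1 := h.total
        rcases Finset.eq_empty_or_nonempty F.S with h2 | h2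
        · have h3 : sm * 1 ≤ sm * (insert (c t) ({u ∈ Finset.range t | p u < thr}.image c)).card :=
            Nat.mul_le_mul_left _ (Finset.card_pos.2 (Finset.insert_nonempty _ _))
          rw [h2]
          simp only [Finset.sum_empty]
          omega
        · have h3 : sm * ({u ∈ Finset.range t | p u < thr}.image c).card ≤
              sm * (insert (c t) ({u ∈ Finset.range t | p u < thr}.image c)).card :=
            Nat.mul_le_mul_left _ (Finset.card_le_card (Finset.subset_insert _ _))
          have h4 : sm * (F.S.card + 1 - 1) = sm * (F.S.card - 1) + sm := by
            have := Finset.card_pos.2 h2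
            rw [← Nat.mul_succ]
            congr 1
            omega
          omega }

theorem inv_run {sm thr : ℕ} {p c κ z₀ cl₀ it₀ : ℕ → ℕ} {n : ℕ}
    (hc : MonotoneOn c (Set.Iio n)) (hκ : MonotoneOn κ (Set.Iio n)) :
    ∀ t ≤ n, Inv sm thr p c κ t (run sm thr p c κ z₀ cl₀ it₀ t) := by
  intro t
  induction t with
  | zero =>
    intro _
    constructor <;> simp [run]
  | succ t ih => exact fun ht => (ih (by omega)).step hc hκ (by omega)

end Form

/-! ### Good assignments of the items exist -/

namespace Form

/-- Any assignment of the containers extends to an assignment of all items that sends the large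
jobs to the same machines as `a`. -/
theorem Inv.exists_extend {sm thr : ℕ} {p c κ : ℕ → ℕ} {n m : ℕ} {F : Form}
    (h : Inv sm thr p c κ n F) {a b₀ : ℕ → ℕ} (ha : ∀ u < n, a u < m) (hb : ∀ q ∈ F.S, b₀ q < m) :
    ∃ b : ℕ → ℕ, (∀ q < F.N, b q < m) ∧ (∀ q ∈ F.S, b q = b₀ q) ∧
      (∀ q < F.N, q ∉ F.S → ∃ u < n, thr ≤ p u ∧ F.it u = q ∧ b q = a u) ∧
      ∀ u < n, thr ≤ p u → b (F.it u) = a u := by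
  classical
  choose! job hjob hjob' using h.surj
  refine ⟨fun q => if q ∈ F.S then b₀ q else a (job q), ?_, ?_, ?_, ?_⟩
  · intro q hq
    dsimp only
    split_ifs with hS
    · exact hb q hS
    · exact ha _ (hjob q hq)
  · intro q hq
    simp [hq]
  · intro q hq hS
    refine ⟨job q, hjob q hq, ?_, hjob' q hq, by simp [hS]⟩
    by_contra hp
    exact hS (hjob' q hq ▸ h.small _ (hjob q hq) (not_le.1 hp))
  · intro u hu hp
    obtain ⟨h1, h2⟩ := h.big u hu hp
    have h3 := h.it_lt u hu
    have h4 : job (F.it u) ∈ fib F.it n (F.it u) := mem_fib.2 ⟨hjob _ h3, hjob' _ h3⟩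
    rw [h2, Finset.mem_singleton] at h4
    simp [h1, h4]

theorem Inv.z_big {sm thr : ℕ} {p c κ : ℕ → ℕ} {n : ℕ} {F : Form} (h : Inv sm thr p c κ n F)
    {u : ℕ} (hu : u < n) (hp : thr ≤ p u) : F.z (F.it u) = p u + sm := by
  rw [h.z_eq _ (h.it_lt u hu), (h.big u hu hp).2, mload_singleton]

/-- The size of the items on a machine, split into containers and large jobs. -/
theorem Inv.sum_fib {sm thr : ℕ} {p c κ : ℕ → ℕ} {n : ℕ} {F : Form}
    (h : Inv sm thr p c κ n F) {a b : ℕ → ℕ} (i : ℕ)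
    (hb : ∀ q < F.N, q ∉ F.S → ∃ u < n, thr ≤ p u ∧ F.it u = q ∧ b q = a u)
    (hb' : ∀ u < n, thr ≤ p u → b (F.it u) = a u) :
    ∑ q ∈ fib b F.N i, F.z q =
      ∑ q ∈ F.S with b q = i, F.z q + ∑ u ∈ fib a n i with thr ≤ p u, (p u + sm) := by
  rw [← Finset.sum_filter_add_sum_filter_not (fib b F.N i) (· ∈ F.S)]
  congr 1
  · refine Finset.sum_congr ?_ fun _ _ => rfl
    ext q
    simp only [Finset.mem_filter, mem_fib]
    exact ⟨fun ⟨h1, h2⟩ => ⟨h2, h1.2⟩, fun ⟨h1, h2⟩ => ⟨⟨h.S_lt q h1, h2⟩, h1⟩⟩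
  · symm
    refine Finset.sum_bij (fun u _ => F.it u) ?_ ?_ ?_ ?_
    · intro u hu
      rw [Finset.mem_filter, mem_fib] at hu
      rw [Finset.mem_filter, mem_fib, hb' u hu.1.1 hu.2]
      exact ⟨⟨h.it_lt u hu.1.1, hu.1.2⟩, (h.big u hu.1.1 hu.2).1⟩
    · intro u hu v hv huv
      rw [Finset.mem_filter, mem_fib] at hu hv
      have h1 := (h.big u hu.1.1 hu.2).2
      rw [huv, (h.big v hv.1.1 hv.2).2] at h1
      exact (Finset.singleton_injective h1).symm
    · intro q hq
      rw [Finset.mem_filter, mem_fib] at hq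
      obtain ⟨u, hu, hp, h1, h2⟩ := hb q hq.1.1 hq.2
      refine ⟨u, ?_, h1⟩
      rw [Finset.mem_filter, mem_fib]
      exact ⟨⟨hu, h2 ▸ hq.1.2⟩, hp⟩
    · intro u hu
      rw [Finset.mem_filter, mem_fib] at hu
      exact (h.z_big hu.1.1 hu.2).symm

/-- Rounding costs a factor `1 + 1 / e` and one additional unit for each label, because there is at
most one small item per label. -/
theorem Inv.sum_rnd_le {sm thr : ℕ} {p c κ : ℕ → ℕ} {n : ℕ} {F : Form}
    (h : Inv sm thr p c κ n F) {e g : ℕ} (C : ℕ) (hthr : e * g ≤ thr) {X : Finset ℕ}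
    (hX : ∀ q ∈ X, q < F.N) :
    e * g * ∑ q ∈ X, rnd g C (F.z q) ≤
      (e + 1) * ∑ q ∈ X, F.z q + e * g * (X.image F.cl).card := by
  have h1 : g * ∑ q ∈ X, rnd g C (F.z q) ≤ ∑ q ∈ X, F.z q + g * X.card := by
    rw [Finset.mul_sum]
    refine (Finset.sum_le_sum fun q _ => mul_rnd_le g C (F.z q)).trans ?_
    rw [Finset.sum_add_distrib, Finset.sum_const, smul_eq_mul, mul_comm g]
  have h2 : X.card = {q ∈ X | thr ≤ F.z q}.card + {q ∈ X | ¬ thr ≤ F.z q}.card :=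
    (Finset.card_filter_add_card_filter_not _).symm
  have h3 : {q ∈ X | ¬ thr ≤ F.z q}.card ≤ (X.image F.cl).card := by
    have hS : ∀ q ∈ X, ¬ thr ≤ F.z q → q ∈ F.S := by
      intro q hq hz
      obtain ⟨u, hu, rfl⟩ := h.surj q (hX q hq)
      refine h.small u hu (lt_of_not_ge fun hp => hz ?_)
      rw [h.z_big hu hp]
      omega
    refine Finset.card_le_card_of_injOn F.cl ?_ ?_
    · intro q hq
      exact Finset.mem_coe.2
        (Finset.mem_image_of_mem _ (Finset.mem_filter.1 (Finset.mem_coe.1 hq)).1)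
    · intro q hq q' hq' he
      rw [Finset.mem_coe, Finset.mem_filter] at hq hq'
      exact h.open_unique q (hS q hq.1 hq.2) q' (hS q' hq'.1 hq'.2) (not_le.1 hq.2)
        (not_le.1 hq'.2) he
  have h4 : e * g * {q ∈ X | thr ≤ F.z q}.card ≤ ∑ q ∈ X, F.z q := by
    calc e * g * {q ∈ X | thr ≤ F.z q}.card ≤ thr * {q ∈ X | thr ≤ F.z q}.card :=
          Nat.mul_le_mul_right _ hthr
      _ = ∑ q ∈ X with thr ≤ F.z q, thr := by rw [Finset.sum_const, smul_eq_mul, mul_comm]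
      _ ≤ ∑ q ∈ X with thr ≤ F.z q, F.z q :=
          Finset.sum_le_sum fun q hq => (Finset.mem_filter.1 hq).2
      _ ≤ ∑ q ∈ X, F.z q := Finset.sum_le_sum_of_subset (Finset.filter_subset _ _)
  have h5 := Nat.mul_le_mul_left e h1
  have h6 := Nat.mul_le_mul_left (e * g) h3
  rw [h2] at h5
  nlinarith

theorem Inv.z_pos {sm thr : ℕ} {p c κ : ℕ → ℕ} {n : ℕ} {F : Form} (h : Inv sm thr p c κ n F)
    (hp : ∀ u < n, 0 < p u) {q : ℕ} (hq : q < F.N) : 0 < F.z q := by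
  obtain ⟨u, hu, hu'⟩ := h.surj q hq
  rw [h.z_eq q hq]
  have : p u ≤ ∑ t ∈ fib F.it n q, p t :=
    Finset.single_le_sum (fun _ _ => Nat.zero_le _) (mem_fib.2 ⟨hu, hu'⟩)
  have := hp u hu
  unfold mload
  omega

theorem sum_fib_filter (p a : ℕ → ℕ) (n i thr : ℕ) :
    ∑ u ∈ fib a n i, p u = ∑ u ∈ fib a n i with p u < thr, p u +
      ∑ u ∈ fib a n i with thr ≤ p u, p u := by
  rw [← Finset.sum_filter_add_sum_filter_not (fib a n i) (fun u => p u < thr)]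
  simp only [not_lt]

/-- If setups are long, the volume of the small jobs of a class on a machine is replaced by
containers of this class; what is lost by this is small compared with the setup of the class. -/
theorem Inv.exists_large {thr : ℕ} {p c : ℕ → ℕ} {n m : ℕ} {F : Form}
    (h : Inv 0 thr p c c n F) {e g s : ℕ} (C : ℕ) (he : 2 ≤ e) (hg : 0 < g) (hthr : thr = e * g)
    (hs : 2 * e ^ 2 * g ≤ s) (hp : ∀ u < n, 0 < p u) {a : ℕ → ℕ} (ha : ∀ u < n, a u < m)
    (hload : ∀ i < m, mload p c s (fib a n i) ≤ 2 * e ^ 4 * g) :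
    ∃ b : ℕ → ℕ, (∀ q < F.N, b q < m) ∧ ∀ i < m,
      mload (fun q => rnd g C (F.z q)) F.cl (rnd g C s) (fib b F.N i) ≤ 2 * e ^ 4 + 24 * e ^ 3 := by
  have hcap : ∀ k, ∑ q ∈ F.S with F.cl q = k, F.z q ≤ ∑ i ∈ Finset.range m,
      ∑ u ∈ Finset.range n with (p u < thr ∧ c u = k) ∧ a u = i, p u := by
    intro k
    simp only [← Finset.filter_filter (p := fun u => p u < thr ∧ c u = k)]
    rw [Finset.sum_fiberwise_of_maps_to fun u hu => Finset.mem_range.2 <| ha u <|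
      Finset.mem_range.1 (Finset.mem_filter.1 hu).1]
    rw [← Finset.sum_fiberwise_of_maps_to (s := {u ∈ Finset.range n | p u < thr ∧ c u = k})
      (t := {q ∈ F.S | F.cl q = k}) (g := F.it)]
    · refine le_of_eq (Finset.sum_congr rfl fun q hq => ?_)
      rw [Finset.mem_filter] at hq
      rw [h.z_eq q (h.S_lt q hq.1), mload, zero_mul, add_zero]
      refine Finset.sum_congr ?_ fun _ _ => rfl
      ext u
      simp only [mem_fib, Finset.mem_filter, Finset.mem_range]
      constructor
      · rintro ⟨h1, rfl⟩
        refine ⟨⟨h1, lt_of_not_ge fun h2 => (h.big u h1 h2).1 hq.1, ?_⟩, rfl⟩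
        rw [← h.cl_it u h1, hq.2]
      · rintro ⟨⟨h1, _⟩, h2⟩
        exact ⟨h1, h2⟩
    · intro u hu
      simp only [Finset.mem_filter, Finset.mem_range] at hu ⊢
      exact ⟨h.small u hu.1 hu.2.1, by rw [h.cl_it u hu.1, hu.2.2]⟩
  have hgr := fun k => exists_greedy (M := 2 * thr) {q ∈ F.S | F.cl q = k} (fun q hq => by
    have h1 := (Finset.mem_filter.1 hq).1
    exact ⟨h.z_pos hp (h.S_lt q h1), (h.z_lt q h1).le⟩) (hcap k)
  choose bk hbk hbk' using hgr
  have hbS : ∀ q ∈ F.S, bk (F.cl q) q < m := fun q hq =>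
    (hbk _ q (Finset.mem_filter.2 ⟨hq, rfl⟩)).1
  obtain ⟨b, hb1, hb2, hb3, hb4⟩ := h.exists_extend (b₀ := fun q => bk (F.cl q) q) ha hbS
  refine ⟨b, hb1, fun i hi => ?_⟩
  set X := fib b F.N i with hX
  -- the classes on machine `i` are among those that `a` has there
  have hY : X.image F.cl ⊆ (fib a n i).image c := by
    intro k hk
    obtain ⟨q, hq, rfl⟩ := Finset.mem_image.1 hk
    rw [hX, mem_fib] at hq
    by_cases hS : q ∈ F.S
    · have h1 := (hbk _ q (Finset.mem_filter.2 ⟨hS, rfl⟩)).2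
      obtain ⟨u, hu, -⟩ := Finset.exists_ne_zero_of_sum_ne_zero h1.ne'
      simp only [Finset.mem_filter, Finset.mem_range] at hu
      refine Finset.mem_image.2 ⟨u, mem_fib.2 ⟨hu.1, ?_⟩, hu.2.1.2⟩
      rw [hu.2.2, ← hb2 q hS, hq.2]
    · obtain ⟨u, hu, -, h1, h2⟩ := hb3 q hq.1 hS
      exact Finset.mem_image.2 ⟨u, mem_fib.2 ⟨hu, h2 ▸ hq.2⟩, by rw [← h1, h.cl_it u hu]⟩
  have hYc := Finset.card_le_card hY
  have hsm : ∑ q ∈ F.S with b q = i, F.z q ≤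
      ∑ u ∈ fib a n i with p u < thr, p u + 2 * thr * (X.image F.cl).card := by
    rw [← Finset.sum_fiberwise_of_maps_to (s := {q ∈ F.S | b q = i}) (t := X.image F.cl)
      (g := F.cl)]
    · calc ∑ k ∈ X.image F.cl, ∑ q ∈ {q ∈ F.S | b q = i} with F.cl q = k, F.z q
          ≤ ∑ k ∈ X.image F.cl,
            (∑ u ∈ Finset.range n with (p u < thr ∧ c u = k) ∧ a u = i, p u + 2 * thr) := by
            refine Finset.sum_le_sum fun k _ => le_trans (le_of_eq ?_) (hbk' k i)
            refine Finset.sum_congr ?_ fun _ _ => rfl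
            ext q
            simp only [Finset.mem_filter]
            constructor
            · rintro ⟨⟨h1, h2⟩, rfl⟩
              exact ⟨⟨h1, rfl⟩, by rw [← hb2 q h1, h2]⟩
            · rintro ⟨⟨h1, rfl⟩, h2⟩
              exact ⟨⟨h1, by rw [hb2 q h1, h2]⟩, rfl⟩
        _ = ∑ k ∈ X.image F.cl, ∑ u ∈ {u ∈ fib a n i | p u < thr} with c u = k, p u +
            2 * thr * (X.image F.cl).card := by
            rw [Finset.sum_add_distrib, Finset.sum_const, smul_eq_mul, mul_comm (2 * thr)]
            congr 1
            refine Finset.sum_congr rfl fun k _ => Finset.sum_congr ?_ fun _ _ => rfl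
            ext u
            simp only [Finset.mem_filter, mem_fib, Finset.mem_range]
            tauto
        _ ≤ _ := Nat.add_le_add_right
            (Finset.sum_fiberwise_le_sum_of_sum_fiber_nonneg fun _ _ => Nat.zero_le _) _
    · intro q hq
      rw [Finset.mem_filter] at hq
      exact Finset.mem_image_of_mem _ (mem_fib.2 ⟨h.S_lt q hq.1, hq.2⟩)
  have hZ := h.sum_fib i hb3 hb4
  simp only [add_zero] at hZ
  have hP := sum_fib_filter p a n i thr
  have hR := h.sum_rnd_le C hthr.ge (X := X) fun q hq => (mem_fib.1 hq).1
  have hl := hload i hi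
  have hrs := mul_rnd_le g C s
  unfold mload at hl ⊢
  generalize ∑ q ∈ X, rnd g C (F.z q) = R at hR ⊢
  generalize ∑ u ∈ fib a n i, p u = P at hl hP
  generalize ∑ q ∈ X, F.z q = Z at hR hZ
  generalize (X.image F.cl).card = Y at *
  generalize rnd g C s = rs at *
  have hZ' : Z ≤ P + 2 * (e * g) * Y := by rw [← hthr]; omega
  have hl' : P + s * Y ≤ 2 * e ^ 4 * g := by
    have := Nat.mul_le_mul_left s hYc
    omega
  have h1 : e ^ 2 * g * (R + rs * Y) ≤ e ^ 2 * g * (2 * e ^ 4 + 24 * e ^ 3) := by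
    have e1 : e * g * (R + rs * Y) ≤ (e + 1) * (P + 2 * (e * g) * Y) + e * g * Y +
        e * (s + g) * Y := by
      have := Nat.mul_le_mul_left (e + 1) hZ'
      have := Nat.mul_le_mul_left (e * Y) hrs
      nlinarith
    have e2 : e ^ 2 * g * (R + rs * Y) ≤ (e ^ 2 + 2 * e) * (P + s * Y) := by
      have f1 := Nat.mul_le_mul_left e e1
      have f2 := Nat.mul_le_mul_left ((e + 1) * Y) hs
      have f3 := Nat.mul_le_mul_right Y hs
      have f4 := Nat.mul_le_mul_right (s * Y) he
      nlinarith [Nat.zero_le (e * P)]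
    refine e2.trans ((Nat.mul_le_mul_left _ hl').trans ?_)
    have : (e ^ 2 + 2 * e) * (2 * e ^ 4 * g) = e ^ 2 * g * (2 * e ^ 4 + 4 * e ^ 3) := by ring
    rw [this]
    gcongr
    omega
  exact Nat.le_of_mul_le_mul_left h1 (by positivity)

/-- If setups are short, the containers fit into the room that the large jobs leave, as the
setups added for the large jobs and for the containers are small compared with their sizes. -/
theorem Inv.exists_small {thr s : ℕ} {p c : ℕ → ℕ} {n m : ℕ} {F : Form}
    (h : Inv s thr p c (fun _ => 0) n F) {e g : ℕ} (C : ℕ) (he : 2 ≤ e) (hg : 0 < g)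
    (hthr : thr = 2 * e ^ 3 * g) (hs : s < 2 * e ^ 2 * g) (hp : ∀ u < n, 0 < p u)
    {a : ℕ → ℕ} (ha : ∀ u < n, a u < m)
    (hload : ∀ i < m, mload p c s (fib a n i) ≤ 2 * e ^ 4 * g) :
    ∃ b : ℕ → ℕ, (∀ q < F.N, b q < m) ∧ ∀ i < m,
      mload (fun q => rnd g C (F.z q)) F.cl 0 (fib b F.N i) ≤ 2 * e ^ 4 + 24 * e ^ 3 := by
  have hes : e * s ≤ thr := by
    have := Nat.mul_le_mul_left e hs.le
    rw [hthr]
    calc _ ≤ _ := this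
      _ = _ := by ring
  have hcl : ∀ q < F.N, F.cl q = 0 := by
    intro q hq
    obtain ⟨u, hu, rfl⟩ := h.surj q hq
    exact h.cl_it u hu
  have hthr0 : 0 < thr := by rw [hthr]; positivity
  have hPload : ∀ i < m, ∑ u ∈ fib a n i, p u ≤ 2 * e ^ 4 * g := fun i hi =>
    (Nat.le_add_right _ _).trans (hload i hi)
  -- the large jobs with their setups
  have hbig : ∀ i, e * ∑ u ∈ fib a n i with thr ≤ p u, (p u + s) ≤
      (e + 1) * ∑ u ∈ fib a n i with thr ≤ p u, p u := by
    intro i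
    rw [Finset.mul_sum, Finset.mul_sum]
    refine Finset.sum_le_sum fun u hu => ?_
    have := (Finset.mem_filter.1 hu).2
    rw [mul_add, add_mul, one_mul]
    omega
  have hbig' : ∀ i < m, ∑ u ∈ fib a n i with thr ≤ p u, (p u + s) ≤
      (2 * e ^ 4 + 4 * e ^ 3) * g := by
    intro i hi
    have h1 : ∑ u ∈ fib a n i with thr ≤ p u, p u ≤ 2 * e ^ 4 * g :=
      (Finset.sum_le_sum_of_subset (Finset.filter_subset _ _)).trans (hPload i hi)
    refine Nat.le_of_mul_le_mul_left ((hbig i).trans ((Nat.mul_le_mul_left _ h1).trans ?_))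
      (show 0 < e by omega)
    nlinarith [Nat.zero_le (e ^ 4 * g)]
  -- the total size of the containers
  have htot : ∑ q ∈ F.S, F.z q ≤ ∑ i ∈ Finset.range m,
      ((2 * e ^ 4 + 4 * e ^ 3) * g - ∑ u ∈ fib a n i with thr ≤ p u, (p u + s)) := by
    have hsub : ∑ i ∈ Finset.range m,
        ((2 * e ^ 4 + 4 * e ^ 3) * g - ∑ u ∈ fib a n i with thr ≤ p u, (p u + s)) +
        ∑ i ∈ Finset.range m, ∑ u ∈ fib a n i with thr ≤ p u, (p u + s) =
        m * ((2 * e ^ 4 + 4 * e ^ 3) * g) := by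
      rw [← Finset.sum_add_distrib, Finset.sum_congr rfl fun i hi =>
        Nat.sub_add_cancel (hbig' i (Finset.mem_range.1 hi)), Finset.sum_const, smul_eq_mul,
        Finset.card_range]
    have hopen : e * s * (F.S.card - 1) ≤ ∑ q ∈ F.S, F.z q := by
      have h1 : F.S.card - 1 ≤ {q ∈ F.S | thr ≤ F.z q}.card := by
        have h2 : {q ∈ F.S | ¬ thr ≤ F.z q}.card ≤ 1 := by
          rw [Finset.card_le_one]
          intro q hq q' hq'
          rw [Finset.mem_filter] at hq hq'
          exact h.open_unique q hq.1 q' hq'.1 (not_le.1 hq.2) (not_le.1 hq'.2)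
            (by rw [hcl _ (h.S_lt q hq.1), hcl _ (h.S_lt q' hq'.1)])
        have h3 := Finset.card_filter_add_card_filter_not (s := F.S) (fun q => thr ≤ F.z q)
        omega
      calc e * s * (F.S.card - 1) ≤ thr * {q ∈ F.S | thr ≤ F.z q}.card :=
            Nat.mul_le_mul hes h1
        _ = ∑ q ∈ F.S with thr ≤ F.z q, thr := by rw [Finset.sum_const, smul_eq_mul, mul_comm]
        _ ≤ ∑ q ∈ F.S with thr ≤ F.z q, F.z q :=
            Finset.sum_le_sum fun q hq => (Finset.mem_filter.1 hq).2
        _ ≤ ∑ q ∈ F.S, F.z q := Finset.sum_le_sum_of_subset (Finset.filter_subset _ _)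
    have hdist : ({u ∈ Finset.range n | p u < thr}.image c).card ≤
        ∑ i ∈ Finset.range m, ((fib a n i).image c).card := by
      refine (Finset.card_le_card ?_).trans Finset.card_biUnion_le
      intro k hk
      obtain ⟨u, hu, rfl⟩ := Finset.mem_image.1 hk
      have hu' := Finset.mem_range.1 (Finset.mem_filter.1 hu).1
      exact Finset.mem_biUnion.2 ⟨a u, Finset.mem_range.2 (ha u hu'),
        Finset.mem_image_of_mem c (mem_fib.2 ⟨hu', rfl⟩)⟩
    have hsplit : ∀ f : ℕ → ℕ, ∀ P : ℕ → Prop, [DecidablePred P] →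
        ∑ i ∈ Finset.range m, ∑ u ∈ fib a n i with P u, f u =
        ∑ u ∈ Finset.range n with P u, f u := by
      intro f P _
      rw [← Finset.sum_fiberwise_of_maps_to (s := {u ∈ Finset.range n | P u})
        (t := Finset.range m) (g := a)]
      · refine Finset.sum_congr rfl fun i _ => Finset.sum_congr ?_ fun _ _ => rfl
        ext u
        simp only [Finset.mem_filter, mem_fib, Finset.mem_range]
        tauto
      · intro u hu
        simp only [Finset.mem_filter, Finset.mem_range] at hu ⊢
        exact ha u hu.1
    have hall : ∑ u ∈ Finset.range n with p u < thr, p u +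
        ∑ u ∈ Finset.range n with thr ≤ p u, p u +
        s * ∑ i ∈ Finset.range m, ((fib a n i).image c).card ≤ m * (2 * e ^ 4 * g) := by
      rw [← hsplit, ← hsplit, ← Finset.sum_add_distrib, Finset.mul_sum, ← Finset.sum_add_distrib]
      refine (Finset.sum_le_card_nsmul _ _ _ fun i hi => ?_).trans_eq (by
        rw [Finset.card_range, smul_eq_mul])
      rw [← sum_fib_filter]
      exact hload i (Finset.mem_range.1 hi)
    have hbigs : e * ∑ i ∈ Finset.range m, ∑ u ∈ fib a n i with thr ≤ p u, (p u + s) ≤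
        (e + 1) * ∑ u ∈ Finset.range n with thr ≤ p u, p u := by
      rw [← hsplit, Finset.mul_sum, Finset.mul_sum]
      exact Finset.sum_le_sum fun i _ => hbig i
    have ht := h.total
    have hds := Nat.mul_le_mul_left s hdist
    generalize ∑ q ∈ F.S, F.z q = Z at *
    generalize ∑ i ∈ Finset.range m, ∑ u ∈ fib a n i with thr ≤ p u, (p u + s) = Bs at *
    generalize ∑ u ∈ Finset.range n with thr ≤ p u, p u = Pb at *
    generalize ∑ u ∈ Finset.range n with p u < thr, p u = Ps at *
    generalize s * ({u ∈ Finset.range n | p u < thr}.image c).card = D at *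
    generalize s * ∑ i ∈ Finset.range m, ((fib a n i).image c).card = D' at *
    generalize F.S.card - 1 = w at *
    have e1 : e * Z ≤ e * (Ps + D) + Z := by
      have := Nat.mul_le_mul_left e ht
      nlinarith
    have e2 : Z ≤ 2 * (Ps + D) := by
      obtain ⟨d, rfl⟩ := Nat.exists_eq_add_of_le he
      nlinarith
    have e3 : e * (Z + Bs) ≤ e * (m * ((2 * e ^ 4 + 4 * e ^ 3) * g)) := by
      have f1 : e * (Z + Bs) ≤ (e + 2) * (m * (2 * e ^ 4 * g)) := by
        have : Ps + D + Pb ≤ m * (2 * e ^ 4 * g) := by omega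
        have := Nat.mul_le_mul_left (e + 2) this
        nlinarith
      refine f1.trans (le_of_eq (by ring))
    have e4 := Nat.le_of_mul_le_mul_left e3 (by omega)
    omega
  obtain ⟨b₀, hb₀, hb₀'⟩ := exists_greedy (M := 2 * thr + s) F.S
    (fun q hq => ⟨h.z_pos hp (h.S_lt q hq), (h.z_lt q hq).le⟩) htot
  obtain ⟨b, hb1, hb2, hb3, hb4⟩ := h.exists_extend ha fun q hq => (hb₀ q hq).1
  refine ⟨b, hb1, fun i hi => ?_⟩
  have hZ := h.sum_fib i hb3 hb4
  have hsm : ∑ q ∈ F.S with b q = i, F.z q ≤ (2 * e ^ 4 + 4 * e ^ 3) * g -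
      ∑ u ∈ fib a n i with thr ≤ p u, (p u + s) + (2 * thr + s) := by
    rw [Finset.filter_congr fun q hq => by rw [hb2 q hq]]
    exact hb₀' i
  have hR := h.sum_rnd_le (e := e) (g := g) C (by
    rw [hthr]
    have : e ≤ 2 * e ^ 3 := by nlinarith [pow_pos (show 0 < e by omega) 2]
    exact Nat.mul_le_mul_right g this) (X := fib b F.N i) fun q hq => (mem_fib.1 hq).1
  have hone : ((fib b F.N i).image F.cl).card ≤ 1 := by
    rw [Finset.card_le_one]
    intro k hk k' hk'
    obtain ⟨q, hq, rfl⟩ := Finset.mem_image.1 hk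
    obtain ⟨q', hq', rfl⟩ := Finset.mem_image.1 hk'
    rw [hcl _ (mem_fib.1 hq).1, hcl _ (mem_fib.1 hq').1]
  have hb := hbig' i hi
  unfold mload
  rw [zero_mul, add_zero]
  generalize ∑ q ∈ fib b F.N i, rnd g C (F.z q) = R at *
  generalize ∑ q ∈ fib b F.N i, F.z q = Z at *
  have hZ' : Z ≤ (2 * e ^ 4 + 10 * e ^ 3) * g := by
    have h1 : s ≤ thr := le_trans (Nat.le_mul_of_pos_left s (by omega)) hes
    have h2 : (2 * e ^ 4 + 10 * e ^ 3) * g = (2 * e ^ 4 + 4 * e ^ 3) * g + 3 * thr := by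
      rw [hthr]; ring
    omega
  have h1 : e * g * R ≤ e * g * (2 * e ^ 4 + 24 * e ^ 3) := by
    have h2 := Nat.mul_le_mul_left (e + 1) hZ'
    have h3 := Nat.mul_le_mul_left (e * g) hone
    have h4 : (e + 1) * ((2 * e ^ 4 + 10 * e ^ 3) * g) + e * g * 1 ≤
        e * g * (2 * e ^ 4 + 24 * e ^ 3) := by
      have h5 : (e + 1) * (2 * e ^ 4 + 10 * e ^ 3) + e ≤ e * (2 * e ^ 4 + 24 * e ^ 3) := by
        obtain ⟨d, rfl⟩ := Nat.exists_eq_add_of_le he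
        ring_nf
        nlinarith [Nat.zero_le (d ^ 4), Nat.zero_le (d ^ 3), Nat.zero_le (d ^ 2)]
      have := Nat.mul_le_mul_right g h5
      nlinarith
    omega
  exact Nat.le_of_mul_le_mul_left h1 (by positivity)

/-- An assignment of the items with small rounded loads is a good assignment of the jobs. -/
theorem Inv.load_le {sm thr : ℕ} {p c κ : ℕ → ℕ} {n : ℕ} {F : Form}
    (h : Inv sm thr p c κ n F) {s s' g C rs : ℕ} {b : ℕ → ℕ} {i : ℕ}
    (hκ : s' = 0 ∧ sm = s ∨ s' = s ∧ κ = c) (hrs : s' ≤ g * rs ∨ rs = C + 1)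
    (hb : mload (fun q => rnd g C (F.z q)) F.cl rs (fib b F.N i) ≤ C) :
    mload p c s (fib (fun t => b (F.it t)) n i) ≤ g * C := by
  set X := fib b F.N i with hX
  set A := fib (fun t => b (F.it t)) n i with hA
  have hsum : ∑ t ∈ A, p t = ∑ q ∈ X, ∑ t ∈ fib F.it n q, p t := by
    rw [← Finset.sum_fiberwise_of_maps_to (s := A) (t := X) (g := F.it)]
    · refine Finset.sum_congr rfl fun q hq => Finset.sum_congr ?_ fun _ _ => rfl
      ext t
      simp only [hA, hX, mem_fib, Finset.mem_filter] at hq ⊢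
      constructor
      · rintro ⟨⟨h1, -⟩, h2⟩; exact ⟨h1, h2⟩
      · rintro ⟨h1, rfl⟩; exact ⟨⟨h1, hq.2⟩, rfl⟩
    · intro t ht
      rw [hA, mem_fib] at ht
      exact mem_fib.2 ⟨h.it_lt t ht.1, ht.2⟩
  have hz : ∑ q ∈ X, F.z q = ∑ t ∈ A, p t + sm * ∑ q ∈ X, ((fib F.it n q).image c).card := by
    rw [hsum, Finset.mul_sum, ← Finset.sum_add_distrib]
    exact Finset.sum_congr rfl fun q hq => h.z_eq q (mem_fib.1 hq).1
  have hsub : A.image c ⊆ X.biUnion fun q => (fib F.it n q).image c := by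
    intro k hk
    obtain ⟨t, ht, rfl⟩ := Finset.mem_image.1 hk
    rw [hA, mem_fib] at ht
    exact Finset.mem_biUnion.2 ⟨F.it t, mem_fib.2 ⟨h.it_lt t ht.1, ht.2⟩,
      Finset.mem_image_of_mem c (mem_fib.2 ⟨ht.1, rfl⟩)⟩
  have h1 : ∑ t ∈ A, p t + s * (A.image c).card ≤ ∑ q ∈ X, F.z q + s' * (X.image F.cl).card := by
    rw [hz]
    rcases hκ with ⟨rfl, rfl⟩ | ⟨rfl, rfl⟩
    · have := Nat.mul_le_mul_left sm ((Finset.card_le_card hsub).trans Finset.card_biUnion_le)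
      omega
    · have : A.image κ ⊆ X.image F.cl := by
        intro k hk
        obtain ⟨t, ht, rfl⟩ := Finset.mem_image.1 hk
        rw [hA, mem_fib] at ht
        exact Finset.mem_image.2 ⟨F.it t, mem_fib.2 ⟨h.it_lt t ht.1, ht.2⟩, h.cl_it t ht.1⟩
      have := Nat.mul_le_mul_left s' (Finset.card_le_card this)
      omega
  unfold mload at hb
  have h2 : ∑ q ∈ X, F.z q ≤ g * ∑ q ∈ X, rnd g C (F.z q) := by
    rw [Finset.mul_sum]
    refine Finset.sum_le_sum fun q hq => ?_
    rcases rnd_cases g C (F.z q) with h3 | h3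
    · exact h3
    · have : rnd g C (F.z q) ≤ ∑ q ∈ X, rnd g C (F.z q) :=
        Finset.single_le_sum (f := fun q => rnd g C (F.z q)) (fun _ _ => Nat.zero_le _) hq
      dsimp only at hb
      omega
  have h3 : s' * (X.image F.cl).card ≤ g * (rs * (X.image F.cl).card) := by
    rcases hrs with h4 | h4
    · have := Nat.mul_le_mul_right (X.image F.cl).card h4
      rwa [mul_assoc] at this
    · rcases Nat.eq_zero_or_pos (X.image F.cl).card with h5 | h5
      · simp [h5]
      · have := Nat.le_mul_of_pos_right rs h5
        omega
  unfold mload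
  have h4 := Nat.mul_le_mul_left g hb
  rw [mul_add] at h4
  dsimp only at h4
  omega

end Form

/-! ### Histograms of loads -/

/-- Uniqueness of the digits in base `B`. -/
theorem eq_of_sum_mul_pow_eq {B : ℕ} : ∀ {D : ℕ} {x y : ℕ → ℕ}, (∀ d, x d < B) → (∀ d, y d < B) →
    ∑ d ∈ Finset.range D, x d * B ^ d = ∑ d ∈ Finset.range D, y d * B ^ d →
    ∀ d < D, x d = y d := by
  intro D
  induction D with
  | zero => intro x y _ _ _ d hd; omega
  | succ D ih =>
    intro x y hx hy h
    have hs : ∀ x : ℕ → ℕ, ∑ d ∈ Finset.range (D + 1), x d * B ^ d =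
        x 0 + B * ∑ d ∈ Finset.range D, x (d + 1) * B ^ d := by
      intro x
      rw [Finset.sum_range_succ', Finset.mul_sum, pow_zero, mul_one, add_comm]
      congr 1
      exact Finset.sum_congr rfl fun d _ => by ring
    rw [hs, hs] at h
    have h0 : x 0 = y 0 := by
      have := congrArg (· % B) h
      simpa [Nat.add_mul_mod_self_left, Nat.mod_eq_of_lt (hx 0), Nat.mod_eq_of_lt (hy 0)] using this
    have h1 : ∑ d ∈ Finset.range D, x (d + 1) * B ^ d = ∑ d ∈ Finset.range D, y (d + 1) * B ^ d :=
      Nat.eq_of_mul_eq_mul_left (by have := hx 0; omega : 0 < B) (by omega)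
    intro d hd
    cases d with
    | zero => exact h0
    | succ d => exact ih (fun d => hx _) (fun d => hy _) h1 d (by omega)

/-- A sum of fewer than `B` powers of `B` determines the exponents up to their order. -/
theorem exists_perm_of_sum_pow_eq {B m : ℕ} (hm : m < B) {f g : Fin m → ℕ}
    (h : ∑ i, B ^ f i = ∑ i, B ^ g i) : ∃ π : Equiv.Perm (Fin m), ∀ i, g (π i) = f i := by
  set D := (Finset.univ.sup f) + (Finset.univ.sup g) + 1 with hD
  have hfD : ∀ i, f i < D := fun i => by
    have := Finset.le_sup (f := f) (Finset.mem_univ i); omega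
  have hgD : ∀ i, g i < D := fun i => by
    have := Finset.le_sup (f := g) (Finset.mem_univ i); omega
  have hs : ∀ f : Fin m → ℕ, (∀ i, f i < D) →
      ∑ i, B ^ f i = ∑ d ∈ Finset.range D, {i | f i = d}.toFinset.card * B ^ d := by
    intro f hf
    rw [← Finset.sum_fiberwise_of_maps_to (t := Finset.range D) (g := f)
      (fun i _ => Finset.mem_range.2 (hf i))]
    refine Finset.sum_congr rfl fun d _ => ?_
    rw [Finset.sum_congr rfl fun i hi => by rw [(Finset.mem_filter.1 hi).2], Finset.sum_const,
      smul_eq_mul]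
    simp
  have hlt : ∀ (f : Fin m → ℕ) d, {i | f i = d}.toFinset.card < B := fun f d =>
    (Finset.card_le_univ _).trans_lt (by simpa using hm)
  rw [hs f hfD, hs g hgD] at h
  have hc : ∀ d, {i | f i = d}.toFinset.card = {i | g i = d}.toFinset.card := by
    intro d
    by_cases hd : d < D
    · exact eq_of_sum_mul_pow_eq (hlt f) (hlt g) h d hd
    · have e1 : {i | f i = d}.toFinset = ∅ := by
        ext i; have := hfD i; simp; omega
      have e2 : {i | g i = d}.toFinset = ∅ := by
        ext i; have := hgD i; simp; omega
      rw [e1, e2]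
  refine ⟨Equiv.ofFiberEquiv (f := f) (g := g) fun d => Fintype.equivOfCardEq ?_, fun i =>
    Equiv.ofFiberEquiv_map _ i⟩
  have := hc d
  simpa [Fintype.card_subtype] using this

/-- The state of a machine with load `l` and last label `x - 1`, as far as it matters for an item
with label `k`: the load, and whether the machine is set up for this label. -/
def slot (l x k : ℕ) : ℕ := 2 * l + if x = k + 1 then 1 else 0

theorem slot_inj {l x l' x' k : ℕ} :
    slot l x k = slot l' x' k ↔ l = l' ∧ (x = k + 1 ↔ x' = k + 1) := by
  unfold slot
  split_ifs <;> omega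

/-- The number of machines in every state, after the items `0, …, q - 1` have been assigned by `b`,
encoded as a number in base `B`. -/
def key (B m : ℕ) (r c : ℕ → ℕ) (s : ℕ) (b : ℕ → ℕ) (q : ℕ) : ℕ :=
  ∑ i ∈ Finset.range m, B ^ (1 + slot (lev r c s b q i) (lst c b q i) (c q))

/-- Assignments with the same key can be continued in the same way: if `b` and `b'` agree in the
key, then there is a machine for the next item that makes up for the choice of `b`. -/
theorem exists_exchange {B m n : ℕ} {r c : ℕ → ℕ} {s : ℕ} {b b' : ℕ → ℕ} {q : ℕ} (hm : m < B)
    (hc : MonotoneOn c (Set.Iio (n + 1))) (hq : q < n) (hb : b q < m)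
    (h : key B m r c s b q = key B m r c s b' q) :
    ∃ i < m, key B m r c s (Function.update b' q i) (q + 1) = key B m r c s b (q + 1) ∧
      lev r c s (Function.update b' q i) (q + 1) i = lev r c s b (q + 1) (b q) := by
  unfold key at h
  simp only [pow_add, pow_one] at h
  rw [← Finset.mul_sum, ← Finset.mul_sum] at h
  have h := Nat.eq_of_mul_eq_mul_left (show 0 < B by omega) h
  rw [Finset.sum_range, Finset.sum_range] at h
  obtain ⟨π, hπ⟩ := exists_perm_of_sum_pow_eq hm h
  simp only [slot_inj] at hπ
  set i := π ⟨b q, hb⟩ with hi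
  have hup : ∀ t < q, Function.update b' q i t = b' t := fun t ht =>
    Function.update_of_ne ht.ne _ _
  have hlev : ∀ t, lev r c s (Function.update b' q i) q t = lev r c s b' q t := fun t =>
    (lev_congr hup).1
  have hlst : ∀ t, lst c (Function.update b' q i) q t = lst c b' q t := fun t =>
    (lev_congr (r := r) (s := s) hup).2
  have hcc : c q ≤ c (q + 1) := hc (by simp; omega) (by simp; omega) (by omega)
  have hone : ∀ t : Fin m, lev r c s (Function.update b' q i) (q + 1) (π t) =
      lev r c s b (q + 1) t ∧ (lst c (Function.update b' q i) (q + 1) (π t) = c (q + 1) + 1 ↔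
        lst c b (q + 1) t = c (q + 1) + 1) := by
    intro t
    obtain ⟨h1, h2⟩ := hπ t
    have h3 : ((i : Fin m) : ℕ) = (π t : ℕ) ↔ b q = t := by
      rw [hi, Fin.val_inj, π.injective.eq_iff, Fin.ext_iff]
    rw [lev, lev, lst, lst, Function.update_self, hlev, hlst, h1]
    simp only [h3, h2]
    refine ⟨trivial, ?_⟩
    split_ifs with h4
    · rfl
    · have h5 := lst_le (b := b) (i := t) hc hq.le
      have h6 := lst_le (b := b') (i := π t) hc hq.le
      rcases Nat.lt_or_eq_of_le hcc with h7 | h7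
      · constructor <;> intro <;> omega
      · rw [← h7]; exact h2
  refine ⟨i, i.2, ?_, ?_⟩
  · unfold key
    rw [Finset.sum_range, Finset.sum_range, ← Equiv.sum_comp π]
    refine Finset.sum_congr rfl fun t _ => ?_
    rw [slot_inj.2 (hone t)]
  · exact (hone ⟨b q, hb⟩).1

theorem slot_le {l x k C : ℕ} (h : l ≤ C) : slot l x k ≤ 2 * C + 1 := by
  unfold slot
  split_ifs <;> omega

/-- Loads of at most `C` admit only polynomially many keys. -/
theorem key_lt {B m C : ℕ} {r c : ℕ → ℕ} {s : ℕ} {b : ℕ → ℕ} {q : ℕ} (hm : m < B)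
    (h : ∀ i < m, lev r c s b q i ≤ C) : key B m r c s b q < B ^ (2 * C + 3) := by
  calc key B m r c s b q ≤ ∑ i ∈ Finset.range m, B ^ (2 * C + 2) := by
        refine Finset.sum_le_sum fun i hi => Nat.pow_le_pow_right (by omega) ?_
        have := slot_le (x := lst c b q i) (k := c q) (h i (Finset.mem_range.1 hi))
        omega
  _ = m * B ^ (2 * C + 2) := by simp
  _ < B * B ^ (2 * C + 2) := Nat.mul_lt_mul_of_pos_right hm (Nat.pow_pos (by omega))
  _ = B ^ (2 * C + 3) := by ring

/-- Keys are multiples of `B`, so that blocks of `B` cells that start at different keys are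
disjoint. -/
theorem dvd_key (B m : ℕ) (r c : ℕ → ℕ) (s : ℕ) (b : ℕ → ℕ) (q : ℕ) : B ∣ key B m r c s b q :=
  Finset.dvd_sum fun _ _ => dvd_pow_self _ (by omega)

/-! ### Building blocks of programs -/

namespace RAM

theorem Store.write_apply (σ : Store) (a i v b : ℕ) :
    σ.write a i v b = if b = a then Function.update (σ a) i v else σ b := by
  funext l
  unfold Store.write
  by_cases h : b = a
  · subst h
    by_cases hl : l = i
    · subst hl; simp
    · simp [hl]
  · simp [h]

namespace Expr

/-- A scalar variable is kept in cell `0` of an array. -/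
def var (a : ℕ) : Expr := .get a (.lit 0)

/-- Comparison `e < f`. -/
def lt (e f : Expr) : Expr := .sub f e

/-- Negation: `1` if `e` is zero, and `0` otherwise. -/
def neg (e : Expr) : Expr := .sub (.lit 1) e

/-- Conjunction. -/
def both (e f : Expr) : Expr := neg (.add (neg e) (neg f))

/-- Equality: `1` if `e` and `f` have the same value, and `0` otherwise. -/
def eq (e f : Expr) : Expr := neg (.add (.sub e f) (.sub f e))

/-- Multiplication by a constant. -/
def smul : ℕ → Expr → Expr
  | 0, _ => .lit 0
  | n + 1, e => .add (smul n e) e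

/-- Rounded division by `g`, truncated at `C`; see `rnd`. -/
def round (g z : Expr) : ℕ → Expr
  | 0 => .lit 0
  | C + 1 => .add (round g z C) (neg (neg (lt (smul C g) z)))

variable (σ : Store) (e f g z : Expr)

@[simp] theorem eval_lit (v : ℕ) : (lit v).eval σ = v := rfl
@[simp] theorem eval_get (a : ℕ) : (get a e).eval σ = σ a (e.eval σ) := rfl
@[simp] theorem eval_add : (add e f).eval σ = e.eval σ + f.eval σ := rfl
@[simp] theorem eval_sub : (sub e f).eval σ = e.eval σ - f.eval σ := rfl
@[simp] theorem eval_var (a : ℕ) : (var a).eval σ = σ a 0 := rfl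

@[simp] theorem eval_lt : (lt e f).eval σ = 0 ↔ f.eval σ ≤ e.eval σ := by
  simp [lt, Nat.sub_eq_zero_iff_le]

@[simp] theorem eval_both : (both e f).eval σ = 0 ↔ e.eval σ = 0 ∨ f.eval σ = 0 := by
  simp only [both, neg, eval_add, eval_sub, eval_lit]
  omega

@[simp] theorem eval_eq : (eq e f).eval σ = if e.eval σ = f.eval σ then 1 else 0 := by
  simp only [eq, neg, eval_add, eval_sub, eval_lit]
  split_ifs <;> omega

@[simp] theorem eval_smul (n : ℕ) : (smul n e).eval σ = n * e.eval σ := by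
  induction n with
  | zero => simp [smul]
  | succ n ih => rw [smul, eval_add, ih, Nat.succ_mul]

theorem eval_round (C : ℕ) : (round g z (C + 1)).eval σ = rnd (g.eval σ) C (z.eval σ) := by
  unfold rnd
  generalize C + 1 = C
  induction C with
  | zero => simp [round]
  | succ C ih =>
    rw [round, eval_add, ih, Finset.sum_range_succ]
    congr 1
    simp only [neg, lt, eval_sub, eval_lit, eval_smul]
    split_ifs <;> omega

end Expr

namespace Cmd

/-- Assignment to a scalar variable. -/
def set (a : ℕ) (e : Expr) : Cmd := .put a (.lit 0) e

variable (B : ℕ) (σ : Store)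

@[simp] theorem exec_skip : skip.exec B σ = σ := rfl

@[simp] theorem exec_put (a : ℕ) (e f : Expr) :
    (put a e f).exec B σ = σ.write a (e.eval σ) (f.eval σ) := rfl

@[simp] theorem exec_set (a : ℕ) (e : Expr) : (set a e).exec B σ = σ.write a 0 (e.eval σ) := rfl

@[simp] theorem exec_seq (c d : Cmd) : (seq c d).exec B σ = d.exec B (c.exec B σ) := rfl

@[simp] theorem exec_ite (e : Expr) (c d : Cmd) :
    (ite e c d).exec B σ = if e.eval σ = 0 then d.exec B σ else c.exec B σ := rfl

@[simp] theorem mods_set (a : ℕ) (e : Expr) : (set a e).mods = [a] := rfl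

end Cmd

end RAM

open RAM

attribute [simp] RAM.Cmd.mods

infixr:60 " ;; " => RAM.Cmd.seq

/-! ### Sorting the jobs by class -/

-- Names of arrays. A name with initial `v` denotes a scalar variable, kept in cell `0`. The bound on
-- the loops is `vB`; `aOrd` lists the jobs by class, `aP` and `aC` their scaled sizes and classes,
-- `vCnt` the number of jobs listed; `vMax` is the largest size; `aW` contains the powers of `vB`.

notation "vB" => (5 : ℕ)
notation "aOrd" => (6 : ℕ)
notation "aP" => (7 : ℕ)
notation "aC" => (8 : ℕ)
notation "vCnt" => (9 : ℕ)
notation "vCls" => (10 : ℕ)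
notation "vJob" => (11 : ℕ)
notation "vMax" => (12 : ℕ)
notation "aW" => (13 : ℕ)
notation "vDig" => (14 : ℕ)

/-- Computes the powers of `B`. -/
def powersCmd : Cmd :=
  .put aW (.lit 0) (.lit 1) ;;
  .rep (
    .rep (.put aW (.add (.var vDig) (.lit 1))
      (.add (.get aW (.add (.var vDig) (.lit 1))) (.get aW (.var vDig)))) ;;
    .set vDig (.add (.var vDig) (.lit 1)))

theorem exec_powersCmd {B : ℕ} {σ : Store} (hW : ∀ i, σ aW i = 0) (hd : σ vDig 0 = 0) :
    ∀ i ≤ B, powersCmd.exec B σ aW i = B ^ i := by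
  have key := Cmd.exec_rep (B := B)
    (c := .rep (.put aW (.add (.var vDig) (.lit 1))
      (.add (.get aW (.add (.var vDig) (.lit 1))) (.get aW (.var vDig)))) ;;
    .set vDig (.add (.var vDig) (.lit 1)))
    (fun d τ => τ vDig 0 = d ∧ (∀ i ≤ d, τ aW i = B ^ i) ∧ ∀ i > d, τ aW i = 0)
    (σ := σ.write aW 0 1) (by
      simp only [Store.write_apply]
      refine ⟨by simpa using hd, ?_, ?_⟩
      · intro i hi
        obtain rfl : i = 0 := by omega
        simp
      · intro i hi
        simp [Function.update_of_ne (show i ≠ 0 by omega), hW]) (by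
      rintro d - τ ⟨h1, h2, h3⟩
      have inner := Cmd.exec_rep (B := B) (c := .put aW (.add (.var vDig) (.lit 1))
        (.add (.get aW (.add (.var vDig) (.lit 1))) (.get aW (.var vDig))))
        (fun j υ => υ vDig 0 = d ∧ (∀ i ≤ d, υ aW i = B ^ i) ∧ υ aW (d + 1) = j * B ^ d ∧
          ∀ i > d + 1, υ aW i = 0) (σ := τ)
        ⟨h1, h2, by simp [h3], fun i hi => h3 i (by omega)⟩ (by
          rintro j - υ ⟨k1, k2, k3, k4⟩
          refine ⟨by simp [Store.write_apply, k1], ?_, ?_, ?_⟩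
          · intro i hi
            simp [Store.write_apply, k1, Function.update_of_ne (show i ≠ d + 1 by omega), k2 i hi]
          · simp [Store.write_apply, k1, k3, k2, Nat.succ_mul]
          · intro i hi
            simp [Store.write_apply, k1, Function.update_of_ne (show i ≠ d + 1 by omega), k4 i hi])
      obtain ⟨k1, k2, k3, k4⟩ := inner
      rw [Cmd.exec_seq]
      generalize (Cmd.rep _).exec B τ = υ at *
      refine ⟨by simp [Store.write_apply, k1], ?_, ?_⟩
      · intro i hi
        rcases Nat.lt_succ_iff_lt_or_eq.1 (Nat.lt_succ_of_le hi) with hi | rfl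
        · simpa [Store.write_apply] using k2 i (by omega)
        · simpa [Store.write_apply, pow_succ'] using k3
      · intro i hi
        simpa [Store.write_apply] using k4 i (by omega))
  exact key.2.1

/-- Appends job `vJob` to the sorted list, if it has class `vCls`; its size is multiplied
by `f`. -/
def sortStep (f : ℕ) : Cmd :=
  .ite (.both (.lt (.var vJob) (.get 0 (.lit 0))) (.eq (.get 2 (.var vJob)) (.var vCls)))
    (.put aOrd (.var vCnt) (.var vJob) ;;
     .put aP (.var vCnt) (.smul f (.get 1 (.var vJob))) ;;
     .put aC (.var vCnt) (.var vCls) ;;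
     .set vMax (.add (.var vMax) (.sub (.get 1 (.var vJob)) (.var vMax))) ;;
     .set vCnt (.add (.var vCnt) (.lit 1)))
    .skip ;;
  .set vJob (.add (.var vJob) (.lit 1))

/-- Lists the jobs by class. -/
def sortCmd (f : ℕ) : Cmd :=
  .rep (.set vJob (.lit 0) ;; .rep (sortStep f) ;; .set vCls (.add (.var vCls) (.lit 1)))

/-- The state of the sorting procedure when the first `x` classes have been treated, and the first
`j` jobs have been scanned for the next class. -/
structure SortInv (f : ℕ) (σ : Store) (x j : ℕ) (τ : Store) : Prop where
  in0 : τ 0 = σ 0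
  in1 : τ 1 = σ 1
  in2 : τ 2 = σ 2
  cls : τ vCls 0 = x
  job : τ vJob 0 = j
  ord_lt : ∀ t < τ vCnt 0, τ aOrd t < σ 0 0
  p_eq : ∀ t < τ vCnt 0, τ aP t = f * σ 1 (τ aOrd t)
  c_eq : ∀ t < τ vCnt 0, τ aC t = σ 2 (τ aOrd t)
  mem : ∀ l < σ 0 0, (σ 2 l < x ∨ σ 2 l = x ∧ l < j) ↔ ∃ t < τ vCnt 0, τ aOrd t = l
  inj : ∀ t < τ vCnt 0, ∀ t' < τ vCnt 0, τ aOrd t = τ aOrd t' → t = t'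
  mono : ∀ t t', t ≤ t' → t' < τ vCnt 0 → τ aC t ≤ τ aC t'
  le_max : ∀ t < τ vCnt 0, σ 1 (τ aOrd t) ≤ τ vMax 0
  max_le : ∀ M, (∀ l < σ 0 0, σ 1 l ≤ M) → τ vMax 0 ≤ M

theorem SortInv.step {B f : ℕ} {σ τ : Store} {x j : ℕ} (h : SortInv f σ x j τ) :
    SortInv f σ x (j + 1) ((sortStep f).exec B τ) := by
  obtain ⟨i0, i1, i2, h1, h2, h3, h4, h5, h6, h7, h8, h9, h10⟩ := h
  by_cases hg : j < σ 0 0 ∧ σ 2 j = x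
  · have hnot : ∀ t < τ vCnt 0, τ aOrd t ≠ j := by
      intro t ht he
      have := (h6 j hg.1).2 ⟨t, ht, he⟩
      omega
    have hcle : ∀ t < τ vCnt 0, τ aC t ≤ x := by
      intro t ht
      rw [h5 t ht]
      have := (h6 _ (h3 t ht)).2 ⟨t, ht, rfl⟩
      omega
    simp only [sortStep, Cmd.exec_seq, Cmd.exec_ite, Expr.eval_both, Expr.eval_lt, Expr.eval_get,
      Expr.eval_var, Expr.eval_lit, Expr.eval_eq, i0, i2, h1, h2]
    rw [if_neg (by simp; omega)]
    simp only [Cmd.exec_put, Cmd.exec_set, Store.write_apply, Expr.eval_get,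
      Expr.eval_var, Expr.eval_lit, Expr.eval_smul, Expr.eval_add, Expr.eval_sub]
    generalize hn : τ vCnt 0 = n at *
    have hup : ∀ {g : ℕ → ℕ} {y : ℕ}, ∀ t < n, Function.update g n y t = g t := fun t ht =>
      Function.update_of_ne ht.ne _ _
    constructor <;> simp only [Store.write_apply] <;> simp [hn, h1, h2, i0, i1, i2]
    · intro t ht
      rcases Nat.lt_or_eq_of_le ht with ht | rfl
      · rw [hup t ht]; exact h3 t ht
      · simpa using hg.1
    · intro t ht
      rcases Nat.lt_or_eq_of_le ht with ht | rfl
      · rw [hup t ht, hup t ht]; exact h4 t ht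
      · simp
    · intro t ht
      rcases Nat.lt_or_eq_of_le ht with ht | rfl
      · rw [hup t ht, hup t ht]; exact h5 t ht
      · simpa using hg.2.symm
    · intro l hl
      constructor
      · intro h
        by_cases hlj : l = j
        · exact ⟨n, by omega, by simp [hlj]⟩
        · obtain ⟨t, ht, ht'⟩ := (h6 l hl).1 (by omega)
          exact ⟨t, by omega, by rw [hup t ht, ht']⟩
      · rintro ⟨t, ht, rfl⟩
        rcases Nat.lt_or_eq_of_le ht with ht | rfl
        · rw [hup t ht] at hl ⊢
          have := (h6 _ hl).2 ⟨t, ht, rfl⟩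
          omega
        · rw [Function.update_self]
          omega
    · intro t ht t' ht'
      rcases Nat.lt_or_eq_of_le ht with ht | rfl <;>
        rcases Nat.lt_or_eq_of_le ht' with ht' | rfl
      · rw [hup t ht, hup t' ht']; exact h7 t ht t' ht'
      · rw [hup t ht, Function.update_self]; exact fun h => absurd h (hnot t ht)
      · rw [hup t' ht', Function.update_self]; exact fun h => absurd h.symm (hnot t' ht')
      · simp
    · intro t t' htt ht'
      rcases Nat.lt_or_eq_of_le ht' with ht' | rfl
      · rw [hup t (by omega), hup t' ht']; exact h8 t t' htt ht'
      · rcases Nat.lt_or_eq_of_le htt with ht | rfl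
        · rw [hup t ht, Function.update_self]; exact hcle t ht
        · rfl
    · intro t ht
      rcases Nat.lt_or_eq_of_le ht with ht | rfl
      · rw [hup t ht]; have := h9 t ht; omega
      · simp; omega
    · intro M hM
      have e1 := h10 M hM
      have e2 := hM j hg.1
      omega
  · have hstep : (sortStep f).exec B τ = τ.write vJob 0 (j + 1) := by
      simp only [sortStep, Cmd.exec_seq, Cmd.exec_ite, Expr.eval_both, Expr.eval_lt, Expr.eval_get,
        Expr.eval_var, Expr.eval_lit, Expr.eval_eq, i0, i2, h1, h2]
      rw [if_pos (by simp; omega)]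
      simp [h2]
    rw [hstep]
    have h6' : ∀ l < σ 0 0, (σ 2 l < x ∨ σ 2 l = x ∧ l < j + 1) ↔
        ∃ t < τ vCnt 0, τ aOrd t = l := by
      intro l hl
      rw [← h6 l hl]
      constructor
      · rintro (h | h)
        · exact Or.inl h
        · by_cases hlj : l = j
          · subst hlj; exact absurd ⟨hl, h.1⟩ hg
          · exact Or.inr ⟨h.1, by omega⟩
      · rintro (h | h)
        · exact Or.inl h
        · exact Or.inr ⟨h.1, by omega⟩
    constructor <;> simp only [Store.write_apply] <;> simp only [Nat.reduceEqDiff,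
      reduceIte, OfNat.zero_ne_ofNat, OfNat.one_ne_ofNat]
    exacts [i0, i1, i2, h1, by simp, h3, h4, h5, h6', h7, h8, h9, h10]

theorem exec_sortCmd {B f : ℕ} {σ : Store} (hn : σ 0 0 ≤ B) (hcls : σ vCls 0 = 0)
    (hcnt : σ vCnt 0 = 0) (hmax : σ vMax 0 = 0) :
    SortInv f σ B 0 (((sortCmd f).exec B σ).write vJob 0 0) := by
  have hset : ∀ {x j : ℕ} {τ : Store} (j' : ℕ), SortInv f σ x j τ →
      (∀ l < σ 0 0, (σ 2 l < x ∨ σ 2 l = x ∧ l < j) ↔ (σ 2 l < x ∨ σ 2 l = x ∧ l < j')) →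
      SortInv f σ x j' (τ.write vJob 0 j') := by
    intro x j τ j' h hj
    obtain ⟨i0, i1, i2, h1, h2, h3, h4, h5, h6, h7, h8, h9, h10⟩ := h
    constructor <;> simp only [Store.write_apply] <;> simp only [Nat.reduceEqDiff,
      reduceIte, OfNat.zero_ne_ofNat, OfNat.one_ne_ofNat]
    exacts [i0, i1, i2, h1, by simp, h3, h4, h5, fun l hl => (hj l hl).symm.trans (h6 l hl), h7,
      h8, h9, h10]
  refine Cmd.exec_rep (B := B) (c := _) (fun x τ => SortInv f σ x 0 (τ.write vJob 0 0)) ?_ ?_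
  · constructor <;> simp [Store.write_apply, hcls, hcnt, hmax]
  · intro x _ τ h
    have h1 : SortInv f σ x 0 ((Cmd.set vJob (.lit 0)).exec B τ) := h
    have h2 := Cmd.exec_rep (B := B) (c := sortStep f) (SortInv f σ x) h1
      fun j _ υ hυ => hυ.step
    rw [Cmd.exec_seq, Cmd.exec_seq]
    generalize (Cmd.rep (sortStep f)).exec B _ = υ at *
    have h3 := h2.cls
    obtain ⟨i0, i1, i2, h1, h2, h3, h4, h5, h6, h7, h8, h9, h10⟩ := h2
    have h6' : ∀ l < σ 0 0, (σ 2 l < x + 1 ∨ σ 2 l = x + 1 ∧ l < 0) ↔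
        ∃ t < υ vCnt 0, υ aOrd t = l := by
      intro l hl
      rw [← h6 l hl]
      omega
    constructor <;> simp only [Cmd.exec_set, Store.write_apply] <;> simp only [Nat.reduceEqDiff,
      reduceIte, OfNat.zero_ne_ofNat, OfNat.one_ne_ofNat]
    exacts [i0, i1, i2, by simp [h1], by simp, h3, h4, h5, h6', h7, h8, h9, h10]

theorem SortInv.cnt_eq {f x j : ℕ} {σ τ : Store} (h : SortInv f σ x j τ)
    (hx : ∀ l < σ 0 0, σ 2 l < x) : τ vCnt 0 = σ 0 0 := by
  apply le_antisymm
  · simpa using Finset.card_le_card_of_injOn (s := Finset.range (τ vCnt 0))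
      (t := Finset.range (σ 0 0)) (τ aOrd)
      (fun t ht => by simpa using h.ord_lt t (by simpa using ht))
      (fun t ht t' ht' => h.inj t (by simpa using ht) t' (by simpa using ht'))
  · have : Finset.range (σ 0 0) ⊆ (Finset.range (τ vCnt 0)).image (τ aOrd) := by
      intro l hl
      rw [Finset.mem_range] at hl
      obtain ⟨t, ht, ht'⟩ := (h.mem l hl).1 (Or.inl (hx l hl))
      exact Finset.mem_image.2 ⟨t, Finset.mem_range.2 ht, ht'⟩
    simpa using (Finset.card_le_card this).trans Finset.card_image_le

/-! ### The program that groups the jobs -/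

-- `vU` is the increment of the scale `vG`, `vS` the scaled setup time, and `vDone` tells whether an
-- assignment has been found. The grouping has the setup `vSm` that is included in the items, the
-- threshold `vThr` for large jobs, and the rounded setup `vRs` between items. Its state consists of
-- `vN`, `vCur`, `vLc`, `aZ`, `aCl`, `aIt` (see `Form`); `aR` contains the rounded sizes of the items.

notation "vU" => (15 : ℕ)
notation "vS" => (16 : ℕ)
notation "vG" => (17 : ℕ)
notation "vDone" => (18 : ℕ)
notation "vSm" => (19 : ℕ)
notation "vThr" => (20 : ℕ)
notation "vRs" => (21 : ℕ)
notation "vMode" => (22 : ℕ)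
notation "vN" => (23 : ℕ)
notation "vCur" => (24 : ℕ)
notation "vLc" => (25 : ℕ)
notation "aZ" => (26 : ℕ)
notation "aCl" => (27 : ℕ)
notation "aIt" => (28 : ℕ)
notation "vT" => (29 : ℕ)
notation "vK" => (30 : ℕ)
notation "aR" => (31 : ℕ)

/-- Opens a new item for job `vT`. -/
def newItem : Cmd :=
  .put aZ (.var vN) (.add (.get aP (.var vT)) (.var vSm)) ;;
  .put aCl (.var vN) (.var vK) ;;
  .put aIt (.var vT) (.var vN) ;;
  .set vN (.add (.var vN) (.lit 1))

/-- The item of the container opened last. -/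
def lastItem : Expr := .sub (.var vCur) (.lit 1)

/-- Treats job `vT`; see `Form.step`. -/
def groupStep : Cmd :=
  .ite (.lt (.var vT) (.get 0 (.lit 0)))
    (.ite (.var vMode) (.set vK (.lit 0)) (.set vK (.get aC (.var vT))) ;;
     .ite (.lt (.get aP (.var vT)) (.var vThr))
      (.ite (.both (.var vCur) (.both (.lt (.get aZ lastItem) (.var vThr))
          (.eq (.get aCl lastItem) (.var vK))))
        (.ite (.eq (.var vLc) (.add (.get aC (.var vT)) (.lit 1))) .skip
          (.put aZ lastItem (.add (.get aZ lastItem) (.var vSm))) ;;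
         .put aZ lastItem (.add (.get aZ lastItem) (.get aP (.var vT))) ;;
         .put aIt (.var vT) lastItem)
        (newItem ;; .set vCur (.var vN)) ;;
       .set vLc (.add (.get aC (.var vT)) (.lit 1)))
      newItem ;;
     .set vT (.add (.var vT) (.lit 1)))
    .skip

/-- The memory `τ` contains the state `F` of the grouping procedure. -/
structure Form.IsStored (F : Form) (τ : Store) : Prop where
  N : τ vN 0 = F.N
  cur : τ vCur 0 = F.cur
  lc : τ vLc 0 = F.lc
  z : τ aZ = F.z
  cl : τ aCl = F.cl
  it : τ aIt = F.it

theorem Form.IsStored.step {B : ℕ} {F : Form} {τ : Store} (h : F.IsStored τ)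
    (ht : τ vT 0 < τ 0 0) :
    (F.step (τ vSm 0) (τ vThr 0) (τ aP) (τ aC) (fun t => if τ vMode 0 = 0 then τ aC t else 0)
      (τ vT 0)).IsStored (groupStep.exec B τ) ∧ groupStep.exec B τ vT 0 = τ vT 0 + 1 := by
  obtain ⟨h1, h2, h3, h4, h5, h6⟩ := h
  have e1 : groupStep.exec B τ =
      (Cmd.ite (.lt (.get aP (.var vT)) (.var vThr))
      (.ite (.both (.var vCur) (.both (.lt (.get aZ lastItem) (.var vThr))
          (.eq (.get aCl lastItem) (.var vK))))
        (.ite (.eq (.var vLc) (.add (.get aC (.var vT)) (.lit 1))) .skip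
          (.put aZ lastItem (.add (.get aZ lastItem) (.var vSm))) ;;
         .put aZ lastItem (.add (.get aZ lastItem) (.get aP (.var vT))) ;;
         .put aIt (.var vT) lastItem)
        (newItem ;; .set vCur (.var vN)) ;;
       .set vLc (.add (.get aC (.var vT)) (.lit 1)))
      newItem ;; .set vT (.add (.var vT) (.lit 1))).exec B
      (τ.write vK 0 (if τ vMode 0 = 0 then τ aC (τ vT 0) else 0)) := by
    rw [groupStep, Cmd.exec_ite, if_neg (by simpa using ht), Cmd.exec_seq]
    congr 1
    rw [Cmd.exec_ite]
    simp only [Expr.eval_var, Cmd.exec_set, Expr.eval_get, Expr.eval_lit]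
    by_cases h : τ vMode 0 = 0 <;> simp [h]
  rw [e1]
  unfold Form.step
  by_cases hp : τ vThr 0 ≤ τ aP (τ vT 0)
  · rw [if_pos hp, Cmd.exec_seq, Cmd.exec_ite, if_pos (by simpa [Store.write_apply] using hp)]
    refine ⟨?_, by simp [newItem, Store.write_apply]⟩
    constructor <;> simp [newItem, Store.write_apply, h1, h2, h3, h4, h5, h6]
  · rw [if_neg hp]
    have hp' : ((Expr.lt (.get aP (.var vT)) (.var vThr)).eval
        (τ.write vK 0 (if τ vMode 0 = 0 then τ aC (τ vT 0) else 0))) ≠ 0 := by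
      simpa [Store.write_apply] using hp
    have hjiff : ((Expr.both (.var vCur) (.both (.lt (.get aZ lastItem) (.var vThr))
          (.eq (.get aCl lastItem) (.var vK)))).eval
          (τ.write vK 0 (if τ vMode 0 = 0 then τ aC (τ vT 0) else 0)) = 0) ↔
        ¬ F.Joins (τ vThr 0) (fun t => if τ vMode 0 = 0 then τ aC t else 0) (τ vT 0) := by
      simp only [Expr.eval_both, Expr.eval_lt, Expr.eval_eq, Expr.eval_var, Expr.eval_get,
        lastItem, Expr.eval_sub, Expr.eval_lit, Store.write_apply, Nat.reduceEqDiff, reduceIte,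
        Function.update_self, h2, h4, h5, Form.Joins]
      generalize (if τ vMode 0 = 0 then τ aC (τ vT 0) else 0) = k
      split_ifs with h <;> simp [h]
      tauto
    by_cases hj : F.Joins (τ vThr 0) (fun t => if τ vMode 0 = 0 then τ aC t else 0) (τ vT 0)
    · rw [if_pos hj, Cmd.exec_seq, Cmd.exec_ite, if_neg hp', Cmd.exec_seq, Cmd.exec_ite,
        if_neg (fun h => (hjiff.1 h) hj), Cmd.exec_seq, Cmd.exec_ite]
      have hc : (Expr.eq (.var vLc) (.add (.get aC (.var vT)) (.lit 1))).eval
          (τ.write vK 0 (if τ vMode 0 = 0 then τ aC (τ vT 0) else 0)) = 0 ↔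
          ¬ F.lc = τ aC (τ vT 0) + 1 := by
        simp [Store.write_apply, h3]
      by_cases hlc : F.lc = τ aC (τ vT 0) + 1
      · rw [if_neg (fun h => hc.1 h hlc)]
        refine ⟨?_, by simp [Store.write_apply]⟩
        constructor <;> simp [lastItem, Store.write_apply, h1, h2, h4, h5, h6, hlc]
      · rw [if_pos (hc.2 hlc)]
        refine ⟨?_, by simp [Store.write_apply]⟩
        constructor <;> simp [lastItem, Store.write_apply, h1, h2, h4, h5, h6, hlc]
    · rw [if_neg hj, Cmd.exec_seq, Cmd.exec_ite, if_neg hp', Cmd.exec_seq, Cmd.exec_ite,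
        if_pos (hjiff.2 hj)]
      refine ⟨?_, by simp [newItem, Store.write_apply]⟩
      constructor <;> simp [newItem, Store.write_apply, h1, h4, h5, h6]

/-- Chooses the parameters of the grouping, depending on whether setups are short or long compared
with `vG`. -/
def modeCmd (e C : ℕ) : Cmd :=
  .set vMode (.lt (.var vS) (.smul (2 * e ^ 2) (.var vG))) ;;
  .ite (.var vMode)
    (.set vSm (.var vS) ;; .set vThr (.smul (2 * e ^ 3) (.var vG)) ;; .set vRs (.lit 0))
    (.set vSm (.lit 0) ;; .set vThr (.smul e (.var vG)) ;;
      .set vRs (.round (.var vG) (.var vS) (C + 1)))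

/-- Groups the jobs into items and computes the rounded sizes of the items. A label larger than
all others is appended to the list of labels. -/
def groupCmd (e C : ℕ) : Cmd :=
  modeCmd e C ;;
  .set vN (.lit 0) ;; .set vCur (.lit 0) ;; .set vLc (.lit 0) ;; .set vT (.lit 0) ;;
  .rep groupStep ;;
  .put aCl (.var vN) (.var vB) ;;
  .set vT (.lit 0) ;;
  .rep (.put aR (.var vT) (.round (.var vG) (.get aZ (.var vT)) (C + 1)) ;;
    .set vT (.add (.var vT) (.lit 1)))

theorem exec_rep_groupStep {B : ℕ} {σ : Store} (hn : σ 0 0 ≤ B) (hN : σ vN 0 = 0)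
    (hcur : σ vCur 0 = 0) (hlc : σ vLc 0 = 0) (hT : σ vT 0 = 0) :
    ∃ z₀ cl₀ it₀, (Form.run (σ vSm 0) (σ vThr 0) (σ aP) (σ aC)
      (fun t => if σ vMode 0 = 0 then σ aC t else 0) z₀ cl₀ it₀ (σ 0 0)).IsStored
        ((Cmd.rep groupStep).exec B σ) := by
  refine ⟨σ aZ, σ aCl, σ aIt, ?_⟩
  have hmods : ∀ a ∈ [0, aP, aC, vThr, vSm, vMode], ∀ τ : Store,
      groupStep.exec B τ a = τ a := by
    intro a ha τ
    refine Cmd.exec_frame _ ?_ τ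
    simp only [groupStep, newItem, Cmd.mods, Cmd.mods_set]
    revert a
    decide
  have := Cmd.exec_rep (B := B) (c := groupStep) (σ := σ)
    (fun t τ => (∀ a ∈ [0, aP, aC, vThr, vSm, vMode], τ a = σ a) ∧ τ vT 0 = min t (σ 0 0) ∧
      (Form.run (σ vSm 0) (σ vThr 0) (σ aP) (σ aC)
      (fun t => if σ vMode 0 = 0 then σ aC t else 0) (σ aZ) (σ aCl) (σ aIt)
      (min t (σ 0 0))).IsStored τ) ?_ ?_
  · rw [min_eq_right hn] at this
    exact this.2.2
  · refine ⟨fun _ _ => rfl, by simpa using hT, ?_⟩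
    rw [Nat.zero_min]
    exact ⟨hN, hcur, hlc, rfl, rfl, rfl⟩
  · rintro t - τ ⟨h1, h2, h3⟩
    have hin : τ 0 = σ 0 := h1 0 (by decide)
    refine ⟨fun a ha => (hmods a ha τ).trans (h1 a ha), ?_⟩
    by_cases ht : t < σ 0 0
    · rw [min_eq_left ht.le] at h2 h3
      rw [min_eq_left (show t + 1 ≤ σ 0 0 from ht)]
      have h4 := h3.step (B := B) (by rw [h2, hin]; exact ht)
      rw [h1 aP (by decide), h1 aC (by decide), h1 vThr (by decide), h1 vSm (by decide),
        h1 vMode (by decide), h2] at h4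
      exact ⟨h4.2, h4.1⟩
    · rw [min_eq_right (not_lt.1 ht)] at h2 h3
      rw [min_eq_right (show σ 0 0 ≤ t + 1 by omega)]
      have : groupStep.exec B τ = τ := by
        rw [groupStep, Cmd.exec_ite, if_pos (by simp [h2, hin]), Cmd.exec_skip]
      rw [this]
      exact ⟨h2, h3⟩

theorem exec_roundLoop {B C : ℕ} {σ : Store} (hT : σ vT 0 = 0) : ∀ q < B,
    (Cmd.rep (.put aR (.var vT) (.round (.var vG) (.get aZ (.var vT)) (C + 1)) ;;
      .set vT (.add (.var vT) (.lit 1)))).exec B σ aR q = rnd (σ vG 0) C (σ aZ q) := by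
  refine (Cmd.exec_rep (B := B) (fun t τ => τ vT 0 = t ∧ τ vG = σ vG ∧ τ aZ = σ aZ ∧
    ∀ q < t, τ aR q = rnd (σ vG 0) C (σ aZ q)) (σ := σ) ⟨hT, rfl, rfl, by simp⟩ ?_).2.2.2
  rintro t - τ ⟨h1, h2, h3, h4⟩
  simp only [Cmd.exec_seq, Cmd.exec_put, Cmd.exec_set, Store.write_apply, Expr.eval_round,
    Expr.eval_var, Expr.eval_get, Expr.eval_add, Expr.eval_lit, h1, h2, h3]
  refine ⟨by simp [h1], by simp, by simp, fun q hq => ?_⟩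
  rcases Nat.lt_succ_iff_lt_or_eq.1 hq with hq | rfl
  · simpa [Function.update_of_ne hq.ne] using h4 q hq
  · simp

/-- The grouping takes one of two forms. If setups are short, all items have the same label, and the
setups are included in their sizes. If setups are long, the label of an item is the class of its
jobs, and the rounded setup time is charged once for every label on a machine. -/
theorem exec_groupCmd {B e C : ℕ} {σ : Store} (hn : σ 0 0 ≤ B) (hB : σ vB 0 = B)
    (hc : MonotoneOn (σ aC) (Set.Iio (σ 0 0))) :
    ∃ F : Form, (groupCmd e C).exec B σ vN 0 = F.N ∧
      (∀ q < F.N, (groupCmd e C).exec B σ aCl q = F.cl q) ∧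
      (groupCmd e C).exec B σ aCl F.N = B ∧
      (∀ q < F.N, (groupCmd e C).exec B σ aR q = rnd (σ vG 0) C (F.z q)) ∧
      (groupCmd e C).exec B σ aIt = F.it ∧
      (σ vS 0 < 2 * e ^ 2 * σ vG 0 ∧
          F.Inv (σ vS 0) (2 * e ^ 3 * σ vG 0) (σ aP) (σ aC) (fun _ => 0) (σ 0 0) ∧
          (groupCmd e C).exec B σ vRs 0 = 0 ∨
        2 * e ^ 2 * σ vG 0 ≤ σ vS 0 ∧
          F.Inv 0 (e * σ vG 0) (σ aP) (σ aC) (σ aC) (σ 0 0) ∧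
          (groupCmd e C).exec B σ vRs 0 = rnd (σ vG 0) C (σ vS 0)) := by
  rw [groupCmd, Cmd.exec_seq]
  have hm0 : ∀ a ∈ [0, vB, aP, aC, vG], (modeCmd e C).exec B σ a = σ a := by
    intro a ha
    refine Cmd.exec_frame _ ?_ σ
    simp only [modeCmd, Cmd.mods, Cmd.mods_set]
    revert a
    decide
  have hm1 : σ vS 0 < 2 * e ^ 2 * σ vG 0 ∧ (modeCmd e C).exec B σ vMode 0 ≠ 0 ∧
      (modeCmd e C).exec B σ vSm 0 = σ vS 0 ∧
      (modeCmd e C).exec B σ vThr 0 = 2 * e ^ 3 * σ vG 0 ∧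
      (modeCmd e C).exec B σ vRs 0 = 0 ∨
      2 * e ^ 2 * σ vG 0 ≤ σ vS 0 ∧ (modeCmd e C).exec B σ vMode 0 = 0 ∧
      (modeCmd e C).exec B σ vSm 0 = 0 ∧
      (modeCmd e C).exec B σ vThr 0 = e * σ vG 0 ∧
      (modeCmd e C).exec B σ vRs 0 = rnd (σ vG 0) C (σ vS 0) := by
    rcases lt_or_ge (σ vS 0) (2 * e ^ 2 * σ vG 0) with h | h
    · left
      have h0 : 2 * e ^ 2 * σ vG 0 - σ vS 0 ≠ 0 := by omega
      simp [modeCmd, Store.write_apply, Expr.lt, h0, h]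
    · right
      have h0 : 2 * e ^ 2 * σ vG 0 - σ vS 0 = 0 := by omega
      simp [modeCmd, Store.write_apply, Expr.lt, h0, h, Expr.eval_round]
  generalize (modeCmd e C).exec B σ = σ₁ at *
  simp only [Cmd.exec_seq]
  obtain ⟨σ₂, hσ₂⟩ : ∃ σ₂, σ₂ = (Cmd.set vT (.lit 0)).exec B ((Cmd.set vLc (.lit 0)).exec B
    ((Cmd.set vCur (.lit 0)).exec B ((Cmd.set vN (.lit 0)).exec B σ₁))) := ⟨_, rfl⟩
  rw [← hσ₂]
  have hm2 : ∀ a ∈ [0, vB, aP, aC, vG, vMode, vSm, vThr, vRs], σ₂ a = σ₁ a := by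
    rw [hσ₂]
    simp [Store.write_apply]
  obtain ⟨z₀, cl₀, it₀, hF⟩ := exec_rep_groupStep (B := B) (σ := σ₂)
    (by rw [hm2 0 (by decide), hm0 0 (by decide)]; exact hn) (by simp [hσ₂, Store.write_apply])
    (by simp [hσ₂, Store.write_apply]) (by simp [hσ₂, Store.write_apply])
    (by simp [hσ₂, Store.write_apply])
  rw [hm2 vSm (by decide), hm2 vThr (by decide), hm2 vMode (by decide), hm2 aP (by decide),
    hm2 aC (by decide), hm2 0 (by decide), hm0 0 (by decide), hm0 aP (by decide),
    hm0 aC (by decide)] at hF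
  have hκ : MonotoneOn (fun t => if σ₁ vMode 0 = 0 then σ aC t else 0) (Set.Iio (σ 0 0)) := by
    intro t ht t' ht' htt
    dsimp only
    split_ifs
    · exact hc ht ht' htt
    · rfl
  have hinv := Form.inv_run (sm := σ₁ vSm 0) (thr := σ₁ vThr 0) (p := σ aP) (z₀ := z₀)
    (cl₀ := cl₀) (it₀ := it₀) hc hκ (σ 0 0) le_rfl
  generalize Form.run (σ₁ vSm 0) (σ₁ vThr 0) (σ aP) (σ aC)
    (fun t => if σ₁ vMode 0 = 0 then σ aC t else 0) z₀ cl₀ it₀ (σ 0 0) = F at hF hinv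
  have hm3 : ∀ a ∈ [vB, vG, vRs], (Cmd.rep groupStep).exec B σ₂ a = σ₂ a := by
    intro a ha
    refine Cmd.exec_frame _ ?_ _
    simp only [groupStep, newItem, Cmd.mods, Cmd.mods_set]
    revert a
    decide
  generalize (Cmd.rep groupStep).exec B σ₂ = σ₃ at *
  obtain ⟨σ₄, hσ₄⟩ : ∃ σ₄, σ₄ = (Cmd.set vT (.lit 0)).exec B
    ((Cmd.put aCl (.var vN) (.var vB)).exec B σ₃) := ⟨_, rfl⟩
  rw [← hσ₄]
  have hr := exec_roundLoop (B := B) (C := C) (σ := σ₄) (by simp [hσ₄, Store.write_apply])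
  have hm5 : ∀ a ∈ [vN, aCl, aIt, vRs],
      (Cmd.rep (.put aR (.var vT) (.round (.var vG) (.get aZ (.var vT)) (C + 1)) ;;
      .set vT (.add (.var vT) (.lit 1)))).exec B σ₄ a = σ₄ a := by
    intro a ha
    refine Cmd.exec_frame _ ?_ _
    simp only [Cmd.mods, Cmd.mods_set]
    revert a
    decide
  rw [hm5 vN (by decide), hm5 aCl (by decide), hm5 aIt (by decide), hm5 vRs (by decide)]
  have hG : σ₄ vG = σ vG := by
    rw [← hm0 vG (by decide), ← hm2 vG (by decide), ← hm3 vG (by decide), hσ₄]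
    simp [Store.write_apply]
  have hZ : σ₄ aZ = F.z := by rw [hσ₄, ← hF.z]; simp [Store.write_apply]
  have hRs : σ₄ vRs = σ₁ vRs := by
    rw [← hm2 vRs (by decide), ← hm3 vRs (by decide), hσ₄]
    simp [Store.write_apply]
  have hBB : σ₃ vB 0 = B := by
    rw [hm3 vB (by decide), hm2 vB (by decide), hm0 vB (by decide), hB]
  rw [hG, hZ] at hr
  rw [hRs]
  refine ⟨F, ?_, ?_, ?_, ?_, ?_, ?_⟩
  · simp [hσ₄, Store.write_apply, hF.N]
  · intro q hq
    simp [hσ₄, Store.write_apply, hF.N, hF.cl, Function.update_of_ne hq.ne]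
  · simp [hσ₄, Store.write_apply, hF.N, hBB]
  · intro q hq
    exact hr q (hq.trans_le (hinv.N_le.trans hn))
  · simp [hσ₄, Store.write_apply, hF.it]
  · rcases hm1 with ⟨h1, h2, h3, h4, h5⟩ | ⟨h1, h2, h3, h4, h5⟩
    · left
      simp only [h2, if_false, h3, h4] at hinv
      exact ⟨h1, hinv, h5⟩
    · right
      simp only [h2, if_true, h3, h4] at hinv
      exact ⟨h1, hinv, h5⟩

/-! ### The dynamic program: one move -/

-- The states of the dynamic program are stored in `aL` (loads), `aX` (last labels) and `aA`
-- (assignment), and `aPres` tells where there is a state. The current layer starts at `vOff`. The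
-- state at hand is in `sL`, `sX`, `sA`, read from position `vSrc` and written to position `vDst`.
-- `vQ` is the item and `vLab` the label of the next one; `aAsg` is the assignment found.

notation "vOff" => (32 : ℕ)
notation "vQ" => (33 : ℕ)
notation "vX" => (34 : ℕ)
notation "vI" => (35 : ℕ)
notation "vP" => (36 : ℕ)
notation "aL" => (37 : ℕ)
notation "aX" => (38 : ℕ)
notation "aA" => (39 : ℕ)
notation "sL" => (40 : ℕ)
notation "sX" => (41 : ℕ)
notation "sA" => (42 : ℕ)
notation "vKey" => (43 : ℕ)
notation "aPres" => (44 : ℕ)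
notation "aAsg" => (45 : ℕ)
notation "vSrc" => (46 : ℕ)
notation "vDst" => (47 : ℕ)
notation "vLab" => (48 : ℕ)

/-- Copies `B` cells of the array `s`, starting at `f`, to the array `d`, starting at `e`. -/
def copyCmd (d : ℕ) (e : Expr) (s : ℕ) (f : Expr) : Cmd :=
  .set vP (.lit 0) ;;
  .rep (.put d (.add e (.var vP)) (.get s (.add f (.var vP))) ;; .set vP (.add (.var vP) (.lit 1)))

/-- Copying works as expected, provided that the expressions for the positions do not depend on the
arrays that are written to. -/
theorem exec_copyCmd {B d s : ℕ} {e f : Expr} {σ : Store} (hds : s ≠ d) (hd : d ≠ vP) (hs : s ≠ vP)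
    (he : ∀ τ : Store, (∀ a, a ≠ d → a ≠ vP → τ a = σ a) → e.eval τ = e.eval σ)
    (hf : ∀ τ : Store, (∀ a, a ≠ d → a ≠ vP → τ a = σ a) → f.eval τ = f.eval σ) :
    (∀ a, a ≠ d → a ≠ vP → (copyCmd d e s f).exec B σ a = σ a) ∧
    (∀ p < B, (copyCmd d e s f).exec B σ d (e.eval σ + p) = σ s (f.eval σ + p)) ∧
    ∀ j, (j < e.eval σ ∨ e.eval σ + B ≤ j) → (copyCmd d e s f).exec B σ d j = σ d j := by
  refine (Cmd.exec_rep (B := B) (fun t τ => τ vP 0 = t ∧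
    (∀ a, a ≠ d → a ≠ vP → τ a = σ a) ∧ (∀ p < t, τ d (e.eval σ + p) = σ s (f.eval σ + p)) ∧
    ∀ j, (j < e.eval σ ∨ e.eval σ + t ≤ j) → τ d j = σ d j)
    (σ := (Cmd.set vP (.lit 0)).exec B σ) ?_ ?_).2
  · refine ⟨by simp [Store.write_apply], ?_, by simp, ?_⟩
    · intro a _ ha
      simp [Store.write_apply, ha]
    · intro j _
      simp [Store.write_apply, hd]
  · rintro t - τ ⟨h1, h2, h3, h4⟩
    simp only [Cmd.exec_seq, Cmd.exec_put, Cmd.exec_set, Store.write_apply, Expr.eval_add,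
      Expr.eval_var, Expr.eval_get, Expr.eval_lit, he τ h2, hf τ h2, h1, h2 s hds hs, if_neg hd,
      if_neg hd.symm, if_true]
    refine ⟨by simp, fun a ha ha' => by rw [if_neg ha', if_neg ha, h2 a ha ha'], ?_, ?_⟩
    · intro p hp
      rcases Nat.lt_succ_iff_lt_or_eq.1 hp with hp | rfl
      · rw [Function.update_of_ne (by omega), h3 p hp]
      · simp
    · intro j hj
      rw [Function.update_of_ne (by omega), h4 j (by omega)]

/-- The first items, assigned by `b`, are on machines that exist, and all loads are at most `C`. -/
def Valid (m C : ℕ) (r c : ℕ → ℕ) (s q : ℕ) (b : ℕ → ℕ) : Prop :=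
  (∀ t < q, b t < m) ∧ ∀ i < m, lev r c s b q i ≤ C

/-- The state after the items `0, …, q - 1` have been assigned by `b` is stored at position `a` of
the arrays `L` (loads), `X` (last labels) and `A` (assignment). -/
structure Row (m : ℕ) (r c : ℕ → ℕ) (s : ℕ) (L X A : ℕ → ℕ) (a q : ℕ) (b : ℕ → ℕ) : Prop where
  L : ∀ p < m, L (a + p) = lev r c s b q p
  X : ∀ p < m, X (a + p) = lst c b q p
  A : ∀ t < q, A (a + t) = b t

/-- The data on which the dynamic program runs. -/
structure Env (B m N : ℕ) (r c : ℕ → ℕ) (s : ℕ) (τ : Store) : Prop where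
  m : τ 0 2 = m
  W : ∀ j ≤ B, τ aW j = B ^ j
  cl : τ aCl = c
  r : τ aR = r
  rs : τ vRs 0 = s
  N : τ vN 0 = N

/-- The data depend on these arrays only. -/
theorem Env.frame {B m N : ℕ} {r c : ℕ → ℕ} {s : ℕ} {τ τ' : Store} (h : Env B m N r c s τ)
    (hf : ∀ a ∈ [0, aW, aCl, aR, vRs, vN], τ' a = τ a) : Env B m N r c s τ' := by
  obtain ⟨h1, h2, h3, h4, h5, h6⟩ := h
  constructor
  · rw [hf 0 (by decide), h1]
  · rw [hf aW (by decide)]; exact h2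
  · rw [hf aCl (by decide), h3]
  · rw [hf aR (by decide), h4]
  · rw [hf vRs (by decide), h5]
  · rw [hf vN (by decide), h6]

/-- Makes a working copy of the state at position `vSrc`. -/
def loadRow : Cmd :=
  copyCmd sL (.lit 0) aL (.var vSrc) ;;
  copyCmd sX (.lit 0) aX (.var vSrc) ;;
  copyCmd sA (.lit 0) aA (.var vSrc)

theorem exec_loadRow {B m : ℕ} {r c : ℕ → ℕ} {s q : ℕ} {b : ℕ → ℕ} {τ : Store} (hm : m ≤ B)
    (hq : q ≤ B) (h : Row m r c s (τ aL) (τ aX) (τ aA) (τ vSrc 0) q b) :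
    Row m r c s (loadRow.exec B τ sL) (loadRow.exec B τ sX) (loadRow.exec B τ sA) 0 q b := by
  rw [loadRow, Cmd.exec_seq, Cmd.exec_seq]
  have h1 := exec_copyCmd (B := B) (d := sL) (s := aL) (e := .lit 0) (f := .var vSrc) (σ := τ)
    (by decide) (by decide) (by decide) (fun _ _ => rfl)
    fun υ hυ => by simp [hυ vSrc (by decide) (by decide)]
  generalize (copyCmd sL (.lit 0) aL (.var vSrc)).exec B τ = τ₁ at *
  have h2 := exec_copyCmd (B := B) (d := sX) (s := aX) (e := .lit 0) (f := .var vSrc) (σ := τ₁)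
    (by decide) (by decide) (by decide) (fun _ _ => rfl)
    fun υ hυ => by simp [hυ vSrc (by decide) (by decide)]
  generalize (copyCmd sX (.lit 0) aX (.var vSrc)).exec B τ₁ = τ₂ at *
  have h3 := exec_copyCmd (B := B) (d := sA) (s := aA) (e := .lit 0) (f := .var vSrc) (σ := τ₂)
    (by decide) (by decide) (by decide) (fun _ _ => rfl)
    fun υ hυ => by simp [hυ vSrc (by decide) (by decide)]
  generalize (copyCmd sA (.lit 0) aA (.var vSrc)).exec B τ₂ = τ₃ at *
  simp only [Expr.eval_lit, Expr.eval_var] at h1 h2 h3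
  have hs1 : τ₁ vSrc = τ vSrc := h1.1 _ (by decide) (by decide)
  have hs2 : τ₂ vSrc = τ vSrc := (h2.1 _ (by decide) (by decide)).trans hs1
  constructor
  · intro p hp
    rw [h3.1 sL (by decide) (by decide), h2.1 sL (by decide) (by decide), h1.2.1 p (by omega),
      h.L p hp]
  · intro p hp
    rw [h3.1 sX (by decide) (by decide), h2.2.1 p (by omega), hs1,
      h1.1 aX (by decide) (by decide), h.X p hp]
  · intro t ht
    rw [h3.2.1 t (by omega), hs2, h2.1 aA (by decide) (by decide),
      h1.1 aA (by decide) (by decide), h.A t ht]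

/-- Assigns item `vQ` to machine `vI`. -/
def stepRow : Cmd :=
  .ite (.eq (.get sX (.var vI)) (.add (.get aCl (.var vQ)) (.lit 1))) .skip
    (.put sL (.var vI) (.add (.get sL (.var vI)) (.var vRs))) ;;
  .put sL (.var vI) (.add (.get sL (.var vI)) (.get aR (.var vQ))) ;;
  .put sX (.var vI) (.add (.get aCl (.var vQ)) (.lit 1)) ;;
  .put sA (.var vQ) (.var vI)

theorem exec_stepRow {B m N : ℕ} {r c : ℕ → ℕ} {s q i : ℕ} {b : ℕ → ℕ} {τ : Store}
    (henv : Env B m N r c s τ) (hq : τ vQ 0 = q) (hi : τ vI 0 = i) (him : i < m)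
    (h : Row m r c s (τ sL) (τ sX) (τ sA) 0 q b) :
    Row m r c s (stepRow.exec B τ sL) (stepRow.exec B τ sX) (stepRow.exec B τ sA) 0 (q + 1)
      (Function.update b q i) := by
  have hup : ∀ t < q, Function.update b q i t = b t := fun t ht => Function.update_of_ne ht.ne _ _
  have hlev : ∀ p, lev r c s (Function.update b q i) q p = lev r c s b q p := fun p =>
    (lev_congr hup).1
  have hlst : ∀ p, lst c (Function.update b q i) q p = lst c b q p := fun p =>
    (lev_congr (r := r) (s := s) hup).2
  obtain ⟨h1, h2, h3⟩ := h
  simp only [zero_add] at h1 h2 h3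
  have e1 : stepRow.exec B τ sL = Function.update (τ sL) i
      (lev r c s b q i + r q + if lst c b q i = c q + 1 then 0 else s) := by
    simp only [stepRow, Cmd.exec_seq, Cmd.exec_ite, Expr.eval_eq, Expr.eval_get, Expr.eval_var,
      Expr.eval_add, Expr.eval_lit, henv.cl, hq, hi, h2 i him]
    by_cases hc : lst c b q i = c q + 1
    · simp [hc, Store.write_apply, hi, hq, henv.r, h1 i him]
    · simp [hc, Store.write_apply, hi, hq, henv.r, h1 i him, henv.rs]
      congr 1
      omega
  have e2 : stepRow.exec B τ sX = Function.update (τ sX) i (c q + 1) := by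
    simp only [stepRow, Cmd.exec_seq, Cmd.exec_ite, Expr.eval_eq, Expr.eval_get, Expr.eval_var,
      Expr.eval_add, Expr.eval_lit, henv.cl, hq, hi, h2 i him]
    by_cases hc : lst c b q i = c q + 1
    · simp [hc, Store.write_apply, hi, hq, henv.cl]
    · simp [hc, Store.write_apply, hi, hq, henv.cl]
  have e3 : stepRow.exec B τ sA = Function.update (τ sA) q i := by
    simp only [stepRow, Cmd.exec_seq, Cmd.exec_ite, Expr.eval_eq, Expr.eval_get, Expr.eval_var,
      Expr.eval_add, Expr.eval_lit, henv.cl, hq, hi, h2 i him]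
    by_cases hc : lst c b q i = c q + 1
    · simp [hc, Store.write_apply, hi, hq]
    · simp [hc, Store.write_apply, hi, hq]
  rw [e1, e2, e3]
  constructor
  · intro p hp
    rw [zero_add, lev, Function.update_self, hlev, hlst]
    by_cases h4 : i = p
    · subst h4; simp
    · rw [if_neg h4, Function.update_of_ne (Ne.symm h4), h1 p hp]
  · intro p hp
    rw [zero_add, lst, Function.update_self, hlst]
    split_ifs with h4
    · subst h4; simp
    · rw [Function.update_of_ne (Ne.symm h4), h2 p hp]
  · intro t ht
    rw [zero_add]
    rcases Nat.lt_succ_iff_lt_or_eq.1 ht with ht | rfl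
    · rw [Function.update_of_ne ht.ne, hup t ht, h3 t ht]
    · simp

/-- Computes the key of the state, for an item with label `vLab` to come. -/
def keyRow : Cmd :=
  .set vKey (.lit 0) ;; .set vP (.lit 0) ;;
  .rep (.ite (.lt (.var vP) (.get 0 (.lit 2)))
    (.set vKey (.add (.var vKey) (.get aW (.add (.lit 1) (.add (.smul 2 (.get sL (.var vP)))
      (.eq (.get sX (.var vP)) (.add (.var vLab) (.lit 1)))))))) .skip ;;
    .set vP (.add (.var vP) (.lit 1)))

theorem exec_keyRow {B C m N : ℕ} {r c : ℕ → ℕ} {s q : ℕ} {b : ℕ → ℕ} {τ : Store}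
    (henv : Env B m N r c s τ) (hm : m ≤ B) (hC : 2 * C + 2 ≤ B) (hlab : τ vLab 0 = c q)
    (h : Row m r c s (τ sL) (τ sX) (τ sA) 0 q b) (hb : ∀ p < m, lev r c s b q p ≤ C) :
    keyRow.exec B τ vKey 0 = key B m r c s b q := by
  have := Cmd.exec_rep (B := B) (c := .ite (.lt (.var vP) (.get 0 (.lit 2)))
    (.set vKey (.add (.var vKey) (.get aW (.add (.lit 1) (.add (.smul 2 (.get sL (.var vP)))
      (.eq (.get sX (.var vP)) (.add (.var vLab) (.lit 1)))))))) .skip ;;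
    .set vP (.add (.var vP) (.lit 1))) (fun t υ => (∀ a, a ≠ vKey → a ≠ vP → υ a = τ a) ∧
      υ vP 0 = t ∧ υ vKey 0 = ∑ i ∈ Finset.range (min t m),
        B ^ (1 + slot (lev r c s b q i) (lst c b q i) (c q)))
    (σ := (Cmd.set vP (.lit 0)).exec B ((Cmd.set vKey (.lit 0)).exec B τ)) ?_ ?_
  · rw [min_eq_right hm] at this
    exact this.2.2
  · refine ⟨?_, by simp [Store.write_apply], by simp [Store.write_apply]⟩
    intro a h1 h2
    simp [Store.write_apply, h1, h2]
  · rintro t - υ ⟨h1, h2, h3⟩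
    have em : υ 0 2 = m := by rw [h1 0 (by decide) (by decide), henv.m]
    by_cases ht : t < m
    · have e1 : υ sL t = lev r c s b q t := by
        rw [h1 sL (by decide) (by decide), ← h.L t ht, zero_add]
      have e2 : υ sX t = lst c b q t := by
        rw [h1 sX (by decide) (by decide), ← h.X t ht, zero_add]
      have e3 : υ vLab 0 = c q := by rw [h1 vLab (by decide) (by decide), hlab]
      have hsl := slot_le (x := lst c b q t) (k := c q) (hb t ht)
      have e4 : υ aW (1 + slot (lev r c s b q t) (lst c b q t) (c q)) =
          B ^ (1 + slot (lev r c s b q t) (lst c b q t) (c q)) := by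
        rw [h1 aW (by decide) (by decide), henv.W _ (by omega)]
      rw [Cmd.exec_seq, Cmd.exec_ite, if_neg (by simpa [h2, em] using ht)]
      rw [min_eq_left ht.le] at h3
      rw [min_eq_left (show t + 1 ≤ m from ht), Finset.sum_range_succ, ← h3, ← e4]
      refine ⟨?_, by simp [Store.write_apply, h2], ?_⟩
      · intro a ha ha'
        simp [Store.write_apply, ha, ha', h1 a ha ha']
      · simp [Store.write_apply, h2, e1, e2, e3, slot]
    · rw [Cmd.exec_seq, Cmd.exec_ite, if_pos (by simpa [h2, em] using ht)]
      rw [min_eq_right (not_lt.1 ht)] at h3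
      rw [min_eq_right (show m ≤ t + 1 by omega), ← h3]
      refine ⟨?_, by simp [Store.write_apply, h2], by simp [Store.write_apply]⟩
      intro a ha ha'
      simp [Store.write_apply, ha', h1 a ha ha']

/-- Stores the state at hand at position `vDst`. -/
def storeRow : Cmd :=
  copyCmd aL (.var vDst) sL (.lit 0) ;;
  copyCmd aX (.var vDst) sX (.lit 0) ;;
  copyCmd aA (.var vDst) sA (.lit 0) ;;
  .put aPres (.var vDst) (.lit 1)

theorem exec_storeRow {B m : ℕ} {r c : ℕ → ℕ} {s q : ℕ} {b : ℕ → ℕ} {τ : Store} (hm : m ≤ B)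
    (hq : q ≤ B) (h : Row m r c s (τ sL) (τ sX) (τ sA) 0 q b) :
    Row m r c s (storeRow.exec B τ aL) (storeRow.exec B τ aX) (storeRow.exec B τ aA)
      (τ vDst 0) q b ∧
    storeRow.exec B τ aPres = Function.update (τ aPres) (τ vDst 0) 1 ∧
    ∀ a ∈ [aL, aX, aA], ∀ j, (j < τ vDst 0 ∨ τ vDst 0 + B ≤ j) →
      storeRow.exec B τ a j = τ a j := by
  rw [storeRow, Cmd.exec_seq, Cmd.exec_seq, Cmd.exec_seq]
  have h1 := exec_copyCmd (B := B) (d := aL) (s := sL) (e := .var vDst) (f := .lit 0) (σ := τ)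
    (by decide) (by decide) (by decide)
    (fun υ hυ => by simp [hυ vDst (by decide) (by decide)]) (fun _ _ => rfl)
  generalize (copyCmd aL (.var vDst) sL (.lit 0)).exec B τ = τ₁ at *
  have h2 := exec_copyCmd (B := B) (d := aX) (s := sX) (e := .var vDst) (f := .lit 0) (σ := τ₁)
    (by decide) (by decide) (by decide)
    (fun υ hυ => by simp [hυ vDst (by decide) (by decide)]) (fun _ _ => rfl)
  generalize (copyCmd aX (.var vDst) sX (.lit 0)).exec B τ₁ = τ₂ at *
  have h3 := exec_copyCmd (B := B) (d := aA) (s := sA) (e := .var vDst) (f := .lit 0) (σ := τ₂)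
    (by decide) (by decide) (by decide)
    (fun υ hυ => by simp [hυ vDst (by decide) (by decide)]) (fun _ _ => rfl)
  generalize (copyCmd aA (.var vDst) sA (.lit 0)).exec B τ₂ = τ₃ at *
  simp only [Expr.eval_lit, Expr.eval_var, zero_add] at h1 h2 h3
  have hs1 : τ₁ vDst = τ vDst := h1.1 _ (by decide) (by decide)
  have hs2 : τ₂ vDst = τ vDst := (h2.1 _ (by decide) (by decide)).trans hs1
  have hs3 : τ₃ vDst = τ vDst := (h3.1 _ (by decide) (by decide)).trans hs2
  rw [hs1] at h2
  rw [hs2] at h3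
  obtain ⟨hL, hX, hA⟩ := h
  simp only [zero_add] at hL hX hA
  simp only [Cmd.exec_put, Store.write_apply, Expr.eval_var, Expr.eval_lit, Nat.reduceEqDiff,
    reduceIte, hs3]
  refine ⟨⟨?_, ?_, ?_⟩, ?_, ?_⟩
  · intro p hp
    rw [h3.1 aL (by decide) (by decide), h2.1 aL (by decide) (by decide), h1.2.1 p (by omega),
      hL p hp]
  · intro p hp
    rw [h3.1 aX (by decide) (by decide), h2.2.1 p (by omega),
      h1.1 sX (by decide) (by decide), hX p hp]
  · intro t ht
    rw [h3.2.1 t (by omega), h2.1 sA (by decide) (by decide),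
      h1.1 sA (by decide) (by decide), hA t ht]
  · rw [h3.1 aPres (by decide) (by decide), h2.1 aPres (by decide) (by decide),
      h1.1 aPres (by decide) (by decide)]
  · intro a ha j hj
    simp only [List.mem_cons, List.not_mem_nil, or_false] at ha
    rcases ha with rfl | rfl | rfl
    · simp only [Nat.reduceEqDiff, reduceIte]
      rw [h3.1 aL (by decide) (by decide), h2.1 aL (by decide) (by decide), h1.2.2 j hj]
    · simp only [Nat.reduceEqDiff, reduceIte]
      rw [h3.1 aX (by decide) (by decide), h2.2.2 j hj, h1.1 aX (by decide) (by decide)]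
    · simp only [Nat.reduceEqDiff, reduceIte]
      rw [h3.2.2 j hj, h2.1 aA (by decide) (by decide), h1.1 aA (by decide) (by decide)]

/-- Takes the state at `vSrc`, assigns item `vQ` to machine `vI`, and stores the new state in the
next layer, unless the load of the machine exceeds `C`. -/
def moveCmd (C : ℕ) : Cmd :=
  loadRow ;; stepRow ;;
  .ite (.lt (.lit C) (.get sL (.var vI))) .skip
    (keyRow ;;
     .set vDst (.add (.var vOff) (.add (.get aW (.lit (2 * C + 3))) (.var vKey))) ;;
     storeRow)

theorem exec_moveCmd {B C m N : ℕ} {r c : ℕ → ℕ} {s q i : ℕ} {b : ℕ → ℕ} {τ : Store}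
    (henv : Env B m N r c s τ) (hm : m < B) (hC : 2 * C + 3 ≤ B) (hqB : q < B)
    (hlab : τ vLab 0 = c (q + 1)) (hq : τ vQ 0 = q) (hi : τ vI 0 = i) (him : i < m)
    (h : Row m r c s (τ aL) (τ aX) (τ aA) (τ vSrc 0) q b) (hb : Valid m C r c s q b) :
    (C < lev r c s (Function.update b q i) (q + 1) i ∧
      ∀ a ∈ [aL, aX, aA, aPres], (moveCmd C).exec B τ a = τ a) ∨
    (Valid m C r c s (q + 1) (Function.update b q i) ∧
      ∃ d, d = τ vOff 0 + (B ^ (2 * C + 3) + key B m r c s (Function.update b q i) (q + 1)) ∧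
      Row m r c s ((moveCmd C).exec B τ aL) ((moveCmd C).exec B τ aX) ((moveCmd C).exec B τ aA)
        d (q + 1) (Function.update b q i) ∧
      (moveCmd C).exec B τ aPres = Function.update (τ aPres) d 1 ∧
      ∀ a ∈ [aL, aX, aA], ∀ j, (j < d ∨ d + B ≤ j) → (moveCmd C).exec B τ a j = τ a j) := by
  rw [moveCmd, Cmd.exec_seq, Cmd.exec_seq]
  have h1 := exec_loadRow hm.le hqB.le h
  have f1 : ∀ a ∈ [0, aW, aCl, aR, vRs, vN, vLab, vQ, vI, vOff, aL, aX, aA, aPres],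
      loadRow.exec B τ a = τ a := by
    intro a ha
    refine Cmd.exec_frame _ ?_ τ
    simp only [loadRow, copyCmd, Cmd.mods, Cmd.mods_set]
    revert a
    decide
  generalize loadRow.exec B τ = τ₁ at *
  have henv₁ : Env B m N r c s τ₁ := henv.frame fun a ha => f1 a (by revert a; decide)
  have h2 := exec_stepRow henv₁ (by rw [f1 vQ (by decide), hq]) (by rw [f1 vI (by decide), hi])
    him h1
  have f2 : ∀ a ∈ [0, aW, aCl, aR, vRs, vN, vLab, vQ, vI, vOff, aL, aX, aA, aPres],
      stepRow.exec B τ₁ a = τ₁ a := by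
    intro a ha
    refine Cmd.exec_frame _ ?_ τ₁
    simp only [stepRow, Cmd.mods]
    revert a
    decide
  generalize stepRow.exec B τ₁ = τ₂ at *
  have henv₂ : Env B m N r c s τ₂ := henv₁.frame fun a ha => f2 a (by revert a; decide)
  have hsL : τ₂ sL i = lev r c s (Function.update b q i) (q + 1) i := by
    rw [← h2.L i him, zero_add]
  have hI : τ₂ vI 0 = i := by rw [f2 vI (by decide), f1 vI (by decide), hi]
  by_cases hcap : C < lev r c s (Function.update b q i) (q + 1) i
  · left
    rw [Cmd.exec_ite, if_neg (by simpa [hI, hsL] using hcap)]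
    refine ⟨hcap, fun a ha => ?_⟩
    rw [Cmd.exec_skip, f2 a (by revert a; decide), f1 a (by revert a; decide)]
  · right
    rw [Cmd.exec_ite, if_pos (by simpa [hI, hsL] using hcap), Cmd.exec_seq, Cmd.exec_seq]
    have hup : ∀ t < q, Function.update b q i t = b t := fun t ht =>
      Function.update_of_ne ht.ne _ _
    have hval : Valid m C r c s (q + 1) (Function.update b q i) := by
      refine ⟨fun t ht => ?_, fun p hp => ?_⟩
      · rcases Nat.lt_succ_iff_lt_or_eq.1 ht with ht | rfl
        · rw [hup t ht]; exact hb.1 t ht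
        · simpa using him
      · by_cases hpi : p = i
        · rw [hpi]; exact not_lt.1 hcap
        · rw [lev, Function.update_self, if_neg (Ne.symm hpi), (lev_congr hup).1]
          exact hb.2 p hp
    have h3 := exec_keyRow henv₂ hm.le (by omega : 2 * C + 2 ≤ B)
      (by rw [f2 vLab (by decide), f1 vLab (by decide), hlab]) h2 hval.2
    have f3 : ∀ a ∈ [0, aW, aCl, aR, vRs, vN, vLab, vQ, vI, vOff, aL, aX, aA, aPres, sL, sX, sA],
        keyRow.exec B τ₂ a = τ₂ a := by
      intro a ha
      refine Cmd.exec_frame _ ?_ τ₂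
      simp only [keyRow, Cmd.mods, Cmd.mods_set]
      revert a
      decide
    generalize keyRow.exec B τ₂ = τ₃ at *
    have hdst : ((Cmd.set vDst (.add (.var vOff) (.add (.get aW (.lit (2 * C + 3)))
        (.var vKey)))).exec B τ₃) vDst 0 =
        τ vOff 0 + (B ^ (2 * C + 3) + key B m r c s (Function.update b q i) (q + 1)) := by
      simp only [Cmd.exec_set, Store.write_apply, reduceIte, Function.update_self, Expr.eval_add,
        Expr.eval_var, Expr.eval_get, Expr.eval_lit, h3]
      rw [f3 vOff (by decide), f2 vOff (by decide), f1 vOff (by decide), f3 aW (by decide),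
        henv₂.W _ hC]
    have f4 : ∀ a, a ≠ vDst → ((Cmd.set vDst (.add (.var vOff) (.add (.get aW (.lit (2 * C + 3)))
        (.var vKey)))).exec B τ₃) a = τ₃ a := by
      intro a ha
      simp [Store.write_apply, ha]
    generalize (Cmd.set vDst (.add (.var vOff) (.add (.get aW (.lit (2 * C + 3)))
        (.var vKey)))).exec B τ₃ = τ₄ at *
    have h4 := exec_storeRow (B := B) (τ := τ₄) (b := Function.update b q i) (q := q + 1) (r := r)
      (c := c) (s := s) hm.le (by omega) (by
      rw [f4 sL (by decide), f4 sX (by decide), f4 sA (by decide), f3 sL (by decide),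
        f3 sX (by decide), f3 sA (by decide)]
      exact h2)
    rw [hdst] at h4
    have f5 : ∀ a ∈ [aL, aX, aA, aPres], τ₄ a = τ a := by
      intro a ha
      rw [f4 a (by revert a; decide), f3 a (by revert a; decide), f2 a (by revert a; decide),
        f1 a (by revert a; decide)]
    refine ⟨hval, _, rfl, h4.1, ?_, ?_⟩
    · rw [h4.2.1, f5 aPres (by decide)]
    · intro a ha j hj
      rw [h4.2.2 a ha j hj, f5 a (by revert a; decide)]

/-! ### The dynamic program: layers -/

/-- Tries to assign item `vQ` to machine `vI`. -/
def tryMove (C : ℕ) : Cmd :=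
  .ite (.lt (.var vI) (.get 0 (.lit 2))) (moveCmd C) .skip ;;
  .set vI (.add (.var vI) (.lit 1))

/-- Tries all machines, if there is a state at position `vX` of the current layer. -/
def scanState (C : ℕ) : Cmd :=
  .ite (.get aPres (.add (.var vOff) (.var vX)))
    (.set vSrc (.add (.var vOff) (.var vX)) ;; .set vI (.lit 0) ;; .rep (tryMove C)) .skip ;;
  .set vX (.add (.var vX) (.lit 1))

/-- Computes the layer for the items `0, …, vQ` from the one for the items `0, …, vQ - 1`. -/
def layerCmd (C : ℕ) : Cmd :=
  .ite (.lt (.var vQ) (.var vN))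
    (.set vX (.lit 0) ;; .set vLab (.get aCl (.add (.var vQ) (.lit 1))) ;;
     (scanState C).repPow (2 * C + 3) ;;
     .set vOff (.add (.var vOff) (.get aW (.lit (2 * C + 3)))) ;;
     .set vQ (.add (.var vQ) (.lit 1)))
    .skip

section Layers

variable (B C m : ℕ) (r c : ℕ → ℕ) (s : ℕ)

/-- Every entry of the layer at `o` is the state that some valid assignment of `q` items leads to,
stored at the position given by its key. -/
def Sound (τ : Store) (o q : ℕ) : Prop :=
  ∀ x < B ^ (2 * C + 3), τ aPres (o + x) ≠ 0 → ∃ b, Valid m C r c s q b ∧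
    key B m r c s b q = x ∧ Row m r c s (τ aL) (τ aX) (τ aA) (o + x) q b

/-- Every key of a valid assignment of `q` items has an entry in the layer at `o`. -/
def Complete (τ : Store) (o q : ℕ) : Prop :=
  ∀ b, Valid m C r c s q b → τ aPres (o + key B m r c s b q) ≠ 0

/-- While a layer is scanned that was complete in the memory `σ`: the successors of all states
before position `x`, and those of the state at `x` for the machines before `i`, are entered into
the next layer. The state at position `x'` is the one that the assignment `β x'` leads to. -/
structure ScanInv (σ : Store) (β : ℕ → ℕ → ℕ) (o q x i : ℕ) (τ : Store) : Prop where
  frame : ∀ a ∈ [0, aW, aCl, aR, vRs, vN, vLab, vQ, vOff], τ a = σ a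
  below : ∀ a ∈ [aL, aX, aA, aPres], ∀ j < o + B ^ (2 * C + 3), τ a j = σ a j
  sound : Sound B C m r c s τ (o + B ^ (2 * C + 3)) (q + 1)
  fresh : ∀ j ≥ o + B ^ (2 * C + 3) + B ^ (2 * C + 3), τ aPres j = 0
  done : ∀ x' < B ^ (2 * C + 3), σ aPres (o + x') ≠ 0 → ∀ i' < m, (x' < x ∨ x' = x ∧ i' < i) →
    Valid m C r c s (q + 1) (Function.update (β x') q i') →
    τ aPres (o + B ^ (2 * C + 3) + key B m r c s (Function.update (β x') q i') (q + 1)) ≠ 0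

variable {B C m r c s}

theorem ScanInv.move {N : ℕ} {σ : Store} {β : ℕ → ℕ → ℕ} {o q x i : ℕ} {τ : Store}
    (h : ScanInv B C m r c s σ β o q x i τ) (henv : Env B m N r c s σ) (hm : m < B)
    (hC : 2 * C + 3 ≤ B) (hqB : q < B) (hlab : σ vLab 0 = c (q + 1)) (hq : σ vQ 0 = q)
    (ho : σ vOff 0 = o) (hi : τ vI 0 = i) (him : i < m) (hsrc : τ vSrc 0 = o + x)
    (hx : x < B ^ (2 * C + 3)) (hb : Valid m C r c s q (β x))
    (hkx : key B m r c s (β x) q = x)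
    (hrow : Row m r c s (σ aL) (σ aX) (σ aA) (o + x) q (β x)) :
    ScanInv B C m r c s σ β o q x (i + 1) ((moveCmd C).exec B τ) := by
  obtain ⟨h1, h2, h3, h4, h5⟩ := h
  have hdvd : B ∣ B ^ (2 * C + 3) := dvd_pow_self _ (by omega)
  -- a key is a multiple of `B`, so there is room for the whole row
  have hroom : ∀ y z : ℕ, B ∣ y → B ∣ z → y < z → y + B ≤ z := by
    rintro _ _ ⟨u, rfl⟩ ⟨v, rfl⟩ huv
    have : u < v := lt_of_mul_lt_mul_left huv (Nat.zero_le _)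
    calc B * u + B = B * (u + 1) := by ring
    _ ≤ B * v := Nat.mul_le_mul_left _ this
  have hrow' : Row m r c s (τ aL) (τ aX) (τ aA) (τ vSrc 0) q (β x) := by
    have hxB := hroom x _ (hkx ▸ dvd_key B m r c s (β x) q) hdvd hx
    rw [hsrc]
    refine ⟨fun p hp => ?_, fun p hp => ?_, fun t ht => ?_⟩
    · rw [h2 aL (by decide) _ (by omega), hrow.L p hp]
    · rw [h2 aX (by decide) _ (by omega), hrow.X p hp]
    · rw [h2 aA (by decide) _ (by omega), hrow.A t ht]
  have hf : ∀ a ∈ [0, aW, aCl, aR, vRs, vN, vLab, vQ, vOff],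
      (moveCmd C).exec B τ a = σ a := by
    intro a ha
    rw [← h1 a ha]
    refine Cmd.exec_frame _ ?_ τ
    simp only [moveCmd, loadRow, stepRow, keyRow, storeRow, copyCmd, Cmd.mods, Cmd.mods_set]
    revert a
    decide
  have hcases := exec_moveCmd (τ := τ) (B := B) (i := i) (b := β x) (C := C)
    (henv.frame (τ' := τ) fun a ha => h1 a (by revert a; decide)) hm hC hqB
    (by rw [h1 vLab (by decide), hlab]) (by rw [h1 vQ (by decide), hq]) hi him hrow' hb
  rw [h1 vOff (by decide), ho] at hcases
  rcases hcases with ⟨k1, k2⟩ | ⟨k1, d, k2, k3, k4, k5⟩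
  · refine ⟨hf, fun a ha j hj => by rw [k2 a ha, h2 a ha j hj], ?_, ?_, ?_⟩
    · unfold Sound
      rw [k2 aL (by decide), k2 aX (by decide), k2 aA (by decide), k2 aPres (by decide)]
      exact h3
    · rw [k2 aPres (by decide)]
      exact h4
    · intro x' hx' hp i' hi' hlt hv
      rw [k2 aPres (by decide)]
      refine h5 x' hx' hp i' hi' ?_ hv
      rcases hlt with hlt | ⟨rfl, hlt⟩
      · exact Or.inl hlt
      · right
        refine ⟨rfl, lt_of_le_of_ne (Nat.lt_succ_iff.1 hlt) ?_⟩
        rintro rfl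
        have := hv.2 i' him
        omega
  · have hkey := key_lt (B := B) hm k1.2
    have hkd := dvd_key B m r c s (Function.update (β x) q i) (q + 1)
    generalize hk : key B m r c s (Function.update (β x) q i) (q + 1) = k at *
    refine ⟨hf, ?_, ?_, ?_, ?_⟩
    · intro a ha j hj
      simp only [List.mem_cons, List.not_mem_nil, or_false] at ha
      rcases ha with rfl | rfl | rfl | rfl
      · rw [k5 aL (by decide) j (by omega), h2 aL (by decide) j hj]
      · rw [k5 aX (by decide) j (by omega), h2 aX (by decide) j hj]
      · rw [k5 aA (by decide) j (by omega), h2 aA (by decide) j hj]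
      · rw [k4, Function.update_of_ne (by omega), h2 aPres (by decide) j hj]
    · intro x' hx' hp
      rw [k4] at hp
      by_cases hxk : x' = k
      · subst hxk
        refine ⟨_, k1, hk, ?_⟩
        rw [show o + B ^ (2 * C + 3) + x' = d by omega]
        exact k3
      · rw [Function.update_of_ne (by omega)] at hp
        obtain ⟨b, hb1, hb2, hb3⟩ := h3 x' hx' hp
        have hxd : B ∣ x' := hb2 ▸ dvd_key B m r c s b (q + 1)
        have hdisj : ∀ p < B, o + B ^ (2 * C + 3) + x' + p < d ∨
            d + B ≤ o + B ^ (2 * C + 3) + x' + p := by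
          intro p hp
          rcases Nat.lt_or_gt_of_ne hxk with hlt | hlt
          · have := hroom x' k hxd hkd hlt; omega
          · have := hroom k x' hkd hxd hlt; omega
        refine ⟨b, hb1, hb2, ?_, ?_, ?_⟩
        · intro p hp
          rw [k5 aL (by decide) _ (hdisj p (by omega)), hb3.L p hp]
        · intro p hp
          rw [k5 aX (by decide) _ (hdisj p (by omega)), hb3.X p hp]
        · intro t ht
          rw [k5 aA (by decide) _ (hdisj t (by omega)), hb3.A t ht]
    · intro j hj
      rw [k4, Function.update_of_ne (by omega), h4 j hj]
    · intro x' hx' hp i' hi' hlt hv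
      rw [k4]
      by_cases hd : o + B ^ (2 * C + 3) + key B m r c s (Function.update (β x') q i') (q + 1) = d
      · rw [hd, Function.update_self]
        exact one_ne_zero
      · rw [Function.update_of_ne hd]
        refine h5 x' hx' hp i' hi' ?_ hv
        rcases hlt with hlt | ⟨rfl, hlt⟩
        · exact Or.inl hlt
        · right
          refine ⟨rfl, lt_of_le_of_ne (Nat.lt_succ_iff.1 hlt) ?_⟩
          rintro rfl
          omega

theorem ScanInv.scan {N : ℕ} {σ : Store} {β : ℕ → ℕ → ℕ} {o q x : ℕ} {τ : Store}
    (h : ScanInv B C m r c s σ β o q x 0 τ) (henv : Env B m N r c s σ) (hm : m < B)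
    (hC : 2 * C + 3 ≤ B) (hqB : q < B) (hlab : σ vLab 0 = c (q + 1)) (hq : σ vQ 0 = q)
    (ho : σ vOff 0 = o) (hX : τ vX 0 = x) (hx : x < B ^ (2 * C + 3))
    (hβ : σ aPres (o + x) ≠ 0 → Valid m C r c s q (β x) ∧ key B m r c s (β x) q = x ∧
      Row m r c s (σ aL) (σ aX) (σ aA) (o + x) q (β x)) :
    ScanInv B C m r c s σ β o q (x + 1) 0 ((scanState C).exec B τ) ∧
      (scanState C).exec B τ vX 0 = x + 1 := by
  -- changing variables that the invariant does not mention
  have hcongr : ∀ {x' i' : ℕ} {υ υ' : Store}, ScanInv B C m r c s σ β o q x' i' υ →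
      (∀ a ∈ [0, aW, aCl, aR, vRs, vN, vLab, vQ, vOff, aL, aX, aA, aPres], υ' a = υ a) →
      ScanInv B C m r c s σ β o q x' i' υ' := by
    rintro x' i' υ υ' ⟨h1, h2, h3, h4, h5⟩ hf
    refine ⟨fun a ha => by rw [hf a (by revert a; decide), h1 a ha],
      fun a ha j hj => by rw [hf a (by revert a; decide), h2 a ha j hj], ?_, ?_, ?_⟩
    · unfold Sound
      rw [hf aL (by decide), hf aX (by decide), hf aA (by decide), hf aPres (by decide)]
      exact h3
    · rw [hf aPres (by decide)]; exact h4
    · rw [hf aPres (by decide)]; exact h5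
  have hpres : τ aPres (o + x) = σ aPres (o + x) := h.below aPres (by decide) _ (by omega)
  have hoff : τ vOff 0 = o := by rw [h.frame vOff (by decide), ho]
  rw [scanState, Cmd.exec_seq, Cmd.exec_ite]
  by_cases hp : σ aPres (o + x) = 0
  · rw [if_pos (by simpa [hoff, hX, hpres] using hp)]
    refine ⟨hcongr ?_ (υ := τ) (by simp [Store.write_apply]), by simp [Store.write_apply, hX]⟩
    obtain ⟨h1, h2, h3, h4, h5⟩ := h
    refine ⟨h1, h2, h3, h4, fun x' hx' hp' i' hi' hlt hv => h5 x' hx' hp' i' hi' ?_ hv⟩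
    rcases hlt with hlt | ⟨-, hlt⟩
    · rcases Nat.lt_succ_iff_lt_or_eq.1 hlt with hlt | rfl
      · exact Or.inl hlt
      · exact absurd hp hp'
    · omega
  · rw [if_neg (by simpa [hoff, hX, hpres] using hp), Cmd.exec_seq, Cmd.exec_seq]
    obtain ⟨hb, hkx, hrow⟩ := hβ hp
    obtain ⟨τ₁, hτ₁⟩ : ∃ τ₁, τ₁ = (Cmd.set vI (.lit 0)).exec B
      ((Cmd.set vSrc (.add (.var vOff) (.var vX))).exec B τ) := ⟨_, rfl⟩
    rw [← hτ₁]
    have hloop := Cmd.exec_rep (B := B) (c := tryMove C) (σ := τ₁) (fun t υ =>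
      ScanInv B C m r c s σ β o q x (min t m) υ ∧ υ vI 0 = t ∧ υ vSrc 0 = o + x ∧ υ vX 0 = x)
      ?_ ?_
    · rw [min_eq_right hm.le] at hloop
      obtain ⟨k1, k2, k3, k4⟩ := hloop
      generalize (Cmd.rep (tryMove C)).exec B τ₁ = τ₂ at *
      refine ⟨hcongr ?_ (υ := τ₂) (by simp [Store.write_apply]), by simp [Store.write_apply, k4]⟩
      obtain ⟨h1, h2, h3, h4, h5⟩ := k1
      refine ⟨h1, h2, h3, h4, fun x' hx' hp' i' hi' hlt hv => h5 x' hx' hp' i' hi' ?_ hv⟩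
      omega
    · rw [Nat.zero_min]
      refine ⟨hcongr h (by simp [hτ₁, Store.write_apply]), ?_, ?_, ?_⟩ <;>
        simp [hτ₁, Store.write_apply, hoff, hX]
    · rintro t - υ ⟨k1, k2, k3, k4⟩
      have em : υ 0 2 = m := by rw [k1.frame 0 (by decide), henv.m]
      rw [tryMove, Cmd.exec_seq, Cmd.exec_ite]
      by_cases ht : t < m
      · rw [if_neg (by simpa [k2, em] using ht)]
        rw [min_eq_left ht.le] at k1
        rw [min_eq_left (show t + 1 ≤ m from ht)]
        have k5 := k1.move henv hm hC hqB hlab hq ho k2 ht k3 hx hb hkx hrow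
        have hf : ∀ a ∈ [vI, vSrc, vX], (moveCmd C).exec B υ a = υ a := by
          intro a ha
          refine Cmd.exec_frame _ ?_ υ
          simp only [moveCmd, loadRow, stepRow, keyRow, storeRow, copyCmd, Cmd.mods, Cmd.mods_set]
          revert a
          decide
        have f1 := hf vI (by decide)
        have f2 := hf vSrc (by decide)
        have f3 := hf vX (by decide)
        generalize (moveCmd C).exec B υ = υ' at *
        refine ⟨hcongr k5 (by simp [Store.write_apply]), ?_, ?_, ?_⟩ <;>
          simp [Store.write_apply, f1, f2, f3, k2, k3, k4]
      · rw [if_pos (by simpa [k2, em] using ht)]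
        rw [min_eq_right (not_lt.1 ht)] at k1
        rw [min_eq_right (show m ≤ t + 1 by omega)]
        refine ⟨hcongr k1 (by simp [Store.write_apply]), ?_, ?_, ?_⟩ <;>
          simp [Store.write_apply, k2, k3, k4]

/-- If all valid assignments of `q` items are represented, then so are those of `q + 1` items: of an
assignment, only the key matters for what can be added, by `exists_exchange`. -/
theorem exec_layerCmd {N : ℕ} {o q : ℕ} {σ : Store} (henv : Env B m N r c s σ) (hm : m < B)
    (hC : 2 * C + 3 ≤ B) (hN : N < B) (hc : MonotoneOn c (Set.Iio (N + 1))) (hqN : q < N)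
    (hq : σ vQ 0 = q) (ho : σ vOff 0 = o) (hs : Sound B C m r c s σ o q)
    (hcp : Complete B C m r c s σ o q) (hfr : ∀ j ≥ o + B ^ (2 * C + 3), σ aPres j = 0) :
    (layerCmd C).exec B σ vQ 0 = q + 1 ∧
    (layerCmd C).exec B σ vOff 0 = o + B ^ (2 * C + 3) ∧
    Sound B C m r c s ((layerCmd C).exec B σ) (o + B ^ (2 * C + 3)) (q + 1) ∧
    Complete B C m r c s ((layerCmd C).exec B σ) (o + B ^ (2 * C + 3)) (q + 1) ∧
    ∀ j ≥ o + B ^ (2 * C + 3) + B ^ (2 * C + 3), (layerCmd C).exec B σ aPres j = 0 := by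
  rw [layerCmd, Cmd.exec_ite, if_neg (by simpa [hq, henv.N] using hqN)]
  simp only [Cmd.exec_seq]
  obtain ⟨σ₁, hσ₁⟩ : ∃ σ₁, σ₁ = (Cmd.set vLab (.get aCl (.add (.var vQ) (.lit 1)))).exec B
    ((Cmd.set vX (.lit 0)).exec B σ) := ⟨_, rfl⟩
  rw [← hσ₁]
  have hf₁ : ∀ a ∈ [0, aW, aCl, aR, vRs, vN, vQ, vOff, aL, aX, aA, aPres], σ₁ a = σ a := by
    simp [hσ₁, Store.write_apply]
  have henv₁ : Env B m N r c s σ₁ := henv.frame fun a ha => hf₁ a (by revert a; decide)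
  have hlab : σ₁ vLab 0 = c (q + 1) := by simp [hσ₁, Store.write_apply, hq, henv.cl]
  have hX₁ : σ₁ vX 0 = 0 := by simp [hσ₁, Store.write_apply]
  have hs₁ : Sound B C m r c s σ₁ o q := by
    unfold Sound
    rw [hf₁ aL (by decide), hf₁ aX (by decide), hf₁ aA (by decide), hf₁ aPres (by decide)]
    exact hs
  have hcp₁ : Complete B C m r c s σ₁ o q := by
    unfold Complete
    rw [hf₁ aPres (by decide)]
    exact hcp
  have hfr₁ : ∀ j ≥ o + B ^ (2 * C + 3), σ₁ aPres j = 0 := by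
    rw [hf₁ aPres (by decide)]
    exact hfr
  have hq₁ : σ₁ vQ 0 = q := by rw [hf₁ vQ (by decide), hq]
  have ho₁ : σ₁ vOff 0 = o := by rw [hf₁ vOff (by decide), ho]
  choose! β hβ using hs₁
  have hloop := Cmd.exec_repPow (B := B) (d := 2 * C + 3) (c := scanState C) (σ := σ₁)
    (fun x τ => ScanInv B C m r c s σ₁ β o q x 0 τ ∧ τ vX 0 = x) ?_ ?_
  · obtain ⟨⟨k1, k2, k3, k4, k5⟩, -⟩ := hloop
    generalize ((scanState C).repPow (2 * C + 3)).exec B σ₁ = τ at *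
    have hW : τ aW (2 * C + 3) = B ^ (2 * C + 3) := by rw [k1 aW (by decide), henv₁.W _ hC]
    refine ⟨?_, ?_, ?_, ?_, ?_⟩
    · simp [Store.write_apply, k1 vQ (by decide), hq₁]
    · simp [Store.write_apply, k1 vOff (by decide), ho₁, hW]
    · unfold Sound at k3 ⊢
      simpa [Store.write_apply] using k3
    · intro b hb
      have hbq : Valid m C r c s q b :=
        ⟨fun t ht => hb.1 t (by omega), fun i hi => (lev_mono (Nat.le_succ q)).trans (hb.2 i hi)⟩
      have hx := key_lt (B := B) hm hbq.2
      have hp := hcp₁ b hbq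
      obtain ⟨g1, g2, -⟩ := hβ _ hx hp
      obtain ⟨i, hi, e1, e2⟩ := exists_exchange hm hc hqN (hb.1 q (by omega)) g2.symm
      have hv : Valid m C r c s (q + 1) (Function.update (β (key B m r c s b q)) q i) := by
        have hup : ∀ t < q, Function.update (β (key B m r c s b q)) q i t =
            β (key B m r c s b q) t := fun t ht => Function.update_of_ne ht.ne _ _
        refine ⟨fun t ht => ?_, fun p hp => ?_⟩
        · rcases Nat.lt_succ_iff_lt_or_eq.1 ht with ht | rfl
          · rw [hup t ht]; exact g1.1 t ht
          · simpa using hi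
        · by_cases hpi : p = i
          · subst hpi
            rw [e2]
            exact hb.2 _ (hb.1 q (by omega))
          · rw [lev, Function.update_self, if_neg (Ne.symm hpi), (lev_congr hup).1]
            exact g1.2 p hp
      have := k5 _ hx hp i hi (Or.inl hx) hv
      rw [e1] at this
      simpa [Store.write_apply] using this
    · simpa [Store.write_apply] using k4
  · refine ⟨⟨fun _ _ => rfl, fun _ _ _ _ => rfl, ?_, fun j hj => hfr₁ j (by omega), ?_⟩, hX₁⟩
    · intro x _ hp
      exact absurd (hfr₁ _ (by omega)) hp
    · intro x' _ _ i' _ hlt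
      omega
  · rintro x hx τ ⟨k1, k2⟩
    exact k1.scan henv₁ hm hC (by omega) hlab hq₁ ho₁ k2 hx (hβ x hx)

end Layers

/-- Enters the empty assignment into the first layer. -/
def initCmd : Cmd :=
  .set vQ (.lit 0) ;; .set vP (.lit 0) ;;
  .rep (.put sL (.var vP) (.lit 0) ;; .put sX (.var vP) (.lit 0) ;;
    .set vP (.add (.var vP) (.lit 1))) ;;
  .set vLab (.get aCl (.lit 0)) ;; keyRow ;; .set vDst (.add (.var vOff) (.var vKey)) ;; storeRow

theorem exec_initCmd {B C m N : ℕ} {r c : ℕ → ℕ} {s o : ℕ} {σ : Store} (henv : Env B m N r c s σ)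
    (hm : m < B) (hC : 2 * C + 3 ≤ B) (ho : σ vOff 0 = o) (hfr : ∀ j ≥ o, σ aPres j = 0) :
    initCmd.exec B σ vQ 0 = 0 ∧ initCmd.exec B σ vOff 0 = o ∧
    Sound B C m r c s (initCmd.exec B σ) o 0 ∧ Complete B C m r c s (initCmd.exec B σ) o 0 ∧
    ∀ j ≥ o + B ^ (2 * C + 3), initCmd.exec B σ aPres j = 0 := by
  rw [initCmd]
  simp only [Cmd.exec_seq]
  obtain ⟨σ₁, hσ₁⟩ : ∃ σ₁, σ₁ = (Cmd.set vP (.lit 0)).exec B ((Cmd.set vQ (.lit 0)).exec B σ) :=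
    ⟨_, rfl⟩
  rw [← hσ₁]
  have hf₁ : ∀ a ∈ [0, aW, aCl, aR, vRs, vN, vOff, aPres], σ₁ a = σ a := by
    simp [hσ₁, Store.write_apply]
  have hq₁ : σ₁ vQ 0 = 0 := by simp [hσ₁, Store.write_apply]
  have hP₁ : σ₁ vP 0 = 0 := by simp [hσ₁, Store.write_apply]
  have hz := Cmd.exec_rep (B := B) (σ := σ₁) (c := .put sL (.var vP) (.lit 0) ;;
    .put sX (.var vP) (.lit 0) ;; .set vP (.add (.var vP) (.lit 1)))
    (fun t τ => τ vP 0 = t ∧ (∀ p < t, τ sL p = 0 ∧ τ sX p = 0) ∧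
      ∀ a ∈ [0, aW, aCl, aR, vRs, vN, vOff, aPres, vQ], τ a = σ₁ a)
    ⟨hP₁, by simp, fun _ _ => rfl⟩ ?_
  · obtain ⟨-, hz, hf₂⟩ := hz
    generalize (Cmd.rep _).exec B σ₁ = σ₂ at *
    obtain ⟨σ₃, hσ₃⟩ : ∃ σ₃, σ₃ = (Cmd.set vLab (.get aCl (.lit 0))).exec B σ₂ := ⟨_, rfl⟩
    rw [← hσ₃]
    have hf₃ : ∀ a ∈ [0, aW, aCl, aR, vRs, vN, vOff, aPres, vQ, sL, sX], σ₃ a = σ₂ a := by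
      simp [hσ₃, Store.write_apply]
    have henv₃ : Env B m N r c s σ₃ := henv.frame fun a ha => by
      rw [hf₃ a (by revert a; decide), hf₂ a (by revert a; decide), hf₁ a (by revert a; decide)]
    have hlab₃ : σ₃ vLab 0 = c 0 := by
      simp only [hσ₃, Cmd.exec_set, Store.write_apply, reduceIte, Function.update_self,
        Expr.eval_get, Expr.eval_lit]
      rw [hf₂ aCl (by decide), hf₁ aCl (by decide), henv.cl]
    have hrow₃ : ∀ b, Row m r c s (σ₃ sL) (σ₃ sX) (σ₃ sA) 0 0 b := by
      intro b
      rw [hf₃ sL (by decide), hf₃ sX (by decide)]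
      refine ⟨fun p hp => ?_, fun p hp => ?_, by simp⟩
      · rw [zero_add, (hz p (by omega)).1, lev]
      · rw [zero_add, (hz p (by omega)).2, lst]
    have hkey : ∀ b, keyRow.exec B σ₃ vKey 0 = key B m r c s b 0 := fun b =>
      exec_keyRow henv₃ hm.le (show 2 * C + 2 ≤ B by omega) hlab₃ (hrow₃ b)
        fun p _ => by simp [lev]
    have hf₄ : ∀ a ∈ [vOff, aPres, vQ, sL, sX, sA], keyRow.exec B σ₃ a = σ₃ a := by
      intro a ha
      refine Cmd.exec_frame _ ?_ σ₃
      simp only [keyRow, Cmd.mods, Cmd.mods_set]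
      revert a
      decide
    generalize keyRow.exec B σ₃ = σ₄ at *
    obtain ⟨σ₅, hσ₅⟩ : ∃ σ₅, σ₅ = (Cmd.set vDst (.add (.var vOff) (.var vKey))).exec B σ₄ :=
      ⟨_, rfl⟩
    rw [← hσ₅]
    have hf₅ : ∀ a ∈ [vOff, aPres, vQ, sL, sX, sA], σ₅ a = σ₄ a := by
      simp [hσ₅, Store.write_apply]
    have hoff : σ₄ vOff 0 = o := by
      rw [hf₄ vOff (by decide), hf₃ vOff (by decide), hf₂ vOff (by decide),
        hf₁ vOff (by decide), ho]
    have hdst : ∀ b, σ₅ vDst 0 = o + key B m r c s b 0 := by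
      intro b
      simp [hσ₅, Store.write_apply, hkey b, hoff]
    have h6 := fun b => exec_storeRow (B := B) (τ := σ₅) (b := b) (q := 0) (r := r) (c := c)
      (s := s) hm.le (by omega) (by
        rw [hf₅ sL (by decide), hf₅ sX (by decide), hf₅ sA (by decide), hf₄ sL (by decide),
          hf₄ sX (by decide), hf₄ sA (by decide)]
        exact hrow₃ b)
    have hf₆ : ∀ a ∈ [vOff, vQ], storeRow.exec B σ₅ a = σ₅ a := by
      intro a ha
      refine Cmd.exec_frame _ ?_ σ₅
      simp only [storeRow, copyCmd, Cmd.mods, Cmd.mods_set]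
      revert a
      decide
    have hpres : σ₅ aPres = σ aPres := by
      rw [hf₅ aPres (by decide), hf₄ aPres (by decide), hf₃ aPres (by decide),
        hf₂ aPres (by decide), hf₁ aPres (by decide)]
    rw [hpres] at h6
    generalize storeRow.exec B σ₅ = τ at *
    have hval : ∀ b, Valid m C r c s 0 b := fun b => ⟨by simp, by simp [lev]⟩
    refine ⟨?_, ?_, ?_, ?_, ?_⟩
    · rw [hf₆ vQ (by decide), hf₅ vQ (by decide), hf₄ vQ (by decide), hf₃ vQ (by decide),
        hf₂ vQ (by decide), hq₁]
    · rw [hf₆ vOff (by decide), hf₅ vOff (by decide), hoff]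
    · intro x _ hp
      obtain ⟨k1, k2, -⟩ := h6 0
      rw [hdst 0] at k1 k2
      rw [k2] at hp
      have hx : o + x = o + key B m r c s 0 0 := by
        by_contra hne
        rw [Function.update_of_ne hne] at hp
        exact hp (hfr _ (by omega))
      exact ⟨0, hval 0, by omega, hx ▸ k1⟩
    · intro b _
      rw [(h6 b).2.1, hdst b, Function.update_self]
      exact one_ne_zero
    · intro j hj
      have := key_lt (B := B) hm (hval 0).2
      rw [(h6 0).2.1, hdst 0, Function.update_of_ne (by omega)]
      exact hfr j (by omega)
  · rintro t - τ ⟨h1, h2, h3⟩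
    refine ⟨by simp [Store.write_apply, h1], ?_, ?_⟩
    · intro p hp
      rcases Nat.lt_succ_iff_lt_or_eq.1 hp with hp | rfl
      · simpa [Store.write_apply, h1, Function.update_of_ne hp.ne] using h2 p hp
      · simp [Store.write_apply, h1]
    · simpa [Store.write_apply] using h3

/-- Reads off an assignment, if there is a state at position `vX` of the current layer. -/
def pickState : Cmd :=
  .ite (.get aPres (.add (.var vOff) (.var vX)))
    (.set vSrc (.add (.var vOff) (.var vX)) ;; copyCmd aAsg (.lit 0) aA (.var vSrc) ;;
      .set vDone (.lit 1)) .skip ;;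
  .set vX (.add (.var vX) (.lit 1))

theorem exec_pickState {B C m : ℕ} {r c : ℕ → ℕ} {s o q : ℕ} {σ : Store} (hq : q ≤ B)
    (hX : σ vX 0 = 0) (hdone : σ vDone 0 = 0) (ho : σ vOff 0 = o)
    (hs : Sound B C m r c s σ o q) :
    ((pickState.repPow (2 * C + 3)).exec B σ vDone 0 = 0 ∧
      ∀ x < B ^ (2 * C + 3), σ aPres (o + x) = 0) ∨
    ((pickState.repPow (2 * C + 3)).exec B σ vDone 0 ≠ 0 ∧
      ∃ b, Valid m C r c s q b ∧
        ∀ t < q, (pickState.repPow (2 * C + 3)).exec B σ aAsg t = b t) := by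
  refine (Cmd.exec_repPow (B := B) (d := 2 * C + 3) (c := pickState) (σ := σ)
    (fun x τ => (τ vX 0 = x ∧ ∀ a ∈ [vOff, aPres, aL, aX, aA], τ a = σ a) ∧
      ((τ vDone 0 = 0 ∧ ∀ x' < x, σ aPres (o + x') = 0) ∨
      (τ vDone 0 ≠ 0 ∧ ∃ b, Valid m C r c s q b ∧ ∀ t < q, τ aAsg t = b t))) ?_ ?_).2
  · exact ⟨⟨hX, fun _ _ => rfl⟩, Or.inl ⟨hdone, by simp⟩⟩
  · rintro x hx τ ⟨⟨h1, h2⟩, h3⟩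
    rw [pickState, Cmd.exec_seq, Cmd.exec_ite]
    have hoff : τ vOff 0 = o := by rw [h2 vOff (by decide), ho]
    by_cases hp : σ aPres (o + x) = 0
    · rw [if_pos (by simpa [hoff, h1, h2 aPres (by decide)] using hp)]
      refine ⟨⟨by simp [Store.write_apply, h1], by simpa [Store.write_apply] using h2⟩, ?_⟩
      rcases h3 with ⟨h3, h4⟩ | h3
      · left
        refine ⟨by simpa [Store.write_apply] using h3, fun x' hx' => ?_⟩
        rcases Nat.lt_succ_iff_lt_or_eq.1 hx' with hx' | rfl
        · exact h4 x' hx'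
        · exact hp
      · right
        simpa [Store.write_apply] using h3
    · rw [if_neg (by simpa [hoff, h1, h2 aPres (by decide)] using hp), Cmd.exec_seq, Cmd.exec_seq]
      obtain ⟨b, hb, -, hrow⟩ := hs x hx hp
      obtain ⟨τ₁, hτ₁⟩ : ∃ τ₁, τ₁ = (Cmd.set vSrc (.add (.var vOff) (.var vX))).exec B τ :=
        ⟨_, rfl⟩
      rw [← hτ₁]
      have hf₁ : ∀ a ∈ [vOff, aPres, aL, aX, aA, vX], τ₁ a = τ a := by
        simp [hτ₁, Store.write_apply]
      have hsrc : τ₁ vSrc 0 = o + x := by simp [hτ₁, Store.write_apply, hoff, h1]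
      obtain ⟨k1, k2, -⟩ := exec_copyCmd (B := B) (d := aAsg) (s := aA) (e := .lit 0)
        (f := .var vSrc) (σ := τ₁) (by decide) (by decide) (by decide) (fun _ _ => rfl)
        fun υ hυ => by simp [hυ vSrc (by decide) (by decide)]
      generalize (copyCmd aAsg (.lit 0) aA (.var vSrc)).exec B τ₁ = τ₂ at *
      refine ⟨⟨?_, ?_⟩, Or.inr ⟨?_, b, hb, ?_⟩⟩
      · simp [Store.write_apply, k1 vX (by decide) (by decide), hf₁ vX (by decide), h1]
      · intro a ha
        rw [← h2 a ha, ← hf₁ a (by revert a; decide),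
          ← k1 a (by revert a; decide) (by revert a; decide)]
        revert a
        simp [Store.write_apply]
      · simp [Store.write_apply]
      · intro t ht
        have := k2 t (by omega)
        simp only [Expr.eval_lit, Expr.eval_var, zero_add, hsrc] at this
        simp only [Cmd.exec_set, Store.write_apply, Nat.reduceEqDiff, reduceIte, this]
        rw [hf₁ aA (by decide), h2 aA (by decide), hrow.A t ht]

/-- Looks for an assignment of the items such that all rounded loads are at most `C`. -/
def solveCmd (C : ℕ) : Cmd :=
  initCmd ;; .rep (layerCmd C) ;; .set vX (.lit 0) ;; pickState.repPow (2 * C + 3) ;;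
  .set vOff (.add (.var vOff) (.get aW (.lit (2 * C + 3))))

/-- The dynamic program decides whether there is a valid assignment of the items, and finds one. It
uses a fresh part of the memory, so that it can be run again. -/
theorem exec_solveCmd {B C m N : ℕ} {r c : ℕ → ℕ} {s : ℕ} {σ : Store} (henv : Env B m N r c s σ)
    (hm : m < B) (hC : 2 * C + 3 ≤ B) (hN : N < B) (hc : MonotoneOn c (Set.Iio (N + 1)))
    (hdone : σ vDone 0 = 0) (hfr : ∀ j ≥ σ vOff 0, σ aPres j = 0) :
    (∀ j ≥ (solveCmd C).exec B σ vOff 0, (solveCmd C).exec B σ aPres j = 0) ∧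
    (((solveCmd C).exec B σ vDone 0 = 0 ∧ ∀ b, ¬ Valid m C r c s N b) ∨
      ((solveCmd C).exec B σ vDone 0 ≠ 0 ∧ ∃ b, Valid m C r c s N b ∧
        ∀ t < N, (solveCmd C).exec B σ aAsg t = b t)) := by
  rw [solveCmd]
  simp only [Cmd.exec_seq]
  have hi := exec_initCmd henv hm hC rfl hfr
  have hf₁ : ∀ a ∈ [0, aW, aCl, aR, vRs, vN, vDone], initCmd.exec B σ a = σ a := by
    intro a ha
    refine Cmd.exec_frame _ ?_ σ
    simp only [initCmd, keyRow, storeRow, copyCmd, Cmd.mods, Cmd.mods_set]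
    revert a
    decide
  generalize initCmd.exec B σ = σ₁ at *
  have hfl : ∀ a ∈ [0, aW, aCl, aR, vRs, vN, vDone], ∀ τ, (layerCmd C).exec B τ a = τ a := by
    intro a ha τ
    refine Cmd.exec_frame _ ?_ τ
    simp only [layerCmd, scanState, tryMove, moveCmd, loadRow, stepRow, keyRow, storeRow, copyCmd,
      Cmd.mods, Cmd.mods_set, Cmd.mods_repPow]
    revert a
    decide
  have hl := Cmd.exec_rep (B := B) (c := layerCmd C) (σ := σ₁) (fun t τ =>
    (∀ a ∈ [0, aW, aCl, aR, vRs, vN, vDone], τ a = σ₁ a) ∧ τ vQ 0 = min t N ∧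
    ∃ o, τ vOff 0 = o ∧ Sound B C m r c s τ o (min t N) ∧ Complete B C m r c s τ o (min t N) ∧
      ∀ j ≥ o + B ^ (2 * C + 3), τ aPres j = 0) ?_ ?_
  · rw [min_eq_right hN.le] at hl
    obtain ⟨hf₂, -, o, ho, hs, hcp, hfr₂⟩ := hl
    generalize (Cmd.rep (layerCmd C)).exec B σ₁ = σ₂ at *
    obtain ⟨σ₃, hσ₃⟩ : ∃ σ₃, σ₃ = (Cmd.set vX (.lit 0)).exec B σ₂ := ⟨_, rfl⟩
    rw [← hσ₃]
    have hf₃ : ∀ a, a ≠ vX → σ₃ a = σ₂ a := by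
      intro a ha
      simp [hσ₃, Store.write_apply, ha]
    have hp := exec_pickState (B := B) (C := C) (q := N) (σ := σ₃) (o := o) (m := m) (r := r)
      (c := c) (s := s) hN.le (by simp [hσ₃, Store.write_apply])
      (by rw [hf₃ vDone (by decide), hf₂ vDone (by decide), hf₁ vDone (by decide), hdone])
      (by rw [hf₃ vOff (by decide), ho]) (by
        unfold Sound
        rw [hf₃ aL (by decide), hf₃ aX (by decide), hf₃ aA (by decide), hf₃ aPres (by decide)]
        exact hs)
    have hf₄ : ∀ a ∈ [aW, vOff, aPres], (pickState.repPow (2 * C + 3)).exec B σ₃ a = σ₃ a := by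
      intro a ha
      refine Cmd.exec_frame _ ?_ σ₃
      simp only [pickState, copyCmd, Cmd.mods, Cmd.mods_set, Cmd.mods_repPow]
      revert a
      decide
    generalize (pickState.repPow (2 * C + 3)).exec B σ₃ = σ₄ at *
    have hW : σ₄ aW (2 * C + 3) = B ^ (2 * C + 3) := by
      rw [hf₄ aW (by decide), hf₃ aW (by decide), hf₂ aW (by decide), hf₁ aW (by decide),
        henv.W _ hC]
    have hO : σ₄ vOff 0 = o := by rw [hf₄ vOff (by decide), hf₃ vOff (by decide), ho]
    simp only [Cmd.exec_set, Store.write_apply, Nat.reduceEqDiff, reduceIte, Expr.eval_add,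
      Expr.eval_var, Expr.eval_get, Expr.eval_lit, hW, hO, Function.update_self]
    refine ⟨?_, ?_⟩
    · rw [hf₄ aPres (by decide), hf₃ aPres (by decide)]
      exact hfr₂
    · rcases hp with ⟨h1, h2⟩ | h1
      · left
        refine ⟨h1, fun b hb => hcp b hb ?_⟩
        rw [← hf₃ aPres (by decide)]
        exact h2 _ (key_lt hm hb.2)
      · exact Or.inr h1
  · rw [Nat.zero_min]
    exact ⟨fun _ _ => rfl, hi.1, _, hi.2⟩
  · rintro t - τ ⟨h1, h2, o, h3, h4, h5, h6⟩
    have henv' : Env B m N r c s τ := henv.frame fun a ha => by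
      rw [h1 a (by revert a; decide), hf₁ a (by revert a; decide)]
    refine ⟨fun a ha => (hfl a ha τ).trans (h1 a ha), ?_⟩
    by_cases ht : t < N
    · rw [min_eq_left ht.le] at h2 h4 h5
      rw [min_eq_left (show t + 1 ≤ N from ht)]
      obtain ⟨k1, k2, k3, k4, k5⟩ := exec_layerCmd henv' hm hC hN hc ht h2 h3 h4 h5 h6
      exact ⟨k1, _, k2, k3, k4, k5⟩
    · rw [min_eq_right (not_lt.1 ht)] at h2 h4 h5
      rw [min_eq_right (show N ≤ t + 1 by omega)]
      have : (layerCmd C).exec B τ = τ := by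
        rw [layerCmd, Cmd.exec_ite, if_pos (by simp [h2, henv'.N]), Cmd.exec_skip]
      rw [this]
      exact ⟨h2, o, h3, h4, h5, h6⟩

/-! ### The search for the scale -/

/-- The assignment `a` of `n` jobs to `m` machines causes loads of at most `T`. -/
def Packs (m n : ℕ) (p c : ℕ → ℕ) (s T : ℕ) (a : ℕ → ℕ) : Prop :=
  (∀ t < n, a t < m) ∧ ∀ i < m, mload p c s (fib a n i) ≤ T

theorem mload_congr {p p' c c' : ℕ → ℕ} {s : ℕ} {X : Finset ℕ} (hp : ∀ t ∈ X, p t = p' t)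
    (hc : ∀ t ∈ X, c t = c' t) : mload p c s X = mload p' c' s X := by
  unfold mload
  rw [Finset.sum_congr rfl hp, Finset.image_congr hc]

/-- Looks for an assignment of the jobs with the scale `vG`. -/
def attemptCmd (e C : ℕ) : Cmd := groupCmd e C ;; solveCmd C

/-- The memory in which the scales are tried out: `n` jobs of scaled sizes `p` sorted by class. -/
structure Ready (B m n : ℕ) (p c : ℕ → ℕ) (s : ℕ) (σ : Store) : Prop where
  eq_n : σ 0 0 = n
  eq_m : σ 0 2 = m
  n_lt : n < B
  m_lt : m < B
  eq_B : σ vB 0 = B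
  pow : ∀ j ≤ B, σ aW j = B ^ j
  eq_p : σ aP = p
  eq_c : σ aC = c
  eq_s : σ vS 0 = s
  p_pos : ∀ t < n, 0 < p t
  mono : MonotoneOn c (Set.Iio n)
  c_lt : ∀ t < n, c t < B

theorem Ready.frame {B m n : ℕ} {p c : ℕ → ℕ} {s : ℕ} {σ τ : Store} (h : Ready B m n p c s σ)
    (hf : ∀ a ∈ [0, vB, aW, aP, aC, vS], τ a = σ a) : Ready B m n p c s τ := by
  obtain ⟨h1, h2, h3, h4, h5, h6, h7, h8, h9, h10, h11, h12⟩ := h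
  rw [← hf 0 (by decide)] at h1 h2
  rw [← hf vB (by decide)] at h5
  rw [← hf aW (by decide)] at h6
  rw [← hf aP (by decide)] at h7
  rw [← hf aC (by decide)] at h8
  rw [← hf vS (by decide)] at h9
  exact ⟨h1, h2, h3, h4, h5, h6, h7, h8, h9, h10, h11, h12⟩

theorem attemptCmd_frame {B e C : ℕ} {σ : Store} :
    ∀ a ∈ [0, vB, aOrd, aP, aC, aW, vU, vS, vG], (attemptCmd e C).exec B σ a = σ a := by
  intro a ha
  refine Cmd.exec_frame _ ?_ σ
  simp only [attemptCmd, groupCmd, modeCmd, groupStep, newItem, solveCmd, initCmd, layerCmd,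
    scanState, tryMove, moveCmd, loadRow, stepRow, keyRow, storeRow, copyCmd, pickState, Cmd.mods,
    Cmd.mods_set, Cmd.mods_repPow]
  revert a
  decide

/-- At scale `g`, either no assignment of the jobs has loads of at most `2 * e ^ 4 * g`, or one with
loads of at most `g * C` is found. -/
theorem exec_attemptCmd {B m n : ℕ} {p c : ℕ → ℕ} {s : ℕ} {σ : Store} {e C : ℕ}
    (h : Ready B m n p c s σ) (he : 2 ≤ e) (hCe : C = 2 * e ^ 4 + 24 * e ^ 3)
    (hC : 2 * C + 3 ≤ B) (hG : 0 < σ vG 0) (hdone : σ vDone 0 = 0)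
    (hfr : ∀ j ≥ σ vOff 0, σ aPres j = 0) :
    (∀ j ≥ (attemptCmd e C).exec B σ vOff 0, (attemptCmd e C).exec B σ aPres j = 0) ∧
    (((attemptCmd e C).exec B σ vDone 0 = 0 ∧
        ∀ a, ¬ Packs m n p c s (2 * e ^ 4 * σ vG 0) a) ∨
      ((attemptCmd e C).exec B σ vDone 0 ≠ 0 ∧
        Packs m n p c s (σ vG 0 * C) fun t =>
          (attemptCmd e C).exec B σ aAsg ((attemptCmd e C).exec B σ aIt t))) := by
  rw [attemptCmd, Cmd.exec_seq]
  obtain ⟨F, h1, h2, h3, h4, h5, h6⟩ := exec_groupCmd (B := B) (e := e) (C := C) (σ := σ)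
    (h.eq_n ▸ h.n_lt.le) h.eq_B (by rw [h.eq_c, h.eq_n]; exact h.mono)
  have hf₁ : ∀ a ∈ [0, aW, vDone, vOff, aPres], (groupCmd e C).exec B σ a = σ a := by
    intro a ha
    refine Cmd.exec_frame _ ?_ σ
    simp only [groupCmd, modeCmd, groupStep, newItem, Cmd.mods, Cmd.mods_set]
    revert a
    decide
  generalize (groupCmd e C).exec B σ = σ₁ at *
  have hf₂ : (solveCmd C).exec B σ₁ aIt = σ₁ aIt := by
    refine Cmd.exec_frame _ ?_ σ₁
    simp only [solveCmd, initCmd, layerCmd, scanState, tryMove, moveCmd, loadRow, stepRow, keyRow,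
      storeRow, copyCmd, pickState, Cmd.mods, Cmd.mods_set, Cmd.mods_repPow]
    decide
  rw [h.eq_n, h.eq_p, h.eq_c, h.eq_s] at h6
  have hNn : F.N ≤ n := by rcases h6 with h6 | h6 <;> exact h6.2.1.N_le
  have hclB : ∀ q < F.N, F.cl q ≤ B := by
    rcases h6 with ⟨-, h6, -⟩ | ⟨-, h6, -⟩ <;> intro q hq <;>
      obtain ⟨u, hu, rfl⟩ := h6.surj q hq <;> rw [h6.cl_it u hu]
    · exact Nat.zero_le _
    · exact (h.c_lt u hu).le
  have hclm : ∀ q q', q ≤ q' → q' < F.N → F.cl q ≤ F.cl q' := by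
    rcases h6 with h6 | h6 <;> exact h6.2.1.cl_mono
  have henv : Env B m F.N (σ₁ aR) (σ₁ aCl) (σ₁ vRs 0) σ₁ :=
    ⟨by rw [hf₁ 0 (by decide), h.eq_m], by rw [hf₁ aW (by decide)]; exact h.pow, rfl, rfl, rfl, h1⟩
  -- the dynamic program also looks at the label after the last one
  have hmono : MonotoneOn (σ₁ aCl) (Set.Iio (F.N + 1)) := by
    intro q hq q' hq' hqq
    rw [Set.mem_Iio] at hq hq'
    rcases Nat.lt_succ_iff_lt_or_eq.1 hq' with hq' | rfl
    · rw [h2 q (by omega), h2 q' hq']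
      exact hclm q q' hqq hq'
    · rcases Nat.lt_succ_iff_lt_or_eq.1 hq with hq | rfl
      · rw [h2 q hq, h3]
        exact hclB q hq
      · rfl
  have hs := exec_solveCmd henv h.m_lt hC (hNn.trans_lt h.n_lt) hmono
    (by rw [hf₁ vDone (by decide), hdone])
    (by rw [hf₁ vOff (by decide), hf₁ aPres (by decide)]; exact hfr)
  rw [hf₂, h5]
  generalize (solveCmd C).exec B σ₁ = τ at *
  -- validity refers to the loads of the machines with the rounded items
  have hval : ∀ b, Valid m C (σ₁ aR) (σ₁ aCl) (σ₁ vRs 0) F.N b ↔ (∀ q < F.N, b q < m) ∧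
      ∀ i < m, mload (fun q => rnd (σ vG 0) C (F.z q)) F.cl (σ₁ vRs 0) (fib b F.N i) ≤ C := by
    intro b
    refine and_congr_right fun _ => forall_congr' fun i => forall_congr' fun _ => ?_
    rw [lev_eq hmono (Nat.le_succ _), mload_congr (p' := fun q => rnd (σ vG 0) C (F.z q))
      (c' := F.cl) (fun q hq => h4 q (mem_fib.1 hq).1) fun q hq => h2 q (mem_fib.1 hq).1]
  refine ⟨hs.1, ?_⟩
  rcases hs.2 with ⟨k1, k2⟩ | ⟨k1, b, k2, k3⟩
  · refine Or.inl ⟨k1, fun a ha => ?_⟩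
    have : ∃ b, Valid m C (σ₁ aR) (σ₁ aCl) (σ₁ vRs 0) F.N b := by
      simp only [hval]
      rcases h6 with ⟨g1, g2, g3⟩ | ⟨g1, g2, g3⟩
      · have := g2.exists_small C he hG rfl g1 h.p_pos ha.1 ha.2
        rwa [g3, ← hCe] at *
      · have := g2.exists_large C he hG rfl g1 h.p_pos ha.1 ha.2
        rwa [g3, ← hCe] at *
    exact k2 _ this.choose_spec
  · refine Or.inr ⟨k1, ?_⟩
    have hit : ∀ t < n, F.it t < F.N := by rcases h6 with h6 | h6 <;> exact h6.2.1.it_lt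
    rw [hval] at k2
    refine ⟨fun t ht => ?_, fun i hi => ?_⟩
    · dsimp only
      rw [k3 _ (hit t ht)]
      exact k2.1 _ (hit t ht)
    · have : fib (fun t => τ aAsg (F.it t)) n i = fib (fun t => b (F.it t)) n i := by
        refine Finset.filter_congr fun t ht => ?_
        dsimp only
        rw [k3 _ (hit t (Finset.mem_range.1 ht))]
      rw [this]
      rcases h6 with ⟨g1, g2, g3⟩ | ⟨g1, g2, g3⟩
      · exact g2.load_le (s' := 0) (Or.inl ⟨rfl, rfl⟩) (Or.inl (Nat.zero_le _)) (k2.2 i hi)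
      · refine g2.load_le (s' := s) (Or.inr ⟨rfl, rfl⟩) ?_ (k2.2 i hi)
        rw [g3]
        exact rnd_cases _ _ _

/-- Unless an assignment has been found, increases the scale by `vU` and tries again. -/
def tryCmd (e C : ℕ) : Cmd :=
  .ite (.var vDone) .skip (.set vG (.add (.var vG) (.var vU)) ;; attemptCmd e C)

/-- Tries the scales `vU`, `2 * vU`, … until an assignment is found. -/
def searchCmd (e C : ℕ) : Cmd := .rep (.rep (tryCmd e C))

/-- The state of the search after `x` trials. Here `u` is the first scale. -/
structure SearchInv (m n : ℕ) (p c : ℕ → ℕ) (s u e C : ℕ) (σ : Store) (x : ℕ) (τ : Store) :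
    Prop where
  frame : ∀ a ∈ [0, vB, aOrd, aP, aC, aW, vU, vS], τ a = σ a
  fresh : ∀ j ≥ τ vOff 0, τ aPres j = 0
  res : τ vDone 0 = 0 ∧ τ vG 0 = x * u ∧ (0 < x → ∀ a, ¬ Packs m n p c s (2 * e ^ 4 * (x * u)) a) ∨
    τ vDone 0 ≠ 0 ∧ ∃ y, (0 < y → ∀ a, ¬ Packs m n p c s (2 * e ^ 4 * (y * u)) a) ∧
      Packs m n p c s ((y + 1) * u * C) fun t => τ aAsg (τ aIt t)

theorem SearchInv.step {B m n : ℕ} {p c : ℕ → ℕ} {s u e C x : ℕ} {σ τ : Store}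
    (hσ : Ready B m n p c s σ) (he : 2 ≤ e) (hCe : C = 2 * e ^ 4 + 24 * e ^ 3)
    (hC : 2 * C + 3 ≤ B) (hu : 0 < u) (hU : σ vU 0 = u)
    (h : SearchInv m n p c s u e C σ x τ) :
    SearchInv m n p c s u e C σ (x + 1) ((tryCmd e C).exec B τ) := by
  obtain ⟨h1, h2, h3⟩ := h
  rw [tryCmd, Cmd.exec_ite]
  rcases h3 with ⟨h3, h4, h5⟩ | h3
  · rw [if_pos (by simpa using h3), Cmd.exec_seq]
    obtain ⟨τ₁, hτ₁⟩ : ∃ τ₁, τ₁ = (Cmd.set vG (.add (.var vG) (.var vU))).exec B τ := ⟨_, rfl⟩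
    rw [← hτ₁]
    have hf₁ : ∀ a, a ≠ vG → τ₁ a = τ a := by
      intro a ha
      simp [hτ₁, Store.write_apply, ha]
    have hG : τ₁ vG 0 = (x + 1) * u := by
      simp [hτ₁, Store.write_apply, h4, h1 vU (by decide), hU, Nat.succ_mul]
    have hfr : ∀ a ∈ [0, vB, aOrd, aP, aC, aW, vU, vS], τ₁ a = σ a := by
      intro a ha
      rw [hf₁ a (by revert a; decide), h1 a ha]
    obtain ⟨k1, k2⟩ := exec_attemptCmd (σ := τ₁)
      (hσ.frame fun a ha => hfr a (by revert a; decide)) he hCe hC (by rw [hG]; positivity) (by rw [hf₁ vDone (by decide), h3])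
      (by rw [hf₁ vOff (by decide), hf₁ aPres (by decide)]; exact h2)
    rw [hG] at k2
    refine ⟨fun a ha => ?_, k1, ?_⟩
    · rw [attemptCmd_frame a (by revert a; decide), hfr a ha]
    · rcases k2 with ⟨k2, k3⟩ | ⟨k2, k3⟩
      · refine Or.inl ⟨k2, ?_, fun _ => k3⟩
        rw [attemptCmd_frame vG (by decide), hG]
      · exact Or.inr ⟨k2, x, h5, k3⟩
  · rw [if_neg (by simpa using h3.1)]
    exact ⟨h1, h2, Or.inr h3⟩

/-- The scale found is at most `u` larger than it need be for an assignment with loads at most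
`T`. -/
theorem exec_searchCmd {B m n : ℕ} {p c : ℕ → ℕ} {s u e C T : ℕ} {a : ℕ → ℕ} {σ : Store}
    (hσ : Ready B m n p c s σ) (he : 2 ≤ e) (hCe : C = 2 * e ^ 4 + 24 * e ^ 3)
    (hC : 2 * C + 3 ≤ B) (hu : 0 < u) (hU : σ vU 0 = u) (hG : σ vG 0 = 0) (hdone : σ vDone 0 = 0)
    (hfr : ∀ j, σ aPres j = 0) (ha : Packs m n p c s T a) (hT : T ≤ 2 * e ^ 4 * (B * B * u)) :
    (∀ a ∈ [0, vB, aOrd, aP, aC, aW, vU, vS], (searchCmd e C).exec B σ a = σ a) ∧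
    ∃ y, 2 * e ^ 4 * (y * u) ≤ T ∧ Packs m n p c s ((y + 1) * u * C) fun t =>
      (searchCmd e C).exec B σ aAsg ((searchCmd e C).exec B σ aIt t) := by
  have h := Cmd.exec_rep (B := B) (c := .rep (tryCmd e C)) (σ := σ)
    (fun x τ => SearchInv m n p c s u e C σ (x * B) τ)
    ⟨fun _ _ => rfl, fun j _ => hfr j, Or.inl ⟨hdone, by simpa using hG, by simp⟩⟩ ?_
  · rw [searchCmd]
    generalize (Cmd.rep (.rep (tryCmd e C))).exec B σ = τ at *
    obtain ⟨h1, -, h3⟩ := h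
    refine ⟨h1, ?_⟩
    have mono : ∀ {T' : ℕ}, T ≤ T' → Packs m n p c s T' a :=
      fun hTT => ⟨ha.1, fun i hi => (ha.2 i hi).trans hTT⟩
    have hB : 0 < B := by have := hσ.n_lt; omega
    rcases h3 with ⟨-, -, h3⟩ | ⟨-, y, h3, h4⟩
    · exact absurd (mono hT) (h3 (by positivity) a)
    · refine ⟨y, ?_, h4⟩
      rcases Nat.eq_zero_or_pos y with rfl | hy
      · simp
      · by_contra hlt
        exact h3 hy a (mono (by omega))
  · rintro x - τ hx
    have h' := Cmd.exec_rep (B := B) (c := tryCmd e C) (σ := τ)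
      (fun y υ => SearchInv m n p c s u e C σ (x * B + y) υ) hx
      fun y _ υ hy => hy.step hσ he hCe hC hu hU
    rwa [Nat.succ_mul]

/-! ### The output of the schedule -/

notation "vPos" => (49 : ℕ)
notation "vMac" => (50 : ℕ)
notation "aLd" => (51 : ℕ)
notation "aLs" => (52 : ℕ)

/-- Schedules the job at position `vPos` at the end of its machine. The array `aLd` contains the
completion times of the machines, and `aLs` the classes of their last jobs, plus one. -/
def emitStep : Cmd :=
  .ite (.lt (.var vPos) (.get 0 (.lit 0)))
    (.set vMac (.get aAsg (.get aIt (.var vPos))) ;;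
     .ite (.eq (.get aLs (.var vMac)) (.add (.get aC (.var vPos)) (.lit 1))) .skip
       (.put aLd (.var vMac) (.add (.get aLd (.var vMac)) (.get 0 (.lit 3)))) ;;
     .put 3 (.get aOrd (.var vPos)) (.var vMac) ;;
     .put 4 (.get aOrd (.var vPos)) (.get aLd (.var vMac)) ;;
     .put aLd (.var vMac) (.add (.get aLd (.var vMac)) (.get 1 (.get aOrd (.var vPos)))) ;;
     .put aLs (.var vMac) (.add (.get aC (.var vPos)) (.lit 1)) ;;
     .set vPos (.add (.var vPos) (.lit 1)))
    .skip

/-- The output consists of the assignment and the starting times that result from processing the jobs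
of every machine in the order of their classes. -/
theorem exec_rep_emitStep {B n s : ℕ} {ord c p a : ℕ → ℕ} {σ : Store} (hn : n ≤ B)
    (h0 : σ 0 0 = n) (hs : σ 0 3 = s) (hp : σ 1 = p) (hord : σ aOrd = ord) (hc : σ aC = c)
    (ha : ∀ t, σ aAsg (σ aIt t) = a t) (hinj : Set.InjOn ord (Set.Iio n)) (hpos : σ vPos 0 = 0)
    (hLd : ∀ i, σ aLd i = 0) (hLs : ∀ i, σ aLs i = 0) :
    ∀ t < n, (Cmd.rep emitStep).exec B σ 3 (ord t) = a t ∧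
      (Cmd.rep emitStep).exec B σ 4 (ord t) + p (ord t) =
        lev (fun u => p (ord u)) c s a (t + 1) (a t) := by
  have h := Cmd.exec_rep (B := B) (c := emitStep) (σ := σ) (fun x τ =>
    (∀ a ∈ [0, 1, aOrd, aC, aAsg, aIt], τ a = σ a) ∧ τ vPos 0 = min x n ∧
    (∀ i, τ aLd i = lev (fun u => p (ord u)) c s a (min x n) i) ∧
    (∀ i, τ aLs i = lst c a (min x n) i) ∧
    ∀ t < min x n, τ 3 (ord t) = a t ∧
      τ 4 (ord t) + p (ord t) = lev (fun u => p (ord u)) c s a (t + 1) (a t)) ?_ ?_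
  · rw [min_eq_right hn] at h
    exact h.2.2.2.2
  · refine ⟨fun _ _ => rfl, by simp [hpos], ?_, ?_, by simp⟩ <;> intro i
    · simp [hLd, lev]
    · simp [hLs, lst]
  · rintro x - τ ⟨h1, h2, h3, h4, h5⟩
    rw [emitStep, Cmd.exec_ite]
    have hin : τ 0 0 = n := by rw [h1 0 (by decide), h0]
    by_cases hx : x < n
    · rw [min_eq_left hx.le] at h2 h3 h4 h5
      rw [min_eq_left (show x + 1 ≤ n from hx), if_neg (by simpa [h2, hin] using hx), Cmd.exec_seq]
      obtain ⟨τ₁, hτ₁⟩ : ∃ τ₁, τ₁ = (Cmd.set vMac (.get aAsg (.get aIt (.var vPos)))).exec B τ :=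
        ⟨_, rfl⟩
      rw [← hτ₁, Cmd.exec_seq]
      have hf₁ : ∀ a, a ≠ vMac → τ₁ a = τ a := by
        intro a ha
        simp [hτ₁, Store.write_apply, ha]
      have hM : τ₁ vMac 0 = a x := by
        simp [hτ₁, Store.write_apply, h2, h1 aAsg (by decide), h1 aIt (by decide), ha]
      obtain ⟨τ₂, hτ₂⟩ : ∃ τ₂, τ₂ =
        (Cmd.ite (.eq (.get aLs (.var vMac)) (.add (.get aC (.var vPos)) (.lit 1))) .skip
         (.put aLd (.var vMac) (.add (.get aLd (.var vMac)) (.get 0 (.lit 3))))).exec B τ₁ :=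
        ⟨_, rfl⟩
      rw [← hτ₂]
      have hf₂ : ∀ a, a ≠ aLd → τ₂ a = τ₁ a := by
        intro a ha
        rw [hτ₂, Cmd.exec_ite]
        split_ifs <;> simp [Store.write_apply, ha]
      have hL₂ : ∀ i, τ₂ aLd i = lev (fun u => p (ord u)) c s a x i +
          if a x = i ∧ lst c a x i ≠ c x + 1 then s else 0 := by
        intro i
        rw [hτ₂, Cmd.exec_ite]
        simp only [Expr.eval_eq, Expr.eval_get, Expr.eval_var, Expr.eval_add, Expr.eval_lit, hM,
          hf₁ aLs (by decide), h4, hf₁ vPos (by decide), h2, hf₁ aC (by decide), h1 aC (by decide),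
          hc]
        by_cases hl : lst c a x (a x) = c x + 1
        · rw [if_pos hl, if_neg one_ne_zero, Cmd.exec_skip, hf₁ aLd (by decide), h3, if_neg]
          · simp
          · rintro ⟨rfl, h⟩
            exact h hl
        · rw [if_neg hl, if_pos rfl]
          simp only [Cmd.exec_put, Store.write_apply, reduceIte, Expr.eval_get, Expr.eval_var,
            Expr.eval_add, Expr.eval_lit, hM, hf₁ aLd (by decide), h3, hf₁ 0 (by decide),
            h1 0 (by decide), hs]
          by_cases hi : a x = i
          · subst hi
            simp [hl]
          · simp [hi, Function.update_of_ne (Ne.symm hi), h3]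
      have hM₂ : τ₂ vMac 0 = a x := by rw [hf₂ vMac (by decide), hM]
      have hP₂ : τ₂ vPos 0 = x := by rw [hf₂ vPos (by decide), hf₁ vPos (by decide), h2]
      have hO₂ : τ₂ aOrd = ord := by
        rw [hf₂ aOrd (by decide), hf₁ aOrd (by decide), h1 aOrd (by decide), hord]
      have hp₂ : τ₂ 1 = p := by
        rw [hf₂ 1 (by decide), hf₁ 1 (by decide), h1 1 (by decide), hp]
      have hc₂ : τ₂ aC = c := by
        rw [hf₂ aC (by decide), hf₁ aC (by decide), h1 aC (by decide), hc]
      simp only [Cmd.exec_seq, Cmd.exec_put, Cmd.exec_set, Store.write_apply, Expr.eval_get,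
        Expr.eval_add, Expr.eval_var, Expr.eval_lit, hM₂, hP₂, hO₂, hp₂, hc₂, Nat.reduceEqDiff,
        reduceIte, Function.update_self]
      have hlev : lev (fun u => p (ord u)) c s a (x + 1) (a x) = τ₂ aLd (a x) + p (ord x) := by
        rw [hL₂, lev, if_pos rfl]
        split_ifs <;> omega
      refine ⟨?_, ?_, ?_, ?_, ?_⟩
      · intro b hb
        rw [← h1 b hb, ← hf₁ b (by revert b; decide), ← hf₂ b (by revert b; decide)]
        revert b
        simp
      · simp
      · intro i
        by_cases hi : a x = i
        · subst hi
          simp [hlev]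
        · simp [Function.update_of_ne (Ne.symm hi), hL₂, lev, hi]
      · intro i
        by_cases hi : a x = i
        · subst hi
          simp [lst]
        · simp [Function.update_of_ne (Ne.symm hi), lst, hi, hf₂, hf₁, h4]
      · intro t ht
        rcases Nat.lt_succ_iff_lt_or_eq.1 ht with ht | rfl
        · have hne : ord t ≠ ord x := fun h =>
            ht.ne (hinj (Set.mem_Iio.2 (ht.trans hx)) (Set.mem_Iio.2 hx) h)
          simpa [Function.update_of_ne hne, hf₂, hf₁] using h5 t ht
        · simp [hlev]
    · rw [min_eq_right (not_lt.1 hx)] at h2 h3 h4 h5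
      rw [min_eq_right (show n ≤ x + 1 by omega), if_pos (by simp [h2, hin]), Cmd.exec_skip]
      exact ⟨h1, h2, h3, h4, h5⟩

/-! ### Schedules and loads -/

/-- Jobs that are feasibly scheduled on one machine, job `t` starting at time `st t`, complete no
earlier than the load of the machine. -/
theorem exists_mload_le {p c st : ℕ → ℕ} {s : ℕ} {X : Finset ℕ} (hX : X.Nonempty)
    (hs : ∀ t ∈ X, s ≤ st t) (hp : ∀ t ∈ X, 0 < p t)
    (hd : ∀ t ∈ X, ∀ t' ∈ X, t ≠ t' → st t + p t + (if c t = c t' then 0 else s) ≤ st t' ∨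
      st t' + p t' + (if c t' = c t then 0 else s) ≤ st t) :
    ∃ t ∈ X, mload p c s X ≤ st t + p t := by
  induction hcard : X.card generalizing X with
  | zero => exact absurd (Finset.card_eq_zero.1 hcard) hX.ne_empty
  | succ d ih =>
    -- the job that starts last is removed
    obtain ⟨t, ht, hmax⟩ := X.exists_max_image st hX
    refine ⟨t, ht, ?_⟩
    have hins := mload_insert (p := p) (c := c) (s := s) (Finset.notMem_erase t X)
    rw [Finset.insert_erase ht] at hins
    rw [hins]
    rcases (X.erase t).eq_empty_or_nonempty with hY | hY
    · have := hs t ht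
      simp [hY, mload]
      omega
    · obtain ⟨t', ht', hle⟩ := ih hY (fun u hu => hs u (Finset.mem_of_mem_erase hu))
        (fun u hu => hp u (Finset.mem_of_mem_erase hu))
        (fun u hu u' hu' => hd u (Finset.mem_of_mem_erase hu) u' (Finset.mem_of_mem_erase hu'))
        (by rw [Finset.card_erase_of_mem ht, hcard, Nat.add_sub_cancel])
      have h1 := hmax t' (Finset.mem_of_mem_erase ht')
      have h2 := hp t ht
      rcases hd t' (Finset.mem_of_mem_erase ht') t ht (Finset.ne_of_mem_erase ht') with h3 | h3
      · by_cases hc : c t ∈ (X.erase t).image c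
        · rw [if_pos hc]
          omega
        · have : c t' ≠ c t := fun h => hc (Finset.mem_image.2 ⟨t', ht', h⟩)
          rw [if_neg this] at h3
          rw [if_neg hc]
          omega
      · omega

theorem setup_add_le_lev {p c : ℕ → ℕ} {s : ℕ} {a : ℕ → ℕ} {n t : ℕ}
    (hc : MonotoneOn c (Set.Iio n)) (ht : t < n) : s + p t ≤ lev p c s a (t + 1) (a t) := by
  rw [lev_eq hc ht]
  refine le_trans (le_of_eq ?_) (mload_mono (X := {t}) ?_)
  · simp [mload, add_comm]
  · simp [mem_fib]

/-- Processing the jobs of every machine in the order of their classes, with the setups accounted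
for by `lev`, leaves the time for a setup between any two jobs of different classes. -/
theorem lev_add_le_lev {p c : ℕ → ℕ} {s : ℕ} {a : ℕ → ℕ} {n t t' : ℕ}
    (hc : MonotoneOn c (Set.Iio n)) (htt : t < t') (ht' : t' < n) (ha : a t = a t') :
    lev p c s a (t + 1) (a t) + (if c t = c t' then 0 else s) + p t' ≤
      lev p c s a (t' + 1) (a t') := by
  rw [lev_eq hc (show t + 1 ≤ n by omega), lev_eq hc ht']
  have hnot : t' ∉ fib a (t + 1) (a t) := by
    simp [mem_fib]
    omega
  have hsub : insert t' (fib a (t + 1) (a t)) ⊆ fib a (t' + 1) (a t') := by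
    intro u hu
    rw [Finset.mem_insert, mem_fib] at hu
    rw [mem_fib]
    rcases hu with rfl | hu
    · exact ⟨by omega, rfl⟩
    · exact ⟨by omega, hu.2.trans ha⟩
  refine le_trans ?_ (mload_mono hsub)
  rw [mload_insert hnot]
  split_ifs with h1 h2 h2
  · omega
  · omega
  · rw [Finset.mem_image] at h2
    obtain ⟨u, hu, hu'⟩ := h2
    rw [mem_fib] at hu
    have h3 : c u ≤ c t := hc (by simp; omega) (by simp; omega) (by omega)
    have h4 : c t ≤ c t' := hc (by simp; omega) (by simp; omega) (by omega)
    omega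
  · omega

theorem mload_smul (f : ℕ) (p c : ℕ → ℕ) (s : ℕ) (X : Finset ℕ) :
    mload (fun t => f * p t) c (f * s) X = f * mload p c s X := by
  unfold mload
  rw [← Finset.mul_sum]
  ring

theorem mload_le_mul {p c : ℕ → ℕ} {s M n i : ℕ} {a : ℕ → ℕ} (hp : ∀ t < n, p t ≤ M) :
    mload p c s (fib a n i) ≤ n * (s + M) := by
  have h1 : (fib a n i).card ≤ n := (Finset.card_filter_le _ _).trans (by simp)
  have h2 : ∑ t ∈ fib a n i, p t ≤ n * M :=
    (Finset.sum_le_card_nsmul _ _ M fun t ht => hp t (mem_fib.1 ht).1).trans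
      (Nat.mul_le_mul_right _ h1)
  have h3 : s * ((fib a n i).image c).card ≤ s * n :=
    Nat.mul_le_mul_left _ (Finset.card_image_le.trans h1)
  unfold mload
  calc _ ≤ n * M + s * n := add_le_add h2 h3
    _ = _ := by ring

namespace SetupInstance

variable (I : SetupInstance)

theorem input_p (j : Fin I.n) : I.input 1 j = I.p j := by
  simp [input]

theorem input_cls (j : Fin I.n) : I.input 2 j = I.cls j := by
  simp [input]

theorem input_switchTime (i j : Fin I.n) :
    (if I.input 2 i = I.input 2 j then 0 else I.s) = I.switchTime i j := by
  unfold switchTime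
  simp only [input_cls, Fin.val_inj]

theorem setup_add_pmax_le_opt : I.s + I.pmax ≤ I.opt := by
  obtain ⟨S, hS, hM⟩ := I.opt_isLeast.1
  have h : ∀ j, I.s + I.p j ≤ I.opt := fun j => by
    have h1 : S.start j + I.p j ≤ S.makespan :=
      Finset.le_sup (f := fun j => S.start j + I.p j) (Finset.mem_univ j)
    have h2 := hS.1 j
    omega
  have h1 := h ⟨0, I.n_pos⟩
  have h2 : I.pmax ≤ I.opt - I.s := Finset.sup_le fun j _ => by
    have := h j
    omega
  omega

/-- An optimal schedule provides an assignment of the jobs with loads at most `opt`, where the jobs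
are listed in the order `ord`. -/
theorem exists_mload_le_opt {ord : ℕ → ℕ} (hlt : ∀ t < I.n, ord t < I.n)
    (hinj : Set.InjOn ord (Set.Iio I.n)) :
    ∃ a : ℕ → ℕ, (∀ t < I.n, a t < I.m) ∧ ∀ i,
      mload (fun t => I.input 1 (ord t)) (fun t => I.input 2 (ord t)) I.s (fib a I.n i) ≤
        I.opt := by
  obtain ⟨S, hS, hM⟩ := I.opt_isLeast.1
  refine ⟨fun t => if h : ord t < I.n then S.machine ⟨ord t, h⟩ else 0, fun t ht => ?_,
    fun i => ?_⟩
  · simp [hlt t ht]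
  · rcases (fib (fun t => if h : ord t < I.n then (S.machine ⟨ord t, h⟩ : ℕ) else 0)
      I.n i).eq_empty_or_nonempty with h | h
    · rw [h]
      simp [mload]
    · have key := exists_mload_le (p := fun t => I.input 1 (ord t))
        (c := fun t => I.input 2 (ord t)) (s := I.s)
        (st := fun t => if h : ord t < I.n then S.start ⟨ord t, h⟩ else 0) h ?_ ?_ ?_
      · obtain ⟨t, ht, hle⟩ := key
        refine hle.trans ?_
        have hto := hlt t (mem_fib.1 ht).1
        have h1 := I.input_p ⟨ord t, hto⟩
        have h2 : S.start ⟨ord t, hto⟩ + I.p ⟨ord t, hto⟩ ≤ S.makespan :=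
          Finset.le_sup (f := fun j => S.start j + I.p j) (Finset.mem_univ _)
        simp only [hto, dite_true]
        dsimp only at h1
        omega
      · intro t ht
        have hto := hlt t (mem_fib.1 ht).1
        simpa [hto] using hS.1 ⟨ord t, hto⟩
      · intro t ht
        have hto := hlt t (mem_fib.1 ht).1
        have := I.p_pos ⟨ord t, hto⟩
        rwa [← input_p] at this
      · intro t ht t' ht' hne
        rw [mem_fib] at ht ht'
        have hto := hlt t ht.1
        have hto' := hlt t' ht'.1
        have h3 := hS.2 ⟨ord t, hto⟩ ⟨ord t', hto'⟩
          (fun h => hne (hinj ht.1 ht'.1 (Fin.mk.inj h))) (Fin.ext (by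
            have h1 := ht.2
            have h2 := ht'.2
            simp only [hto, hto', dite_true] at h1 h2
            omega))
        rw [← input_switchTime, ← input_switchTime, ← input_p, ← input_p] at h3
        simpa only [hto, hto', dite_true] using h3

/-- A memory that contains an assignment with loads at most `M`, and the starting times that result
from it, contains a feasible schedule of makespan at most `M`. -/
theorem exists_schedule {ord a : ℕ → ℕ} {M : ℕ} {τ : RAM.Store}
    (hsurj : ∀ l < I.n, ∃ t < I.n, ord t = l)
    (hc : MonotoneOn (fun t => I.input 2 (ord t)) (Set.Iio I.n)) (ha : ∀ t < I.n, a t < I.m)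
    (hload : ∀ i < I.m, mload (fun t => I.input 1 (ord t)) (fun t => I.input 2 (ord t)) I.s
      (fib a I.n i) ≤ M)
    (hτ : ∀ t < I.n, τ 3 (ord t) = a t ∧ τ 4 (ord t) + I.input 1 (ord t) =
      lev (fun t => I.input 1 (ord t)) (fun t => I.input 2 (ord t)) I.s a (t + 1) (a t)) :
    ∃ S : I.Schedule, S.IsOutput τ ∧ S.Feasible ∧ S.makespan ≤ M := by
  choose! pos hpos hord using hsurj
  have hm : ∀ j : Fin I.n, τ 3 j = a (pos j) := fun j => by
    rw [← (hτ _ (hpos j j.2)).1, hord j j.2]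
  have hst : ∀ j : Fin I.n, τ 4 j + I.p j = lev (fun t => I.input 1 (ord t))
      (fun t => I.input 2 (ord t)) I.s a (pos j + 1) (a (pos j)) := fun j => by
    rw [← (hτ _ (hpos j j.2)).2, hord j j.2, input_p]
  refine ⟨⟨fun j => ⟨τ 3 j, by rw [hm]; exact ha _ (hpos j j.2)⟩, fun j => τ 4 j⟩,
    fun j => ⟨rfl, rfl⟩, ⟨fun j => ?_, fun i j hij hmac => ?_⟩, Finset.sup_le fun j _ => ?_⟩
  · have := setup_add_le_lev (p := fun t => I.input 1 (ord t)) (s := I.s) (a := a) hc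
      (hpos j j.2)
    rw [← hst, hord j j.2, input_p] at this
    dsimp only
    omega
  · have key : ∀ i j : Fin I.n, τ 3 i = τ 3 j → pos i < pos j →
        τ 4 i + I.p i + I.switchTime i j ≤ τ 4 j := by
      intro i j hmac hlt
      rw [hm, hm] at hmac
      have := lev_add_le_lev (p := fun t => I.input 1 (ord t)) (s := I.s) hc hlt (hpos j j.2) hmac
      rw [← hst, ← hst, hord j j.2, hord i i.2, input_p, input_switchTime] at this
      omega
    have hmac' : τ 3 i = τ 3 j := congrArg Fin.val hmac
    rcases lt_trichotomy (pos i) (pos j) with h | h | h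
    · exact Or.inl (key i j hmac' h)
    · refine absurd (Fin.ext ?_) hij
      rw [← hord i i.2, h, hord j j.2]
    · exact Or.inr (key j i hmac'.symm h)
  · dsimp only
    rw [hst]
    refine (lev_mono (hpos j j.2)).trans ?_
    rw [lev_eq hc le_rfl]
    exact hload _ (ha _ (hpos j j.2))

end SetupInstance

/-! ### The approximation scheme -/

/-- The whole algorithm, apart from the computation of the bound for its loops. The parameter `e`
is the reciprocal of the accuracy. The sizes are multiplied by `2 * e ^ 5`. -/
def schemeCmd (e C : ℕ) : Cmd :=
  .set vB (.add (.add (.get 0 (.lit 0)) (.get 0 (.lit 1)))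
    (.add (.get 0 (.lit 2)) (.lit (2 * C + 4)))) ;;
  powersCmd ;;
  sortCmd (2 * e ^ 5) ;;
  .set vU (.add (.get 0 (.lit 3)) (.var vMax)) ;;
  .set vS (.smul (2 * e ^ 5) (.get 0 (.lit 3))) ;;
  searchCmd e C ;;
  .rep emitStep

theorem searchCmd_frame {B e C : ℕ} {σ : Store} :
    ∀ a ∈ [0, 1, aOrd, aC, vPos, aLd, aLs], (searchCmd e C).exec B σ a = σ a := by
  intro a ha
  refine Cmd.exec_frame _ ?_ σ
  simp only [searchCmd, tryCmd, attemptCmd, groupCmd, modeCmd, groupStep, newItem, solveCmd,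
    initCmd, layerCmd, scanState, tryMove, moveCmd, loadRow, stepRow, keyRow, storeRow, copyCmd,
    pickState, Cmd.mods, Cmd.mods_set, Cmd.mods_repPow]
  revert a
  decide

theorem sortCmd_frame {B f : ℕ} {σ : Store} :
    ∀ a ∈ [0, 1, 2, vB, aW, vG, vDone, aPres, vPos, aLd, aLs], (sortCmd f).exec B σ a = σ a := by
  intro a ha
  refine Cmd.exec_frame _ ?_ σ
  simp only [sortCmd, sortStep, Cmd.mods, Cmd.mods_set]
  revert a
  decide

theorem powersCmd_frame {B : ℕ} {σ : Store} :
    ∀ a ∈ [0, 1, 2, vB, vCnt, vCls, vJob, vMax, vG, vDone, aPres, vPos, aLd, aLs],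
      powersCmd.exec B σ a = σ a := by
  intro a ha
  refine Cmd.exec_frame _ ?_ σ
  simp only [powersCmd, Cmd.mods, Cmd.mods_set]
  revert a
  decide

/-- The loads found, in units of the original sizes, exceed the optimum by a factor of at most
`1 + 25 / e`. -/
theorem mul_load_le {e y u T opt load : ℕ} (he : 2 ≤ e)
    (hy : 2 * e ^ 4 * (y * u) ≤ T) (hT : T ≤ 2 * e ^ 5 * opt) (hu : u ≤ opt)
    (hload : 2 * e ^ 5 * load ≤ (y + 1) * u * (2 * e ^ 4 + 24 * e ^ 3)) :
    e * load ≤ (e + 25) * opt := by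
  have h1 : 2 * e ^ 4 * ((y + 1) * u) ≤ 2 * e ^ 4 * ((e + 1) * opt) := by
    calc _ = 2 * e ^ 4 * (y * u) + 2 * e ^ 4 * u := by ring
      _ ≤ 2 * e ^ 5 * opt + 2 * e ^ 4 * opt := add_le_add (hy.trans hT) (by gcongr)
      _ = _ := by ring
  have h2 : (y + 1) * u ≤ (e + 1) * opt := Nat.le_of_mul_le_mul_left h1 (by positivity)
  have h3 : 2 * e ^ 4 * (e * load) ≤ 2 * e ^ 4 * ((e + 25) * opt) := by
    calc _ = 2 * e ^ 5 * load := by ring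
      _ ≤ (e + 1) * opt * (2 * e ^ 4 + 24 * e ^ 3) :=
        hload.trans (Nat.mul_le_mul_right _ h2)
      _ = 2 * e ^ 3 * ((e * e + 13 * e + 12) * opt) := by ring
      _ ≤ 2 * e ^ 3 * ((e * (e + 25)) * opt) := by gcongr; nlinarith
      _ = _ := by ring
  exact Nat.le_of_mul_le_mul_left h3 (by positivity)

/-- The output is a schedule of makespan at most `(1 + 25 / e) * opt`, where `B` is the number of
iterations of all loops, which is larger than the numbers of jobs, machines and classes. -/
theorem SetupInstance.exec_schemeCmd (I : SetupInstance) {e C B : ℕ} (he : 2 ≤ e)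
    (hCe : C = 2 * e ^ 4 + 24 * e ^ 3) (hB : I.n + I.k + (I.m + (2 * C + 4)) = B) :
    ∃ S : I.Schedule, S.IsOutput ((schemeCmd e C).exec B I.input) ∧ S.Feasible ∧
      e * S.makespan ≤ (e + 25) * I.opt := by
  have hn := I.n_pos
  have h00 : I.input 0 0 = I.n := rfl
  have h02 : I.input 0 2 = I.m := rfl
  have h03 : I.input 0 3 = I.s := rfl
  rw [schemeCmd]
  simp only [Cmd.exec_seq]
  obtain ⟨σ₁, hσ₁⟩ : ∃ σ₁, σ₁ = (Cmd.set vB (.add (.add (.get 0 (.lit 0)) (.get 0 (.lit 1)))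
    (.add (.get 0 (.lit 2)) (.lit (2 * C + 4))))).exec B I.input := ⟨_, rfl⟩
  rw [← hσ₁]
  have hf₁ : ∀ a, a ≠ vB → σ₁ a = I.input a := by
    intro a ha
    simp [hσ₁, Store.write_apply, ha]
  have hB₁ : σ₁ vB 0 = B := by
    rw [← hB]
    simp [hσ₁, Store.write_apply, input]
  have hz₁ : ∀ a, 5 < a → ∀ l, σ₁ a l = 0 := by
    intro a ha l
    rw [hf₁ a (by omega)]
    unfold input
    rw [if_neg (by omega), if_neg (by omega), if_neg (by omega)]
  have hW := exec_powersCmd (B := B) (hz₁ aW (by omega)) (hz₁ vDig (by omega) 0)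
  have hf₂ := powersCmd_frame (B := B) (σ := σ₁)
  generalize powersCmd.exec B σ₁ = σ₂ at *
  have h0 : σ₂ 0 = I.input 0 := by rw [hf₂ 0 (by decide), hf₁ 0 (by decide)]
  have h1 : σ₂ 1 = I.input 1 := by rw [hf₂ 1 (by decide), hf₁ 1 (by decide)]
  have h2 : σ₂ 2 = I.input 2 := by rw [hf₂ 2 (by decide), hf₁ 2 (by decide)]
  have hsort := exec_sortCmd (B := B) (f := 2 * e ^ 5) (σ := σ₂) (by rw [h0, h00]; omega)
    (by rw [hf₂ vCls (by decide)]; exact hz₁ _ (by omega) 0)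
    (by rw [hf₂ vCnt (by decide)]; exact hz₁ _ (by omega) 0)
    (by rw [hf₂ vMax (by decide)]; exact hz₁ _ (by omega) 0)
  have hcnt := hsort.cnt_eq (by
    rw [h0, h00, h2]
    intro l hl
    have := I.input_cls ⟨l, hl⟩
    have h3 := (I.cls ⟨l, hl⟩).2
    dsimp only at this
    omega)
  obtain ⟨-, -, -, -, -, hlt, hp, hc, hmem, hinj, hmono, hle, hmax⟩ := hsort
  rw [hcnt] at hlt hp hc hmem hinj hmono hle
  have hf₃ := sortCmd_frame (B := B) (f := 2 * e ^ 5) (σ := σ₂)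
  generalize (sortCmd (2 * e ^ 5)).exec B σ₂ = σ₃ at *
  simp only [Store.write_apply, Nat.reduceEqDiff, reduceIte, h0, h00, h1, h2]
    at hlt hp hc hmem hinj hmono hle hmax
  have hsurj : ∀ l < I.n, ∃ t < I.n, σ₃ aOrd t = l := by
    intro l hl
    refine (hmem l hl).1 (Or.inl ?_)
    have := I.input_cls ⟨l, hl⟩
    have h3 := (I.cls ⟨l, hl⟩).2
    dsimp only at this
    omega
  have hinj' : Set.InjOn (σ₃ aOrd) (Set.Iio I.n) := fun t ht t' ht' h => hinj t ht t' ht' h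
  have hmono' : MonotoneOn (σ₃ aC) (Set.Iio I.n) := fun t _ t' ht' h => hmono t t' h ht'
  obtain ⟨σ₄, hσ₄⟩ : ∃ σ₄, σ₄ = (Cmd.set vS (.smul (2 * e ^ 5) (.get 0 (.lit 3)))).exec B
    ((Cmd.set vU (.add (.get 0 (.lit 3)) (.var vMax))).exec B σ₃) := ⟨_, rfl⟩
  rw [← hσ₄]
  have hf₄ : ∀ a, a ≠ vS → a ≠ vU → σ₄ a = σ₃ a := by
    intro a ha ha'
    simp [hσ₄, Store.write_apply, ha, ha']
  have hU : σ₄ vU 0 = I.s + σ₃ vMax 0 := by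
    simp [hσ₄, Store.write_apply, hf₃ 0 (by decide), h0, h03]
  have hS : σ₄ vS 0 = 2 * e ^ 5 * I.s := by
    simp [hσ₄, Store.write_apply, hf₃ 0 (by decide), h0, h03]
  have hinput : ∀ a ∈ [0, 1, vG, vDone, aPres, vPos, aLd, aLs], σ₄ a = I.input a := by
    intro a ha
    rw [hf₄ a (by revert a; decide) (by revert a; decide), hf₃ a (by revert a; decide),
      hf₂ a (by revert a; decide), hf₁ a (by revert a; decide)]
  have hready : Ready B I.m I.n (σ₃ aP) (σ₃ aC) (2 * e ^ 5 * I.s) σ₄ := by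
    refine ⟨?_, ?_, by omega, by omega, ?_, ?_, ?_, ?_, hS, fun t ht => ?_, hmono', fun t ht => ?_⟩
    · rw [hinput 0 (by decide), h00]
    · rw [hinput 0 (by decide), h02]
    · rw [hf₄ vB (by decide) (by decide), hf₃ vB (by decide), hf₂ vB (by decide), hB₁]
    · rw [hf₄ aW (by decide) (by decide), hf₃ aW (by decide)]
      exact hW
    · exact hf₄ aP (by decide) (by decide)
    · exact hf₄ aC (by decide) (by decide)
    · have h3 := I.p_pos ⟨_, hlt t ht⟩
      rw [← input_p] at h3
      rw [hp t ht]
      positivity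
    · have h3 := (I.cls ⟨_, hlt t ht⟩).2
      rw [← input_cls] at h3
      rw [hc t ht]
      dsimp only at h3
      omega
  have hload : ∀ a i, mload (σ₃ aP) (σ₃ aC) (2 * e ^ 5 * I.s) (fib a I.n i) = 2 * e ^ 5 *
      mload (fun t => I.input 1 (σ₃ aOrd t)) (fun t => I.input 2 (σ₃ aOrd t)) I.s
        (fib a I.n i) := by
    intro a i
    rw [← mload_smul]
    exact mload_congr (fun t ht => hp t (mem_fib.1 ht).1) fun t ht => hc t (mem_fib.1 ht).1
  have hpmax : σ₃ vMax 0 ≤ I.pmax := hmax _ fun l hl => by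
    have := Finset.le_sup (f := I.p) (Finset.mem_univ ⟨l, hl⟩)
    rwa [← input_p] at this
  obtain ⟨a, ha, haload⟩ := I.exists_mload_le_opt hlt hinj'
  have hT : ∀ i, mload (fun t => I.input 1 (σ₃ aOrd t)) (fun t => I.input 2 (σ₃ aOrd t)) I.s
      (fib a I.n i) ≤ I.n * (I.s + σ₃ vMax 0) := fun i => mload_le_mul fun t ht => hle t ht
  -- the second bound on the loads guarantees that the scales tried out go up to this target
  obtain ⟨hf₅, y, hy, hpk⟩ := exec_searchCmd (B := B) (e := e) (C := C) (a := a) (σ := σ₄)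
    (T := 2 * e ^ 5 * min I.opt (I.n * (I.s + σ₃ vMax 0))) hready he hCe (by omega)
    (by have := I.s_pos; omega) hU (by rw [hinput vG (by decide)]; rfl)
    (by rw [hinput vDone (by decide)]; rfl) (by rw [hinput aPres (by decide)]; exact fun _ => rfl)
    ⟨ha, fun i _ => by
      rw [hload]
      exact Nat.mul_le_mul_left _ (le_min (haload i) (hT i))⟩ (by
      calc _ ≤ 2 * e ^ 5 * (I.n * (I.s + σ₃ vMax 0)) := Nat.mul_le_mul_left _ (min_le_right _ _)
        _ = 2 * e ^ 4 * (e * I.n * (I.s + σ₃ vMax 0)) := by ring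
        _ ≤ _ := by
          have : e ≤ e ^ 4 := Nat.le_self_pow (by decide) e
          gcongr <;> omega)
  have hf₆ := searchCmd_frame (B := B) (e := e) (C := C) (σ := σ₄)
  generalize (searchCmd e C).exec B σ₄ = σ₅ at *
  have hin₅ : ∀ a ∈ [0, 1, vPos, aLd, aLs], σ₅ a = I.input a := by
    intro a ha
    rw [hf₆ a (by revert a; decide), hinput a (by revert a; decide)]
  have hem := exec_rep_emitStep (B := B) (n := I.n) (s := I.s) (ord := σ₃ aOrd) (c := σ₃ aC)
    (p := I.input 1) (a := fun t => σ₅ aAsg (σ₅ aIt t)) (σ := σ₅) (by omega)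
    (by rw [hin₅ 0 (by decide), h00]) (by rw [hin₅ 0 (by decide), h03])
    (hin₅ 1 (by decide))
    (by rw [hf₆ aOrd (by decide), hf₄ aOrd (by decide) (by decide)])
    (by rw [hf₆ aC (by decide), hf₄ aC (by decide) (by decide)]) (fun _ => rfl) hinj'
    (by rw [hin₅ vPos (by decide)]; rfl) (by rw [hin₅ aLd (by decide)]; exact fun _ => rfl)
    (by rw [hin₅ aLs (by decide)]; exact fun _ => rfl)
  generalize (Cmd.rep emitStep).exec B σ₅ = τ at *
  have hmono₂ : MonotoneOn (fun t => I.input 2 (σ₃ aOrd t)) (Set.Iio I.n) := by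
    intro t ht t' ht' h
    dsimp only
    rw [← hc t ht, ← hc t' ht']
    exact hmono' ht ht' h
  obtain ⟨S, hS₁, hS₂, hS₃⟩ := I.exists_schedule (ord := σ₃ aOrd)
    (a := fun t => σ₅ aAsg (σ₅ aIt t)) (M := (e + 25) * I.opt / e) (τ := τ) hsurj hmono₂ hpk.1
    (fun i hi => by
      have h3 := hpk.2 i hi
      rw [hload, hCe] at h3
      rw [Nat.le_div_iff_mul_le (by omega), mul_comm]
      refine mul_load_le he hy (Nat.mul_le_mul_left _ (min_le_left _ _)) ?_ h3
      have := I.setup_add_pmax_le_opt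
      omega) fun t ht => by
      refine ⟨(hem t ht).1, (hem t ht).2.trans ?_⟩
      rw [lev_eq hmono' ht, lev_eq hmono₂ ht]
      exact mload_congr (fun _ _ => rfl) fun u hu => hc u ((mem_fib.1 hu).1.trans_le ht)
  exact ⟨S, hS₁, hS₂, (Nat.mul_le_mul_left e hS₃).trans (Nat.mul_div_le _ _)⟩

theorem SetupInstance.emb_input (I : SetupInstance) (a : ℕ) : I.input (emb a) = I.input a := by
  unfold emb
  split_ifs with h
  · rfl
  · unfold input
    funext l
    rw [if_neg (by omega), if_neg (by omega), if_neg (by omega), if_neg (by omega),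
      if_neg (by omega), if_neg (by omega)]

theorem mainTheorem1 (γ ε : ℝ) (hε : 0 < ε) :
    ∃ (P : RAM.Program) (q : Polynomial ℕ),
      ∀ I : SetupInstance, (∀ i : Fin I.k, (I.workload i : ℝ) ≤ γ * (I.opt : ℝ)) →
        ∃ (t : ℕ) (τ : RAM.Store),
          RAM.Runs P I.input t τ ∧
          t ≤ q.eval (I.n + I.k + I.m) ∧
          ∃ S : I.Schedule, S.IsOutput τ ∧ S.Feasible ∧
            (S.makespan : ℝ) ≤
              (1 + ε) * min (3 / 2 * (I.opt : ℝ)) ((I.opt : ℝ) + (I.pmax : ℝ) - 1) := by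
  obtain ⟨e, he, heε⟩ : ∃ e : ℕ, 2 ≤ e ∧ 25 ≤ ε * e := by
    obtain ⟨e, he⟩ := exists_nat_ge (25 / ε)
    rw [div_le_iff₀ hε] at he
    refine ⟨e + 2, by omega, ?_⟩
    push_cast
    nlinarith
  obtain ⟨C, hC⟩ : ∃ C, C = 2 * e ^ 4 + 24 * e ^ 3 := ⟨_, rfl⟩
  let bound : Expr := .add (.add (.get 0 (.lit 0)) (.get 0 (.lit 1)))
    (.add (.get 0 (.lit 2)) (.lit (2 * C + 4)))
  -- array `5` of the machine holds the bound and the counters of the loops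
  refine ⟨.seq (.put 5 (.lit 0) bound) ((schemeCmd e C).compile 0),
    .C ((Expr.lit 0).cost + bound.cost + 1) +
      (schemeCmd e C).time.comp (.X + .C (2 * C + 4)), fun I _ => ?_⟩
  obtain ⟨B, hB⟩ : ∃ B, I.n + I.k + (I.m + (2 * C + 4)) = B := ⟨_, rfl⟩
  have hbound : bound.eval I.input = B := by
    rw [← hB]
    simp [bound, SetupInstance.input]
  obtain ⟨t, τ, h1, h2, h3, -⟩ := (schemeCmd e C).runs_compile (B := B) 0 I.input
    (I.input.write 5 0 B) (fun a => by
      rw [Store.write_apply, if_neg (emb_ne_five a), I.emb_input]) (by simp [Store.write])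
  obtain ⟨S, hS₁, hS₂, hS₃⟩ := I.exec_schemeCmd he hC hB
  have hrun := Runs.seq (Runs.put 5 (.lit 0) bound I.input) (hbound.symm ▸ h1)
  refine ⟨_, τ, hrun, ?_, S, fun j => ?_, hS₂, ?_⟩
  · rw [Polynomial.eval_add, Polynomial.eval_C, Polynomial.eval_comp]
    refine Nat.add_le_add_left (h2.trans (le_of_eq ?_)) _
    simp only [Polynomial.eval_add, Polynomial.eval_X, Polynomial.eval_C]
    congr 1
    omega
  · have := hS₁ j
    rwa [← h3, ← h3] at this
  · -- as `pmax ≥ 1`, both terms of the minimum are at least `opt`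
    have hopt : (0 : ℝ) ≤ I.opt := Nat.cast_nonneg _
    have hpm : (1 : ℝ) ≤ I.pmax := by
      have h4 := I.p_pos ⟨0, I.n_pos⟩
      have h5 := Finset.le_sup (f := I.p) (Finset.mem_univ ⟨0, I.n_pos⟩)
      exact_mod_cast h4.trans_le h5
    have hmin : (I.opt : ℝ) ≤ min (3 / 2 * (I.opt : ℝ)) ((I.opt : ℝ) + (I.pmax : ℝ) - 1) :=
      le_min (by linarith) (by linarith)
    have he0 : (0 : ℝ) < e := by exact_mod_cast (by omega : 0 < e)
    have h6 : (e : ℝ) * S.makespan ≤ (e + 25) * I.opt := by exact_mod_cast hS₃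
    have h7 : (e : ℝ) * S.makespan ≤ e * ((1 + ε) * I.opt) := by nlinarith
    exact (le_of_mul_le_mul_left h7 he0).trans (mul_le_mul_of_nonneg_left hmin (by linarith))
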